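/- **Conventions.** Let $v_1,\dots,v_n\in\mathbb C^d$ be nonzero vectors, $\Pi_i=|v_i\rangle\langle v_i|/\langle v_i|v_i\rangle$, and let $G$ be their graph of orthogonality: the vertices are $1,\dots,n$, and $i\neq j$ are adjacent iff $\langle v_i|v_j\rangle=0$. Let $w_1,\dots,w_n>0$ be weights, and let $\alpha(G,w)$ be the largest value of $\sum_{i\in S}w_i$ over the independent sets $S$ of $G$. A $(\theta,\epsilon)$-*realization* in dimension $D$ is a family of orthogonal projectors $\Pi'_1,\dots,\Pi'_n$ on $\mathbb C^D$ such that, for all unit vectors $\psi\in\mathbb C^D$, $$\sum_{i=1}^n w_i\langle\psi|\Pi'_i|\psi\rangle\ \ge\ \theta\ >\ \alpha(G,w),\qquad \langle\psi|\Pi'_i\Pi'_j\Pi'_i|\psi\rangle\le\epsilon\ \text{ whenever } i,j \text{ are adjacent in } G .$$ **Four sets** ($q=e^{2\pi \mathrm i/3}$, $g=q^2$, $t=\sqrt2$, $\bar x=-x$; each vector is written as a row of components). * BBC-21 ($d=3$, $Q=40$, $\epsilon_0=0.132$). The first nine vectors have weight $4$: $(0,1,\bar1),(0,1,\bar q),(0,1,\bar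 g),(1,0,\bar1),(1,0,\bar q),(1,0,\bar g),(1,\bar1,0),(1,\bar q,0),(1,\bar g,0)$. The other twelve have weight $7$: $(1,0,0),(0,1,0),(0,0,1),(1,1,1),(1,q,g),(1,g,q),(1,1,q),(1,q,1),(1,g,g),(1,1,g),(1,q,q),(1,g,1)$. * CEG-18 ($d=4$, $Q=\frac92$, $\epsilon_0=0.134$, all weights $1$): $(1,0,0,0)$, $(0,1,0,0)$, $(0,0,1,0)$, $(0,0,0,1)$, $(1,1,0,0)$, $(1,\bar1,t,0)$, $(\bar1,1,t,0)$, $(1,1,0,t)$, $(t,0,1,\bar1)$, $(0,t,\bar1,\bar1)$, $(t,0,\bar1,1)$, $(\bar1,1,0,t)$, $(1,1,t,0)$, $(1,\bar1,0,t)$, $(t,0,\bar1,\bar1)$, $(0,t,\bar1,1)$, $(0,t,1,\bar1)$, $(0,0,1,1)$. * Peres-24 ($d=4$, $Q=6$, $\epsilon_0=0.177$, all weights $1$): $(1,0,0,0)$, $(0,1,0,0)$, $(0,0,1,0)$, $(0,0,0,1)$, $(1,1,1,1)$, $(1,1,\bar1,\bar1)$, $(1,\bar1,1,\bar1)$, $(1,\bar1,\bar1,1)$,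 $(1,1,1,\bar1)$, $(1,1,\bar1,1)$, $(1,\bar1,1,1)$, $(\bar1,1,1,1)$, $(1,1,0,0)$, $(1,\bar1,0,0)$, $(0,0,1,1)$, $(0,0,1,\bar1)$, $(1,0,1,0)$, $(1,0,\bar1,0)$, $(0,1,0,1)$, $(0,1,0,\bar1)$, $(1,0,0,1)$, $(1,0,0,\bar1)$, $(0,1,1,0)$, $(0,1,\bar1,0)$. * YO-13 ($d=3$, $Q=\frac{35}3$, $\epsilon_0=0.208$). The first nine vectors have weight $3$: $(1,0,0),(0,1,0),(0,0,1),(0,1,1),(0,1,\bar1),(1,0,1),(1,0,\bar1),(1,1,0),(1,\bar1,0)$. The other four have weight $2$: $(1,1,1),(1,1,\bar1),(\bar1,1,1),(1,\bar1,1)$. **Statement.** For each of these sets, the ideal family $(\Pi_i)$ is a $(Q,0)$-realization in dimension $d$, and the witness with weights $w$ provides $(\epsilon,\frac12)$-robust certification of it for $\epsilon<\epsilon_0$, in the following sense. There is a constant $C$ such that, for every $0\le\epsilon<\epsilon_0$, every $D\in\mathbb N$ and every $(Q-\epsilon,\epsilon)$-realization $(\Pi'_i)$ in dimension $D$, there are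 integers $m_1,m_2\ge0$ with $m_1+m_2=\lfloor D/d\rfloor$ and an isometry $V:(\mathbb C^d\otimes\mathbb C^{m_1})\oplus(\mathbb C^d\otimes\mathbb C^{m_2})\to\mathbb C^D$ (hence a unitary if $d\mid D$) such that $$\bigl\|\,V\bigl(\Pi_i\otimes\mathbb 1_{m_1}\,\oplus\,\Pi_i^{*}\otimes\mathbb 1_{m_2}\bigr)V^\dagger-\Pi'_i\,\bigr\|\ \le\ C\,\epsilon^{1/2}\qquad(i=1,\dots,n),$$ where $\|\cdot\|$ is the operator norm and $\Pi_i^*$ is the entrywise complex conjugate of $\Pi_i$ (for the three real sets $\Pi_i^*=\Pi_i$, so the ideal operators are $\Pi_i\otimes\mathbb 1_{\lfloor D/d\rfloor}$ up to reordering the basis). For YO-13 this is asserted for those realizations that satisfy in addition $\langle\psi|\Pi'_i|\psi\rangle+\langle\psi|\Pi'_j|\psi\rangle+\langle\psi|\Pi'_k|\psi\rangle=1$ for all unit vectors $\psi$ and all pairwise adjacent vertices $i,j,k$ of $G$; the ideal family of YO-13 satisfies this too. -/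

import Mathlib

open scoped Matrix Kronecker

noncomputable section

namespace CFR

/-! ### Vectors, states, projectors -/

/-- The orthogonal projector `|v⟩⟨v| / ⟨v|v⟩` onto the line spanned by a (nonzero, possibly
unnormalised) vector `v`. -/
def rankOneProj {d : ℕ} (v : Fin d → ℂ) : Matrix (Fin d) (Fin d) ℂ :=
  (star v ⬝ᵥ v)⁻¹ • Matrix.vecMulVec v (star v)

/-- `ψ` is a (pure) state: a unit vector of `ℂ^D`. -/
def IsState {D : ℕ} (ψ : Fin D → ℂ) : Prop := star ψ ⬝ᵥ ψ = 1

/-- The expectation value `⟨ψ|A|ψ⟩` (a real number when `A` is Hermitian). -/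
def expect {D : ℕ} (A : Matrix (Fin D) (Fin D) ℂ) (ψ : Fin D → ℂ) : ℝ :=
  (star ψ ⬝ᵥ (A *ᵥ ψ)).re

/-- The operator norm (largest singular value) of a square matrix acting on the Hilbert space
`ℂ^D`. -/
def opNorm {D : ℕ} (A : Matrix (Fin D) (Fin D) ℂ) : ℝ :=
  ‖Matrix.toEuclideanCLM (𝕜 := ℂ) A‖

/-! ### Graphs of orthogonality and realizations -/

/-- The graph of orthogonality (compatibility) of a family of vectors. -/
def orthGraph {n d : ℕ} (v : Fin n → Fin d → ℂ) : SimpleGraph (Fin n) where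
  Adj i j := i ≠ j ∧ star (v i) ⬝ᵥ v j = 0
  symm := ⟨fun i j h => ⟨h.1.symm, by
    have h2 := congrArg star h.2
    rwa [Matrix.star_dotProduct, star_star, star_zero] at h2⟩⟩
  loopless := ⟨fun _ h => h.1 rfl⟩

/-- The weighted independence number `α(G, w)`: the maximum of `∑ i ∈ s, w i` over all independent
sets `s` of `G`. -/
def weightedIndepNum {n : ℕ} (G : SimpleGraph (Fin n)) (w : Fin n → ℝ) : ℝ :=
  sSup {x | ∃ s : Finset (Fin n), G.IsIndepSet (s : Set (Fin n)) ∧ x = ∑ i ∈ s, w i}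

/-- `P` is a `(θ, ε)`-realization, in dimension `D`, of a set with graph of compatibility `G`,
with respect to the witness with vertex weights `w`. -/
structure IsRealization {n D : ℕ} (G : SimpleGraph (Fin n)) (w : Fin n → ℝ) (θ ε : ℝ)
    (P : Fin n → Matrix (Fin D) (Fin D) ℂ) : Prop where
  isProj : ∀ i, IsStarProjection (P i)
  lt_theta : weightedIndepNum G w < θ
  theta_le : ∀ ψ, IsState ψ → θ ≤ ∑ i, w i * expect (P i) ψ
  le_eps : ∀ i j, G.Adj i j → ∀ ψ, IsState ψ → expect (P i * P j * P i) ψ ≤ ε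

/-- In every state, the probabilities of any three projectors whose labels are pairwise adjacent
in `G` (i.e. that are mutually orthogonal in the ideal set) sum to `1`. -/
def NormalizedTriples {n D : ℕ} (G : SimpleGraph (Fin n))
    (P : Fin n → Matrix (Fin D) (Fin D) ℂ) : Prop :=
  ∀ i j k, G.Adj i j → G.Adj i k → G.Adj j k →
    ∀ ψ, IsState ψ → expect (P i) ψ + expect (P j) ψ + expect (P k) ψ = 1

/-- The matrix `A ⊗ 𝟙_{m₁} ⊕ A^* ⊗ 𝟙_{m₂}`, where `A^*` is the entrywise complex conjugate of `A`.
For a real matrix `A` this is `A ⊗ 𝟙_{m₁ + m₂}`, up to a reordering of the basis. -/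
def amplify {d : ℕ} (m₁ m₂ : ℕ) (A : Matrix (Fin d) (Fin d) ℂ) :
    Matrix ((Fin d × Fin m₁) ⊕ (Fin d × Fin m₂)) ((Fin d × Fin m₁) ⊕ (Fin d × Fin m₂)) ℂ :=
  Matrix.fromBlocks (A ⊗ₖ (1 : Matrix (Fin m₁) (Fin m₁) ℂ)) 0
    0 (A.map star ⊗ₖ (1 : Matrix (Fin m₂) (Fin m₂) ℂ))

/-- The witness with weights `w` on the graph of orthogonality of the vectors `v` provides an
`(ε, r)`-robust certification, for all `ε < ε₀`, of the `(Q, 0)`-realization `|v i⟩⟨v i| / ⟨v i|v i⟩`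
among the realizations that satisfy the extra condition `extra`: there is a constant `C` such
that, for `0 ≤ ε < ε₀`, each `(Q - ε, ε)`-realization `P` with `extra P`, in any finite
dimension `D`, is within `C * ε ^ r`, in operator norm, of the image of the ideal projectors under
`A ↦ V (A ⊗ 𝟙_{m₁} ⊕ A^* ⊗ 𝟙_{m₂}) V†`, where `V` is an isometry and `m₁ + m₂ = ⌊D / d⌋`.
If `d` divides `D`, then `V` is a square matrix, hence unitary. -/
def RobustCFR {n d : ℕ} (v : Fin n → Fin d → ℂ) (w : Fin n → ℝ) (Q : ℝ)
    (extra : ∀ {D : ℕ}, (Fin n → Matrix (Fin D) (Fin D) ℂ) → Prop) (ε₀ r : ℝ) : Prop :=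
  (IsRealization (orthGraph v) w Q 0 (fun i => rankOneProj (v i)) ∧
    extra (fun i => rankOneProj (v i))) ∧
  ∃ C : ℝ, ∀ ε : ℝ, 0 ≤ ε → ε < ε₀ →
    ∀ (D : ℕ) (P : Fin n → Matrix (Fin D) (Fin D) ℂ),
      IsRealization (orthGraph v) w (Q - ε) ε P → extra P →
      ∃ m₁ m₂ : ℕ, m₁ + m₂ = D / d ∧
        ∃ V : Matrix (Fin D) ((Fin d × Fin m₁) ⊕ (Fin d × Fin m₂)) ℂ, Vᴴ * V = 1 ∧
          ∀ i, opNorm (V * amplify m₁ m₂ (rankOneProj (v i)) * Vᴴ - P i) ≤ C * ε ^ r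

/-! ### The four sets: the vectors are the columns of the matrices -/

/-- The primitive cube root of unity `e^{2πi/3}`. -/
def q : ℂ := Complex.exp (2 * Real.pi * Complex.I / 3)

/-- The square of `q`. -/
def g : ℂ := q ^ 2

/-- The real number `√2`, as a complex number. -/
def t : ℂ := (Real.sqrt 2 : ℝ)

/-- The vectors of BBC-21. -/
def bbc21 (i : Fin 21) (a : Fin 3) : ℂ :=
  (!![0, 0, 0, 1, 1, 1, 1, 1, 1, 1, 0, 0, 1, 1, 1, 1, 1, 1, 1, 1, 1;
      1, 1, 1, 0, 0, 0, -1, -q, -g, 0, 1, 0, 1, q, g, 1, q, g, 1, q, g;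
      -1, -q, -g, -1, -q, -g, 0, 0, 0, 0, 0, 1, 1, g, q, q, 1, g, g, q, 1] :
    Matrix (Fin 3) (Fin 21) ℂ) a i

/-- The weights of BBC-21. -/
def bbc21Weight : Fin 21 → ℝ :=
  ![4, 4, 4, 4, 4, 4, 4, 4, 4, 7, 7, 7, 7, 7, 7, 7, 7, 7, 7, 7, 7]

/-- The vectors of CEG-18. -/
def ceg18 (i : Fin 18) (a : Fin 4) : ℂ :=
  (!![1, 0, 0, 0, 1, 1, -1, 1, t, 0, t, -1, 1, 1, t, 0, 0, 0;
      0, 1, 0, 0, 1, -1, 1, 1, 0, t, 0, 1, 1, -1, 0, t, t, 0;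
      0, 0, 1, 0, 0, t, t, 0, 1, -1, -1, 0, t, 0, -1, -1, 1, 1;
      0, 0, 0, 1, 0, 0, 0, t, -1, -1, 1, t, 0, t, -1, 1, -1, 1] :
    Matrix (Fin 4) (Fin 18) ℂ) a i

/-- The vectors of Peres-24. -/
def peres24 (i : Fin 24) (a : Fin 4) : ℂ :=
  (!![1, 0, 0, 0, 1, 1, 1, 1, 1, 1, 1, -1, 1, 1, 0, 0, 1, 1, 0, 0, 1, 1, 0, 0;
      0, 1, 0, 0, 1, 1, -1, -1, 1, 1, -1, 1, 1, -1, 0, 0, 0, 0, 1, 1, 0, 0, 1, 1;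
      0, 0, 1, 0, 1, -1, 1, -1, 1, -1, 1, 1, 0, 0, 1, 1, 1, -1, 0, 0, 0, 0, 1, -1;
      0, 0, 0, 1, 1, -1, -1, 1, -1, 1, 1, 1, 0, 0, 1, -1, 0, 0, 1, -1, 1, -1, 0, 0] :
    Matrix (Fin 4) (Fin 24) ℂ) a i

/-- The vectors of YO-13. -/
def yo13 (i : Fin 13) (a : Fin 3) : ℂ :=
  (!![1, 0, 0, 0, 0, 1, 1, 1, 1, 1, 1, -1, 1;
      0, 1, 0, 1, 1, 0, 0, 1, -1, 1, 1, 1, -1;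
      0, 0, 1, 1, -1, 1, -1, 0, 0, 1, -1, 1, 1] :
    Matrix (Fin 3) (Fin 13) ℂ) a i

/-- The weights of YO-13. -/
def yo13Weight : Fin 13 → ℝ := ![3, 3, 3, 3, 3, 3, 3, 3, 3, 2, 2, 2, 2]

end CFR

end

/-!
The theorem holds because, for each of the four sets, the relations between the ideal projections
determine them up to multiplicity (and, for BBC-21, up to complex conjugation), and because this
rigidity is stable: projections on `ℂ^D` that satisfy the relations up to an error `η` are within
`O(η)` of an exact solution, with a constant that does not depend on `D`. What has to be shown in
addition is that a `(Q - ε, ε)`-realization satisfies the relations up to `O(√ε)`.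

*Stability from exact rigidity.* Uniformly bounded families of matrices, of arbitrary sizes, modulo
the families that are `O(η)` form a `*`-algebra (`AsymptoticAlgebra`). Taking the family of all
approximate solutions at once, one obtains elements of this algebra that satisfy the relations
exactly. If it can be shown by algebra alone that such elements are the ideal projections written in
some system of matrix units, then approximate matrix units exist in the matrices themselves, and
`exists_unitary_near` rounds them to genuine ones: the spectral theorem makes the corner `e₀₀` an
honest projection and the polar decomposition makes a near isometry an isometry. The matrix units are
graded (`GradedMatrixUnits`): they come with a symmetry `c` that commutes with them and multiplies the
imaginary parts of the coefficients, so that its eigenspaces for `1` and `-1` carry the copies of `Π`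
and of its conjugate. The
combination of these steps is `RigidSystem.exists_isNear_of_approx`.

*Exact rigidity.* For Peres-24 (`exists_peres_units`) the differences of the two projections on
`e_i ± e_j` swap two coordinates and annihilate the others; the remaining bases express their products,
and hence they generate matrix units. CEG-18 is a part of Peres-24 in rotated coordinates, and its
relations determine the six missing projections (`exists_ceg_units`). For YO-13 (`exists_yo_units`) the
analogous swaps satisfy anticommutation relations. For BBC-21 (`exists_bbc_units`) the twelve rays
of weight `7` are the lines of the affine plane over the field with three elements. The Fourier
transforms of the four bases that they form satisfy the Weyl commutation relations up to a central
primitive cube root of unity `u` (`exists_central_phase`), and `u` gives the grading.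

*Approximate relations for the two Kochen-Specker sets.* The witness is a multiple of the
sum over all bases. A sum of nearly orthogonal projections is at most `1 + O(√ε)`, so that, if the
value of the witness is nearly maximal, each basis must nearly sum to `1` (`norm_clique_sub_one_le`).

*Approximate relations for YO-13 and BBC-21.* Here the value `Q` arises from a sum of squares,
whose terms measure the failure of the relations. A realization makes this sum small up to
terms such as `P_i P_j` with `i`, `j` adjacent (`HasSmallDefect`, `expect_defect_le`); these are only
`O(√ε)`, and would lead to an error of order `ε^(1/4)`. But this weaker estimate already puts the
realization near an exact solution, and there these first-order terms vanish on average over the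
`d` basis vectors of each copy of the ideal family (`norm_sq_le_of_first_order`), because they are of the
form `A Z B` with `B A = 0` in the ideal family. The remaining terms are of second order, and the error
is `O(√ε)` after all (`RigidSystem.exists_isNear_of_hasSmallDefect`).

For `ε` away from `0` the estimate is trivial with a large constant (`robustCFR_of_small`), and the
ideal families are realizations because bases sum to `1` and because independent sets can be counted
basis by basis.
-/

/-! ### Expectation values and the operator norm -/

namespace CFR

open scoped Matrix.Norms.L2Operator

section Expect

variable {D : ℕ}

lemma opNorm_eq_norm (A : Matrix (Fin D) (Fin D) ℂ) : opNorm A = ‖A‖ := rfl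

lemma expect_add (A B : Matrix (Fin D) (Fin D) ℂ) (ψ : Fin D → ℂ) :
    expect (A + B) ψ = expect A ψ + expect B ψ := by
  simp [expect, Matrix.add_mulVec]

lemma expect_sub (A B : Matrix (Fin D) (Fin D) ℂ) (ψ : Fin D → ℂ) :
    expect (A - B) ψ = expect A ψ - expect B ψ := by
  simp [expect, Matrix.sub_mulVec]

lemma expect_smul (c : ℝ) (A : Matrix (Fin D) (Fin D) ℂ) (ψ : Fin D → ℂ) :
    expect (c • A) ψ = c * expect A ψ := by
  simp [expect, Matrix.smul_mulVec]

lemma expect_zero (ψ : Fin D → ℂ) : expect (0 : Matrix (Fin D) (Fin D) ℂ) ψ = 0 := by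
  simp [expect]

lemma expect_sum {ι : Type*} (s : Finset ι) (A : ι → Matrix (Fin D) (Fin D) ℂ) (ψ : Fin D → ℂ) :
    expect (∑ i ∈ s, A i) ψ = ∑ i ∈ s, expect (A i) ψ := by
  classical
  induction s using Finset.induction_on with
  | empty => simp [expect_zero]
  | insert a s ha ih => rw [Finset.sum_insert ha, Finset.sum_insert ha, expect_add, ih]

lemma expect_one {ψ : Fin D → ℂ} (h : IsState ψ) :
    expect (1 : Matrix (Fin D) (Fin D) ℂ) ψ = 1 := by
  have h' : star ψ ⬝ᵥ ψ = 1 := h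
  simp [expect, h']

lemma inner_toLp {n : Type*} [Fintype n] (x y : n → ℂ) :
    inner ℂ (WithLp.toLp 2 x : EuclideanSpace ℂ n) (WithLp.toLp 2 y) = star x ⬝ᵥ y := by
  rw [EuclideanSpace.inner_eq_star_dotProduct, dotProduct_comm]

lemma norm_toLp_sq {n : Type*} [Fintype n] (x : n → ℂ) :
    ‖(WithLp.toLp 2 x : EuclideanSpace ℂ n)‖ ^ 2 = (star x ⬝ᵥ x).re := by
  rw [← inner_toLp, ← inner_self_eq_norm_sq (𝕜 := ℂ)]; rfl

lemma isState_iff_norm {ψ : Fin D → ℂ} :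
    IsState ψ ↔ ‖(WithLp.toLp 2 ψ : EuclideanSpace ℂ (Fin D))‖ = 1 := by
  have h1 : inner ℂ (WithLp.toLp 2 ψ : EuclideanSpace ℂ (Fin D)) (WithLp.toLp 2 ψ)
      = star ψ ⬝ᵥ ψ := inner_toLp ψ ψ
  rw [inner_self_eq_norm_sq_to_K] at h1
  replace h1 : ((‖(WithLp.toLp 2 ψ : EuclideanSpace ℂ (Fin D))‖ : ℝ) : ℂ) ^ 2 = star ψ ⬝ᵥ ψ := h1
  rw [IsState, ← h1]
  have hn := norm_nonneg (WithLp.toLp 2 ψ : EuclideanSpace ℂ (Fin D))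
  constructor
  · intro h
    have h2 : ‖(WithLp.toLp 2 ψ : EuclideanSpace ℂ (Fin D))‖ ^ 2 = 1 := by exact_mod_cast h
    exact (pow_eq_one_iff_of_nonneg hn two_ne_zero).1 h2
  · intro h; rw [h]; simp

lemma norm_toLp_mulVec_le {m n : Type*} [Fintype m] [Fintype n] [DecidableEq n]
    (A : Matrix m n ℂ) (x : n → ℂ) :
    ‖(WithLp.toLp 2 (A *ᵥ x) : EuclideanSpace ℂ m)‖
      ≤ ‖A‖ * ‖(WithLp.toLp 2 x : EuclideanSpace ℂ n)‖ :=
  Matrix.l2_opNorm_mulVec A (WithLp.toLp 2 x)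

lemma norm_le_of_mulVec {m n : Type*} [Fintype m] [Fintype n] [DecidableEq n]
    (A : Matrix m n ℂ) {c : ℝ} (hc : 0 ≤ c)
    (h : ∀ x : n → ℂ, ‖(WithLp.toLp 2 (A *ᵥ x) : EuclideanSpace ℂ m)‖
      ≤ c * ‖(WithLp.toLp 2 x : EuclideanSpace ℂ n)‖) : ‖A‖ ≤ c := by
  rw [Matrix.l2_opNorm_def]
  refine ContinuousLinearMap.opNorm_le_bound _ hc fun x => ?_
  exact h x.ofLp

lemma abs_dotProduct_mulVec_le {m n : Type*} [Fintype m] [Fintype n] [DecidableEq n]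
    (A : Matrix m n ℂ) (x : m → ℂ) (y : n → ℂ) :
    ‖star x ⬝ᵥ A *ᵥ y‖ ≤ ‖A‖ * ‖(WithLp.toLp 2 x : EuclideanSpace ℂ m)‖
      * ‖(WithLp.toLp 2 y : EuclideanSpace ℂ n)‖ := by
  rw [← inner_toLp]
  refine (norm_inner_le_norm _ _).trans ?_
  have := norm_toLp_mulVec_le A y
  nlinarith [norm_nonneg (WithLp.toLp 2 x : EuclideanSpace ℂ m)]

lemma abs_expect_le_norm (A : Matrix (Fin D) (Fin D) ℂ) {ψ : Fin D → ℂ} (h : IsState ψ) :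
    |expect A ψ| ≤ ‖A‖ := by
  have := abs_dotProduct_mulVec_le A ψ ψ
  rw [isState_iff_norm.1 h, mul_one, mul_one] at this
  exact (Complex.abs_re_le_norm _).trans this

lemma expect_conjTranspose_mul_self (A : Matrix (Fin D) (Fin D) ℂ) (ψ : Fin D → ℂ) :
    expect (Aᴴ * A) ψ = ‖(WithLp.toLp 2 (A *ᵥ ψ) : EuclideanSpace ℂ (Fin D))‖ ^ 2 := by
  rw [norm_toLp_sq, expect, ← Matrix.mulVec_mulVec, Matrix.star_mulVec, ← Matrix.dotProduct_mulVec]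

lemma expect_conjTranspose_mul_self_nonneg (A : Matrix (Fin D) (Fin D) ℂ) (ψ : Fin D → ℂ) :
    0 ≤ expect (Aᴴ * A) ψ := by
  rw [expect_conjTranspose_mul_self]; positivity

/-- A homogeneous bound may be checked on unit vectors. -/
lemma le_of_forall_isState {f : (Fin D → ℂ) → ℝ} {c : ℝ}
    (hf : ∀ (r : ℝ) (x : Fin D → ℂ), 0 ≤ r → f ((r : ℂ) • x) = r * f x)
    (h : ∀ ψ, IsState ψ → f ψ ≤ c) (x : Fin D → ℂ) :
    f x ≤ c * ‖(WithLp.toLp 2 x : EuclideanSpace ℂ (Fin D))‖ := by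
  set r := ‖(WithLp.toLp 2 x : EuclideanSpace ℂ (Fin D))‖ with hr
  rcases eq_or_ne r 0 with h0 | h0
  · have hx : x = 0 := by
      have := norm_eq_zero.1 (hr.symm.trans h0)
      simpa using this
    have := hf 0 x le_rfl
    simp only [Complex.ofReal_zero, zero_smul, zero_mul] at this
    rw [h0, hx, this]; simp
  · have hrpos : 0 < r := lt_of_le_of_ne (norm_nonneg _) (Ne.symm h0)
    have hst : IsState (((r⁻¹ : ℝ) : ℂ) • x) := by
      rw [isState_iff_norm, WithLp.toLp_smul, norm_smul, ← hr]
      simp [abs_of_pos hrpos, h0]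
    have := h _ hst
    rw [hf _ _ (by positivity)] at this
    rw [inv_mul_le_iff₀ hrpos] at this
    linarith

lemma norm_sq_le_of_expect (A : Matrix (Fin D) (Fin D) ℂ) {c : ℝ} (hc : 0 ≤ c)
    (h : ∀ ψ, IsState ψ → expect (Aᴴ * A) ψ ≤ c) : ‖A‖ ^ 2 ≤ c := by
  have h1 : ‖A‖ ≤ √c := by
    refine norm_le_of_mulVec A (Real.sqrt_nonneg c) ?_
    refine le_of_forall_isState (f := fun x => ‖(WithLp.toLp 2 (A *ᵥ x) : EuclideanSpace ℂ (Fin D))‖)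
      ?_ ?_
    · intro r x hr
      simp only [Matrix.mulVec_smul, WithLp.toLp_smul, norm_smul]
      simp [abs_of_nonneg hr]
    · intro ψ hψ
      have := h ψ hψ
      rw [expect_conjTranspose_mul_self] at this
      exact Real.le_sqrt_of_sq_le this
  calc ‖A‖ ^ 2 ≤ √c ^ 2 := by gcongr
    _ = c := Real.sq_sqrt hc

lemma norm_le_of_abs_expect {A : Matrix (Fin D) (Fin D) ℂ} (hA : A.IsHermitian) {c : ℝ}
    (hc : 0 ≤ c) (h : ∀ ψ, IsState ψ → |expect A ψ| ≤ c) : ‖A‖ ≤ c := by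
  rw [Matrix.cstar_norm_def]
  have hsym : (Matrix.toEuclideanCLM (n := Fin D) (𝕜 := ℂ) A).IsSymmetric :=
    Matrix.isSymmetric_toEuclideanLin_iff.2 hA
  rw [ContinuousLinearMap.norm_eq_iSup_rayleighQuotient _ hsym]
  refine ciSup_le fun x => ?_
  rcases eq_or_ne x 0 with rfl | hx
  · simpa using hc
  have hpos : 0 < ‖x‖ := norm_pos_iff.2 hx
  have hst : IsState (((‖x‖⁻¹ : ℝ) : ℂ) • x.ofLp) := by
    rw [isState_iff_norm, WithLp.toLp_smul, norm_smul]
    simp [hx]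
  have h2 := h _ hst
  have h3 : ContinuousLinearMap.rayleighQuotient
      (Matrix.toEuclideanCLM (n := Fin D) (𝕜 := ℂ) A) x = expect A (((‖x‖⁻¹ : ℝ) : ℂ) • x.ofLp) := by
    rw [← ContinuousLinearMap.rayleigh_smul (𝕜 := ℂ) _ x
      (c := ((‖x‖⁻¹ : ℝ) : ℂ)) (by simpa using hx)]
    rw [ContinuousLinearMap.rayleighQuotient, ContinuousLinearMap.reApplyInnerSelf_apply]
    have : ‖((‖x‖⁻¹ : ℝ) : ℂ) • x‖ = 1 := isState_iff_norm.1 hst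
    rw [this, one_pow, div_one, expect, ← inner_toLp, ← inner_conj_symm]
    exact Complex.conj_re _
  rw [h3]; exact h2

end Expect

end CFR


/-! ### Functions of a Hermitian matrix -/

namespace CFR

open scoped Matrix.Norms.L2Operator

section SpectralFunction

variable {n : Type*} [Fintype n] [DecidableEq n] {H : Matrix n n ℂ}

/-- The matrix `f(H)`, for a Hermitian matrix `H` and a real function `f` on its eigenvalues. -/
noncomputable def spectralFun (hH : H.IsHermitian) (f : ℝ → ℝ) : Matrix n n ℂ :=
  (hH.eigenvectorUnitary : Matrix n n ℂ) *
    Matrix.diagonal (fun i => ((f (hH.eigenvalues i) : ℝ) : ℂ)) *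
    star (hH.eigenvectorUnitary : Matrix n n ℂ)

lemma spectralFun_id (hH : H.IsHermitian) : spectralFun hH id = H := by
  conv_rhs => rw [hH.spectral_theorem]
  rw [Unitary.conjStarAlgAut_apply]
  rfl

lemma spectralFun_one (hH : H.IsHermitian) : spectralFun hH (fun _ => 1) = 1 := by
  simp [spectralFun]

lemma spectralFun_mul (hH : H.IsHermitian) (f g : ℝ → ℝ) :
    spectralFun hH f * spectralFun hH g = spectralFun hH (fun x => f x * g x) := by
  have h : star (hH.eigenvectorUnitary : Matrix n n ℂ) * (hH.eigenvectorUnitary : Matrix n n ℂ) = 1 :=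
    Unitary.coe_star_mul_self _
  simp only [spectralFun]
  calc _ = (hH.eigenvectorUnitary : Matrix n n ℂ) *
        Matrix.diagonal (fun i => ((f (hH.eigenvalues i) : ℝ) : ℂ)) *
        (star (hH.eigenvectorUnitary : Matrix n n ℂ) * (hH.eigenvectorUnitary : Matrix n n ℂ)) *
        Matrix.diagonal (fun i => ((g (hH.eigenvalues i) : ℝ) : ℂ)) *
        star (hH.eigenvectorUnitary : Matrix n n ℂ) := by simp only [mul_assoc]
    _ = _ := by
      rw [h, mul_one]
      simp only [mul_assoc]
      rw [← mul_assoc (Matrix.diagonal _) (Matrix.diagonal _), Matrix.diagonal_mul_diagonal]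
      simp

lemma spectralFun_sub (hH : H.IsHermitian) (f g : ℝ → ℝ) :
    spectralFun hH f - spectralFun hH g = spectralFun hH (fun x => f x - g x) := by
  simp only [spectralFun]
  rw [← sub_mul, ← mul_sub, Matrix.diagonal_sub]
  simp

lemma star_spectralFun (hH : H.IsHermitian) (f : ℝ → ℝ) :
    (spectralFun hH f)ᴴ = spectralFun hH f := by
  simp only [spectralFun, Matrix.star_eq_conjTranspose, Matrix.conjTranspose_mul,
    Matrix.conjTranspose_conjTranspose, Matrix.diagonal_conjTranspose, mul_assoc]
  congr 3
  ext i
  simp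

lemma norm_spectralFun (hH : H.IsHermitian) (f : ℝ → ℝ) :
    ‖spectralFun hH f‖ = ‖fun i => f (hH.eigenvalues i)‖ := by
  rw [spectralFun, ← Unitary.coe_star, CStarRing.norm_mul_coe_unitary,
    CStarRing.norm_coe_unitary_mul, Matrix.l2_opNorm_diagonal]
  simp [Pi.norm_def]

lemma norm_spectralFun_le (hH : H.IsHermitian) {f : ℝ → ℝ} {c : ℝ} (hc : 0 ≤ c)
    (h : ∀ i, |f (hH.eigenvalues i)| ≤ c) : ‖spectralFun hH f‖ ≤ c := by
  rw [norm_spectralFun]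
  exact (pi_norm_le_iff_of_nonneg hc).2 h

lemma abs_le_norm_spectralFun (hH : H.IsHermitian) (f : ℝ → ℝ) (i : n) :
    |f (hH.eigenvalues i)| ≤ ‖spectralFun hH f‖ := by
  rw [norm_spectralFun]
  exact norm_le_pi_norm (fun i => f (hH.eigenvalues i)) i

end SpectralFunction

/-- A matrix that is nearly an isometry is near an isometry: the polar decomposition. -/
lemma exists_isometry_near {m n : Type*} [Fintype m] [DecidableEq m] [Fintype n] [DecidableEq n]
    (V : Matrix m n ℂ) {κ : ℝ} (hκ : κ ≤ 1 / 2) (h : ‖Vᴴ * V - 1‖ ≤ κ) :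
    ∃ V' : Matrix m n ℂ, V'ᴴ * V' = 1 ∧ ‖V' - V‖ ≤ 2 * κ := by
  set H := Vᴴ * V with hHdef
  have hH : H.IsHermitian := Matrix.isHermitian_conjTranspose_mul_self V
  have hκ0 : 0 ≤ κ := (norm_nonneg _).trans h
  have hev : ∀ i, |hH.eigenvalues i - 1| ≤ κ := fun i => by
    have h1 : spectralFun hH (fun x => x - 1) = H - 1 := by
      have := spectralFun_sub hH id (fun _ => 1)
      rw [spectralFun_id, spectralFun_one] at this
      exact this.symm
    calc _ ≤ ‖spectralFun hH (fun x => x - 1)‖ := abs_le_norm_spectralFun hH (fun x => x - 1) i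
      _ ≤ κ := by rw [h1]; exact h
  have hpos : ∀ i, 1 / 2 ≤ hH.eigenvalues i := fun i => by
    have := abs_le.1 (hev i); linarith
  -- polar decomposition: `V (Vᴴ V)^(-1/2)` is an isometry
  set G := spectralFun hH (fun x => (√x)⁻¹) with hG
  have hGH : G * H * G = 1 := by
    conv_lhs => rw [← spectralFun_id hH, hG]
    rw [spectralFun_mul, spectralFun_mul, ← spectralFun_one hH]
    simp only [spectralFun]
    congr 3
    ext i
    have h0 : 0 < hH.eigenvalues i := by linarith [hpos i]
    have hs : 0 < √(hH.eigenvalues i) := Real.sqrt_pos.2 h0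
    norm_cast
    have := Real.mul_self_sqrt h0.le
    field_simp
    simp only [id]; nlinarith
  have hGn : ‖G - 1‖ ≤ κ := by
    rw [← spectralFun_one hH, hG, spectralFun_sub]
    refine norm_spectralFun_le hH hκ0 fun i => ?_
    have h0 := hpos i
    have hs1 : (1 : ℝ) / 2 ≤ √(hH.eigenvalues i) := by
      apply Real.le_sqrt_of_sq_le; linarith
    have hss := Real.mul_self_sqrt (show 0 ≤ hH.eigenvalues i by linarith)
    set s := √(hH.eigenvalues i)
    have hs : 0 < s := by linarith
    -- the function `x ↦ x^(-1/2)` moves a point near `1` by no more than its distance to `1`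
    have e1 : s⁻¹ - 1 = -(hH.eigenvalues i - 1) * (s * (1 + s))⁻¹ := by
      field_simp; nlinarith
    rw [e1, abs_mul, abs_neg]
    have h2 : 1 ≤ s * (1 + s) := by nlinarith
    have h3 : |(s * (1 + s))⁻¹| ≤ 1 := by
      rw [abs_of_nonneg (by positivity)]; exact inv_le_one_of_one_le₀ h2
    calc _ ≤ κ * 1 := mul_le_mul (hev i) h3 (abs_nonneg _) hκ0
      _ = κ := mul_one κ
  have hVn : ‖V‖ ≤ 2 := by
    have h1 : ‖V‖ * ‖V‖ = ‖H‖ := (Matrix.l2_opNorm_conjTranspose_mul_self V).symm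
    have h2 : ‖H‖ ≤ 3 / 2 := by
      rw [← spectralFun_id hH]
      refine norm_spectralFun_le hH (by norm_num) fun i => ?_
      have := abs_le.1 (hev i)
      rw [id, abs_le]; constructor <;> linarith [hpos i]
    nlinarith [norm_nonneg V]
  refine ⟨V * G, ?_, ?_⟩
  · rw [Matrix.conjTranspose_mul, star_spectralFun, Matrix.mul_assoc, ← Matrix.mul_assoc Vᴴ,
      ← Matrix.mul_assoc, ← hHdef]
    exact hGH
  · have : V * G - V = V * (G - 1) := by rw [Matrix.mul_sub, Matrix.mul_one]
    rw [this]
    refine (Matrix.l2_opNorm_mul _ _).trans ?_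
    exact mul_le_mul hVn hGn (norm_nonneg _) (by norm_num)

/-- The grading of the multiplicity space: `1` on the first summand, `-1` on the second. -/
def signature (m₁ m₂ : ℕ) : Matrix (Fin m₁ ⊕ Fin m₂) (Fin m₁ ⊕ Fin m₂) ℂ :=
  Matrix.diagonal (Sum.elim (fun _ => 1) (fun _ => -1))

/-- A Hermitian matrix `y` with `y³ ≈ y` is near a self-adjoint partial isometry `J σ Jᴴ`, with `J`
an isometry and `σ` a diagonal matrix of signs. -/
lemma exists_signature_near {D : ℕ} {y : Matrix (Fin D) (Fin D) ℂ} (hy : y.IsHermitian) :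
    ∃ (m₁ m₂ : ℕ) (J : Matrix (Fin D) (Fin m₁ ⊕ Fin m₂) ℂ), Jᴴ * J = 1 ∧
      ‖J * signature m₁ m₂ * Jᴴ - y‖ ≤ 2 * ‖y ^ 3 - y‖ ∧
      ‖J * Jᴴ - y ^ 2‖ ≤ 2 * ‖y ^ 3 - y‖ := by
  classical
  set U : Matrix (Fin D) (Fin D) ℂ := (hy.eigenvectorUnitary).1 with hU
  have hUU : Uᴴ * U = 1 := Unitary.coe_star_mul_self _
  set lam := hy.eigenvalues with hlam
  -- the eigenvalues of `y` are near `1`, `-1` or `0`; `p` and `r` select those of the first two kinds,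
  -- and `φ` lists their positions
  let p : Fin D → Prop := fun i => 1 / 2 < lam i
  let r : Fin D → Prop := fun i => lam i < -(1 / 2)
  let e1 : {i // p i} ≃ Fin (Fintype.card {i // p i}) := Fintype.equivFin _
  let e2 : {i // r i} ≃ Fin (Fintype.card {i // r i}) := Fintype.equivFin _
  let φ : Fin (Fintype.card {i // p i}) ⊕ Fin (Fintype.card {i // r i}) → Fin D :=
    Sum.elim (fun k => (e1.symm k).1) (fun k => (e2.symm k).1)
  have hφ : Function.Injective φ := by
    rintro (a | a) (b | b) hab
    · simp only [φ, Sum.elim_inl] at hab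
      simpa using e1.symm.injective (Subtype.ext hab)
    · simp only [φ, Sum.elim_inl, Sum.elim_inr] at hab
      have h1 := (e1.symm a).2; have h2 := (e2.symm b).2
      rw [hab] at h1; simp only [p, r] at h1 h2; linarith
    · simp only [φ, Sum.elim_inl, Sum.elim_inr] at hab
      have h1 := (e2.symm a).2; have h2 := (e1.symm b).2
      rw [hab] at h1; simp only [p, r] at h1 h2; linarith
    · simp only [φ, Sum.elim_inr] at hab
      simpa using e2.symm.injective (Subtype.ext hab)
  -- the isometry that embeds the coordinates selected by `φ`
  let S : Matrix (Fin D) (Fin (Fintype.card {i // p i}) ⊕ Fin (Fintype.card {i // r i})) ℂ :=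
    Matrix.of fun i k => if i = φ k then 1 else 0
  have hSS : Sᴴ * S = 1 := by
    ext a b
    simp only [Matrix.mul_apply, Matrix.conjTranspose_apply, S, Matrix.of_apply]
    simp only [Matrix.one_apply, hφ.eq_iff, apply_ite star, star_one, star_zero, mul_ite, mul_one,
      mul_zero, Finset.sum_ite_eq', Finset.mem_univ, if_true]
    by_cases hab : a = b
    · simp [hab]
    · simp [hab, Ne.symm hab]
  -- a function of `y` that vanishes on the other eigenvalues factors through `S`
  have hSD : ∀ c : Fin (Fintype.card {i // p i}) ⊕ Fin (Fintype.card {i // r i}) → ℝ, ∀ f : ℝ → ℝ,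
      (∀ k, c k = f (lam (φ k))) → (∀ i, ¬ p i → ¬ r i → f (lam i) = 0) →
      S * Matrix.diagonal (fun k => (c k : ℂ)) * Sᴴ
        = Matrix.diagonal (fun i => ((f (lam i) : ℝ) : ℂ)) := by
    intro c f hc hf
    ext i j
    rw [Matrix.mul_apply]
    simp only [Matrix.mul_diagonal, Matrix.conjTranspose_apply, S, Matrix.of_apply,
      Matrix.diagonal_apply]
    by_cases hi : ∃ k, φ k = i
    · obtain ⟨k, rfl⟩ := hi
      rw [Finset.sum_eq_single k]
      · by_cases hj : φ k = j
        · simp [hj, hc k]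
        · simp [hj, Ne.symm hj]
      · intro b _ hb
        simp [hφ.eq_iff, Ne.symm hb]
      · simp
    · have h0 : f (lam i) = 0 := by
        refine hf i (fun h => hi ⟨Sum.inl (e1 ⟨i, h⟩), ?_⟩) (fun h => hi ⟨Sum.inr (e2 ⟨i, h⟩), ?_⟩)
        · simp [φ]
        · simp [φ]
      rw [Finset.sum_eq_zero]
      · simp [h0]
      · intro k _
        have : ¬ i = φ k := fun h => hi ⟨k, h.symm⟩
        simp [this]
  have hcube : y ^ 3 - y = spectralFun hy (fun x => x * x * x - x) := by
    have := spectralFun_sub hy (fun x => x * x * x) id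
    rw [← spectralFun_mul hy (fun x => x * x) (fun x => x), ← spectralFun_mul hy (fun x => x)] at this
    have hid : spectralFun hy (fun x => x) = y := spectralFun_id hy
    rw [hid, spectralFun_id] at this
    exact (by noncomm_ring : y ^ 3 - y = y * y * y - y).trans this
  have hb : ∀ i, |lam i * lam i * lam i - lam i| ≤ ‖y ^ 3 - y‖ := fun i => by
    rw [hcube]; exact abs_le_norm_spectralFun hy (fun x => x * x * x - x) i
  -- the value to which an eigenvalue is rounded
  let s : ℝ → ℝ := fun x => if 1 / 2 < x then 1 else if x < -(1 / 2) then -1 else 0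
  have hfac : ∀ x : ℝ, |x * x * x - x| = |x| * |x - 1| * |x + 1| := fun x => by
    rw [← abs_mul, ← abs_mul]; congr 1; ring
  have hs1 : ∀ x : ℝ, |s x - x| ≤ 2 * |x * x * x - x| := fun x => by
    rw [hfac]; simp only [s]
    split_ifs with h1 h2
    · rw [abs_of_pos (show 0 < x by linarith), abs_of_pos (show 0 < x + 1 by linarith), abs_sub_comm]
      have : 1 ≤ 2 * (x * (x + 1)) := by nlinarith
      nlinarith [abs_nonneg (x - 1)]
    · rw [abs_of_neg (show x < 0 by linarith), abs_of_neg (show x - 1 < 0 by linarith),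
        show -1 - x = -(x + 1) by ring, abs_neg]
      have : 1 ≤ 2 * (-x * -(x - 1)) := by nlinarith
      nlinarith [abs_nonneg (x + 1)]
    · rw [abs_of_neg (show x - 1 < 0 by linarith), abs_of_pos (show 0 < x + 1 by linarith),
        zero_sub, abs_neg]
      have : 1 ≤ 2 * (-(x - 1) * (x + 1)) := by nlinarith
      nlinarith [abs_nonneg x]
  have hs2 : ∀ x : ℝ, |s x * s x - x * x| ≤ 2 * |x * x * x - x| := fun x => by
    rw [hfac]; simp only [s]
    split_ifs with h1 h2
    · rw [show (1 : ℝ) * 1 - x * x = -((x - 1) * (x + 1)) by ring, abs_neg, abs_mul,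
        abs_of_pos (show 0 < x by linarith)]
      have := mul_nonneg (abs_nonneg (x - 1)) (abs_nonneg (x + 1))
      nlinarith
    · rw [show (-1 : ℝ) * -1 - x * x = -((x - 1) * (x + 1)) by ring, abs_neg, abs_mul,
        abs_of_neg (show x < 0 by linarith)]
      have := mul_nonneg (abs_nonneg (x - 1)) (abs_nonneg (x + 1))
      nlinarith
    · rw [abs_of_neg (show x - 1 < 0 by linarith), abs_of_pos (show 0 < x + 1 by linarith),
        show (0 : ℝ) * 0 - x * x = -(x * x) by ring, abs_neg, abs_mul]
      have h3 : |x| ≤ 1 := abs_le.2 ⟨by linarith, by linarith⟩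
      have : 1 ≤ 2 * (-(x - 1) * (x + 1)) := by nlinarith
      nlinarith [abs_nonneg x]
  refine ⟨_, _, U * S, ?_, ?_, ?_⟩
  · rw [Matrix.conjTranspose_mul, Matrix.mul_assoc, ← Matrix.mul_assoc Uᴴ, hUU, Matrix.one_mul, hSS]
  · have h1 := hSD (Sum.elim (fun _ => 1) (fun _ => -1)) s
      (by rintro (k | k)
          · have : 1 / 2 < lam (φ (Sum.inl k)) := (e1.symm k).2
            simp only [s, if_pos this, Sum.elim_inl]
          · have h2 : lam (φ (Sum.inr k)) < -(1 / 2) := (e2.symm k).2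
            have h3 : ¬ 1 / 2 < lam (φ (Sum.inr k)) := by linarith
            simp only [s, if_neg h3, if_pos h2, Sum.elim_inr])
      (by intro i h1 h2; simp only [p, r] at h1 h2; simp only [s, if_neg h1, if_neg h2])
    have h2 : (fun k => ((Sum.elim (fun _ => 1) (fun _ => -1) k : ℝ) : ℂ))
        = (Sum.elim (fun _ => 1) (fun _ => -1) :
          Fin (Fintype.card {i // p i}) ⊕ Fin (Fintype.card {i // r i}) → ℂ) := by
      ext (k | k) <;> simp
    rw [h2] at h1
    replace h1 : S * signature (Fintype.card {i // p i}) (Fintype.card {i // r i}) * Sᴴ = _ := h1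
    have h3 : U * S * signature (Fintype.card {i // p i}) (Fintype.card {i // r i}) * (U * S)ᴴ
        = spectralFun hy s := by
      rw [spectralFun, ← hU, ← hlam, ← h1, Matrix.conjTranspose_mul]
      simp only [Matrix.mul_assoc, Matrix.star_eq_conjTranspose]
    rw [h3]
    have h4 := spectralFun_sub hy s id
    rw [spectralFun_id] at h4
    rw [h4]
    exact norm_spectralFun_le hy (by positivity) fun i =>
      (hs1 _).trans (mul_le_mul_of_nonneg_left (hb i) (by norm_num))
  · have h1 := hSD (fun _ => 1) (fun x => s x * s x)
      (by rintro (k | k)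
          · have : 1 / 2 < lam (φ (Sum.inl k)) := (e1.symm k).2
            simp only [s, if_pos this]; norm_num
          · have h2 : lam (φ (Sum.inr k)) < -(1 / 2) := (e2.symm k).2
            have h3 : ¬ 1 / 2 < lam (φ (Sum.inr k)) := by linarith
            simp only [s, if_neg h3, if_pos h2]; norm_num)
      (by intro i h1 h2; simp only [p, r] at h1 h2; simp only [s, if_neg h1, if_neg h2]; norm_num)
    have h3 : U * S * (U * S)ᴴ = spectralFun hy (fun x => s x * s x) := by
      rw [spectralFun, ← hU, ← hlam, ← h1, Matrix.conjTranspose_mul]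
      simp only [Complex.ofReal_one, Matrix.diagonal_one, Matrix.mul_one]
      simp only [Matrix.mul_assoc, Matrix.star_eq_conjTranspose]
    have h4 : y ^ 2 = spectralFun hy (fun x => x * x) := by
      rw [← spectralFun_mul hy (fun x => x) (fun x => x)]
      have hid : spectralFun hy (fun x => x) = y := spectralFun_id hy
      rw [hid, sq]
    rw [h3, h4, spectralFun_sub]
    exact norm_spectralFun_le hy (by positivity) fun i =>
      (hs2 _).trans (mul_le_mul_of_nonneg_left (hb i) (by norm_num))

end CFR


/-! ### Rounding approximate matrix units -/

namespace CFR

open scoped Matrix.Norms.L2Operator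

section Selection

variable {d m₁ m₂ : ℕ}

/-- The position of the `k`-th vector of the multiplicity space `ℂ^m₁ ⊕ ℂ^m₂` in the `a`-th slot of
`(ℂ^d ⊗ ℂ^m₁) ⊕ (ℂ^d ⊗ ℂ^m₂)`. -/
def slot {d m₁ m₂ : ℕ} (a : Fin d) : Fin m₁ ⊕ Fin m₂ → (Fin d × Fin m₁) ⊕ (Fin d × Fin m₂) :=
  Sum.map (fun k => (a, k)) (fun k => (a, k))

/-- The coisometry that reads off the `a`-th slot of `(ℂ^d ⊗ ℂ^m₁) ⊕ (ℂ^d ⊗ ℂ^m₂)`. -/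
def slotMatrix {d : ℕ} (m₁ m₂ : ℕ) (a : Fin d) :
    Matrix (Fin m₁ ⊕ Fin m₂) ((Fin d × Fin m₁) ⊕ (Fin d × Fin m₂)) ℂ :=
  Matrix.of fun k x => if x = slot a k then 1 else 0

lemma slot_eq_slot {a b : Fin d} {k l : Fin m₁ ⊕ Fin m₂} : slot a k = slot b l ↔ a = b ∧ k = l := by
  rcases k with k | k <;> rcases l with l | l <;> simp [slot]

lemma slotMatrix_mul_conjTranspose (a b : Fin d) :
    (slotMatrix m₁ m₂ a) * (slotMatrix m₁ m₂ b)ᴴ = if a = b then 1 else 0 := by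
  ext k l
  rw [Matrix.mul_apply]
  simp only [slotMatrix, Matrix.conjTranspose_apply, Matrix.of_apply, apply_ite star, star_one,
    star_zero, mul_ite, mul_one, mul_zero]
  rw [Finset.sum_eq_single (slot b l)]
  · by_cases h : a = b
    · by_cases hk : k = l
      · subst h hk; simp
      · simp [h, hk, slot_eq_slot, Ne.symm hk]
    · simp [h, slot_eq_slot, Ne.symm h]
  · intro x _ hx; simp [hx]
  · simp

lemma amplify_eq_sum (A : Matrix (Fin d) (Fin d) ℂ) :
    amplify m₁ m₂ A = ∑ a, ∑ b, (slotMatrix m₁ m₂ a)ᴴ *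
      (((A a b).re : ℂ) • 1 + (((A a b).im : ℂ) * Complex.I) • signature m₁ m₂) * slotMatrix m₁ m₂ b := by
  have hz : ∀ z : ℂ, (z.re : ℂ) + z.im * Complex.I = z := Complex.re_add_im
  have hz' : ∀ z : ℂ, (z.re : ℂ) - z.im * Complex.I = star z := fun z => by
    apply Complex.ext <;> simp
  have key : ∀ (a b : Fin d) (k l : Fin m₁ ⊕ Fin m₂) (M : Fin d → Fin d →
      Matrix (Fin m₁ ⊕ Fin m₂) (Fin m₁ ⊕ Fin m₂) ℂ),
      (∑ a, ∑ b, (slotMatrix m₁ m₂ a)ᴴ * M a b * slotMatrix m₁ m₂ b) (slot a k) (slot b l) = M a b k l := by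
    intro a b k l M
    simp only [Matrix.sum_apply, Matrix.mul_apply, slotMatrix, Matrix.conjTranspose_apply,
      Matrix.of_apply, slot_eq_slot, apply_ite star, star_one, star_zero, ite_mul, mul_ite, one_mul,
      zero_mul, mul_one, mul_zero, ite_and]
    simp
  ext x y
  obtain ⟨a, k, rfl⟩ : ∃ a k, x = slot a k := by
    rcases x with ⟨a, k⟩ | ⟨a, k⟩
    · exact ⟨a, Sum.inl k, rfl⟩
    · exact ⟨a, Sum.inr k, rfl⟩
  obtain ⟨b, l, rfl⟩ : ∃ b l, y = slot b l := by
    rcases y with ⟨a, k⟩ | ⟨a, k⟩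
    · exact ⟨a, Sum.inl k, rfl⟩
    · exact ⟨a, Sum.inr k, rfl⟩
  rw [key]
  rcases k with k | k <;> rcases l with l | l
  · by_cases h : k = l
    · simp [amplify, slot, signature, h, Matrix.kroneckerMap_apply, hz]
    · simp [amplify, slot, signature, h, Matrix.kroneckerMap_apply]
  · simp [amplify, slot, signature]
  · simp [amplify, slot, signature]
  · by_cases h : k = l
    · simp [amplify, slot, signature, h, Matrix.kroneckerMap_apply, ← sub_eq_add_neg, hz']
    · simp [amplify, slot, signature, h, Matrix.kroneckerMap_apply]

lemma sum_conjTranspose_mul_slotMatrix :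
    ∑ a : Fin d, (slotMatrix m₁ m₂ a)ᴴ * slotMatrix m₁ m₂ a = 1 := by
  have h1 : amplify m₁ m₂ (1 : Matrix (Fin d) (Fin d) ℂ) = 1 := by
    have : (1 : Matrix (Fin d) (Fin d) ℂ).map star = 1 :=
      Matrix.map_one star (star_zero ℂ) (star_one ℂ)
    rw [amplify, this]
    simp
  rw [← h1, amplify_eq_sum]
  refine Finset.sum_congr rfl fun a _ => ?_
  rw [Finset.sum_eq_single a]
  · simp
  · intro b _ hb; simp [Matrix.one_apply_ne (Ne.symm hb)]
  · simp

end Selection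

lemma norm_one_le {n : Type*} [Fintype n] [DecidableEq n] : ‖(1 : Matrix n n ℂ)‖ ≤ 1 := by
  rw [← Matrix.diagonal_one, Matrix.l2_opNorm_diagonal]
  exact (pi_norm_le_iff_of_nonneg zero_le_one).2 fun i => by simp

lemma norm_le_one_of_isometry {m n : Type*} [Fintype m] [Fintype n] [DecidableEq n]
    {V : Matrix m n ℂ} (h : Vᴴ * V = 1) : ‖V‖ ≤ 1 := by
  have h1 := Matrix.l2_opNorm_conjTranspose_mul_self V
  rw [h] at h1
  have h2 : ‖(1 : Matrix n n ℂ)‖ ≤ 1 := norm_one_le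
  nlinarith [norm_nonneg V]

lemma norm_slotMatrix_le {d m₁ m₂ : ℕ} (a : Fin d) :
    ‖slotMatrix m₁ m₂ a‖ ≤ 1 := by
  rw [← Matrix.l2_opNorm_conjTranspose]
  apply norm_le_one_of_isometry
  rw [Matrix.conjTranspose_conjTranspose, slotMatrix_mul_conjTranspose, if_pos rfl]

lemma norm_signature_le (m₁ m₂ : ℕ) : ‖signature m₁ m₂‖ ≤ 1 := by
  rw [signature, Matrix.l2_opNorm_diagonal]
  exact (pi_norm_le_iff_of_nonneg zero_le_one).2 fun i => by rcases i with i | i <;> simp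

lemma norm_mul_le_of_le' {l m n : Type*} [Fintype l] [Fintype m] [Fintype n] [DecidableEq m]
    [DecidableEq n] {A : Matrix l m ℂ} {B : Matrix m n ℂ} {a b : ℝ} (hA : ‖A‖ ≤ a) (hB : ‖B‖ ≤ b) :
    ‖A * B‖ ≤ a * b :=
  (Matrix.l2_opNorm_mul A B).trans
    (mul_le_mul hA hB (norm_nonneg _) ((norm_nonneg _).trans hA))

lemma norm_amplify_le {d : ℕ} (m₁ m₂ : ℕ) {A : Matrix (Fin d) (Fin d) ℂ}
    (hA : ∀ a b, ‖A a b‖ ≤ 1) : ‖amplify m₁ m₂ A‖ ≤ 2 * d ^ 2 := by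
  rw [amplify_eq_sum]
  have hb : ∀ a b : Fin d, ‖(slotMatrix m₁ m₂ a)ᴴ *
      (((A a b).re : ℂ) • 1 + (((A a b).im : ℂ) * Complex.I) • signature m₁ m₂) * slotMatrix m₁ m₂ b‖
        ≤ 2 := by
    intro a b
    have h1 : ‖((A a b).re : ℂ) • (1 : Matrix (Fin m₁ ⊕ Fin m₂) (Fin m₁ ⊕ Fin m₂) ℂ)
        + (((A a b).im : ℂ) * Complex.I) • signature m₁ m₂‖ ≤ 2 := by
      refine (norm_add_le _ _).trans ?_
      rw [norm_smul, norm_smul]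
      have h2 : ‖((A a b).re : ℂ)‖ ≤ 1 := by
        rw [Complex.norm_real]; exact (Complex.abs_re_le_norm _).trans (hA a b)
      have h3 : ‖((A a b).im : ℂ) * Complex.I‖ ≤ 1 := by
        rw [norm_mul, Complex.norm_I, mul_one, Complex.norm_real]
        exact (Complex.abs_im_le_norm _).trans (hA a b)
      have h4 := mul_le_mul h2 (norm_one_le (n := Fin m₁ ⊕ Fin m₂)) (norm_nonneg _) zero_le_one
      have h5 := mul_le_mul h3 (norm_signature_le m₁ m₂) (norm_nonneg _) zero_le_one
      linarith
    have h6 : ‖(slotMatrix m₁ m₂ a)ᴴ‖ ≤ 1 := by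
      rw [Matrix.l2_opNorm_conjTranspose]; exact norm_slotMatrix_le a
    exact (norm_mul_le_of_le' (norm_mul_le_of_le' h6 h1) (norm_slotMatrix_le b)).trans (by norm_num)
  calc _ ≤ ∑ a : Fin d, ∑ b : Fin d, (2 : ℝ) := by
        refine norm_sum_le_of_le _ fun a _ => norm_sum_le_of_le _ fun b _ => hb a b
    _ = 2 * d ^ 2 := by simp; ring

end CFR


namespace CFR

open scoped Matrix.Norms.L2Operator

/-- If `A B` is invertible because it is near `1`, it cannot factor through a smaller space. -/
lemma card_le_of_norm_sub_one_lt {m n : Type*} [Fintype m] [DecidableEq m] [Fintype n]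
    [DecidableEq n] {A : Matrix m n ℂ} {B : Matrix n m ℂ} (h : ‖A * B - 1‖ < 1) :
    Fintype.card m ≤ Fintype.card n := by
  have hu : IsUnit (A * B) := by
    have : ‖1 - A * B‖ < 1 := by rwa [norm_sub_rev]
    have h2 := (Units.oneSub (1 - A * B) this).isUnit
    simpa using h2
  calc Fintype.card m = (A * B).rank := (Matrix.rank_of_isUnit _ hu).symm
    _ ≤ A.rank := Matrix.rank_mul_le_left A B
    _ ≤ Fintype.card n := A.rank_le_card_width

/-- **Rounding.** If `x₀, …, x_{d-1}` behave, up to an error `η`, like the elements `e_{a0}` of a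
system of `d × d` matrix units and the Hermitian matrix `y` like a grading of the range of `e_{00}`,
then they come from an honest unitary `(ℂ^d ⊗ ℂ^m₁) ⊕ (ℂ^d ⊗ ℂ^m₂) → ℂ^D`, up to an error `O(η)`
with a constant that does not depend on `D`. -/
theorem exists_unitary_near {d : ℕ} (hd : 0 < d) {K : ℝ} (hK : 1 ≤ K) :
    ∃ C η₀ : ℝ, 0 < η₀ ∧ ∀ (D : ℕ) (η : ℝ) (x : Fin d → Matrix (Fin D) (Fin D) ℂ)
      (y : Matrix (Fin D) (Fin D) ℂ), η ≤ η₀ → y.IsHermitian → (∀ a, ‖x a‖ ≤ K) →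
      ‖y ^ 3 - y‖ ≤ η → (∀ a b, ‖(x a)ᴴ * x b - if a = b then y ^ 2 else 0‖ ≤ η) →
      (∀ a, ‖x a * y ^ 2 - x a‖ ≤ η) → ‖∑ a, x a * (x a)ᴴ - 1‖ ≤ η →
      ∃ m₁ m₂ : ℕ, m₁ + m₂ = D / d ∧
        ∃ V : Matrix (Fin D) ((Fin d × Fin m₁) ⊕ (Fin d × Fin m₂)) ℂ, Vᴴ * V = 1 ∧ V * Vᴴ = 1 ∧
          ∀ A : Matrix (Fin d) (Fin d) ℂ, (∀ a b, ‖A a b‖ ≤ 1) →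
            ‖V * amplify m₁ m₂ A * Vᴴ - ∑ a, ∑ b, x a * (((A a b).re : ℂ) • 1 +
              (((A a b).im : ℂ) * Complex.I) • y) * (x b)ᴴ‖ ≤ C * η := by
  have hd1 : (1 : ℝ) ≤ d := by exact_mod_cast hd
  refine ⟨(1 + d * K) * (2 * d ^ 2) * (6 * d ^ 2) + 5 * d ^ 2 * K ^ 2,
    1 / (12 * d ^ 2 * K ^ 2), by positivity, ?_⟩
  intro D η x y hη hy hxK hy3 hxx hxy hsum
  have hη0 : 0 ≤ η := (norm_nonneg _).trans hy3
  have hηs : 12 * d ^ 2 * K ^ 2 * η ≤ 1 := by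
    rw [le_div_iff₀ (by positivity)] at hη; linarith
  obtain ⟨m₁, m₂, J, hJ, hJσ, hJJ⟩ := exists_signature_near hy
  have hJn : ‖J‖ ≤ 1 := norm_le_one_of_isometry hJ
  have hJn' : ‖Jᴴ‖ ≤ 1 := by rwa [Matrix.l2_opNorm_conjTranspose]
  have hxK' : ∀ a, ‖(x a)ᴴ‖ ≤ K := fun a => by rw [Matrix.l2_opNorm_conjTranspose]; exact hxK a
  have hR : ∀ a : Fin d, ‖slotMatrix m₁ m₂ a‖ ≤ 1 := norm_slotMatrix_le
  have hR' : ∀ a : Fin d, ‖(slotMatrix m₁ m₂ a)ᴴ‖ ≤ 1 := fun a => by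
    rw [Matrix.l2_opNorm_conjTranspose]; exact hR a
  -- the approximate unitary; by the relations it is nearly an isometry, and nearly a coisometry
  set V₀ : Matrix (Fin D) ((Fin d × Fin m₁) ⊕ (Fin d × Fin m₂)) ℂ :=
    ∑ a, x a * J * slotMatrix m₁ m₂ a with hV₀
  have hV₀' : V₀ᴴ = ∑ a, (slotMatrix m₁ m₂ a)ᴴ * (Jᴴ * (x a)ᴴ) := by
    rw [hV₀, Matrix.conjTranspose_sum]
    simp only [Matrix.conjTranspose_mul]
  have hV₀n : ‖V₀‖ ≤ d * K := by
    calc ‖V₀‖ ≤ ∑ _a : Fin d, K * 1 * 1 :=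
          norm_sum_le_of_le _ fun a _ => norm_mul_le_of_le' (norm_mul_le_of_le' (hxK a) hJn) (hR a)
      _ = d * K := by simp
  -- `J Jᴴ` takes the place of `y ^ 2`, which makes the main term exactly `1`
  have hVV : V₀ᴴ * V₀ - 1 = ∑ a, ∑ b, (slotMatrix m₁ m₂ a)ᴴ *
      (Jᴴ * ((x a)ᴴ * x b - if a = b then J * Jᴴ else 0) * J) * slotMatrix m₁ m₂ b := by
    have h1 : (1 : Matrix ((Fin d × Fin m₁) ⊕ (Fin d × Fin m₂)) _ ℂ) =
        ∑ a, ∑ b, (slotMatrix m₁ m₂ a)ᴴ * (Jᴴ * (if a = b then J * Jᴴ else 0) * J) * slotMatrix m₁ m₂ b := by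
      rw [← sum_conjTranspose_mul_slotMatrix]
      refine Finset.sum_congr rfl fun a _ => ?_
      rw [Finset.sum_eq_single a]
      · rw [if_pos rfl, ← Matrix.mul_assoc Jᴴ, hJ, Matrix.one_mul, hJ, Matrix.mul_one]
      · intro b _ hb; simp [Ne.symm hb]
      · simp
    conv_lhs => rw [h1]
    rw [hV₀', hV₀, Matrix.sum_mul, ← Finset.sum_sub_distrib]
    refine Finset.sum_congr rfl fun a _ => ?_
    rw [Matrix.mul_sum, ← Finset.sum_sub_distrib]
    refine Finset.sum_congr rfl fun b _ => ?_
    simp only [Matrix.mul_sub, Matrix.sub_mul, Matrix.mul_assoc]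
  have hVVn : ‖V₀ᴴ * V₀ - 1‖ ≤ 3 * d ^ 2 * η := by
    rw [hVV]
    have hb : ∀ a b, ‖(slotMatrix m₁ m₂ a)ᴴ *
        (Jᴴ * ((x a)ᴴ * x b - if a = b then J * Jᴴ else 0) * J) * slotMatrix m₁ m₂ b‖ ≤ 3 * η := by
      intro a b
      have h1 : ‖(x a)ᴴ * x b - if a = b then J * Jᴴ else 0‖ ≤ 3 * η := by
        have e : ((x a)ᴴ * x b - if a = b then J * Jᴴ else 0) =
            ((x a)ᴴ * x b - if a = b then y ^ 2 else 0) - (if a = b then J * Jᴴ - y ^ 2 else 0) := by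
          split_ifs <;> abel
        rw [e]
        refine (norm_sub_le _ _).trans ?_
        have h2 : ‖(if a = b then J * Jᴴ - y ^ 2 else 0 : Matrix (Fin D) (Fin D) ℂ)‖ ≤ 2 * η := by
          split_ifs
          · linarith
          · simpa using hη0
        linarith [hxx a b]
      refine (norm_mul_le_of_le' (norm_mul_le_of_le' (hR' a)
        (norm_mul_le_of_le' (norm_mul_le_of_le' hJn' h1) hJn)) (hR b)).trans (by linarith)
    calc _ ≤ ∑ _a : Fin d, ∑ _b : Fin d, 3 * η :=
          norm_sum_le_of_le _ fun a _ => norm_sum_le_of_le _ fun b _ => hb a b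
      _ = 3 * d ^ 2 * η := by simp; ring
  have hk : (1 : ℝ) ≤ K ^ 2 := by nlinarith
  have hsmall : 3 * d ^ 2 * η ≤ 1 / 4 := by
    have : 0 ≤ d ^ 2 * η := by positivity
    nlinarith
  -- conjugation of a block matrix by `V₀`
  have hmid : ∀ M : Fin d → Fin d → Matrix (Fin m₁ ⊕ Fin m₂) (Fin m₁ ⊕ Fin m₂) ℂ,
      V₀ * (∑ a, ∑ b, (slotMatrix m₁ m₂ a)ᴴ * M a b * slotMatrix m₁ m₂ b) * V₀ᴴ
        = ∑ a, ∑ b, x a * (J * M a b * Jᴴ) * (x b)ᴴ := by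
    intro M
    have hl : ∀ a, V₀ * (slotMatrix m₁ m₂ a)ᴴ = x a * J := fun a => by
      rw [hV₀, Matrix.sum_mul, Finset.sum_eq_single a]
      · rw [Matrix.mul_assoc, slotMatrix_mul_conjTranspose, if_pos rfl, Matrix.mul_one]
      · intro b _ hb
        rw [Matrix.mul_assoc, slotMatrix_mul_conjTranspose, if_neg hb, Matrix.mul_zero]
      · simp
    have hr : ∀ a, slotMatrix m₁ m₂ a * V₀ᴴ = Jᴴ * (x a)ᴴ := fun a => by
      have := congrArg Matrix.conjTranspose (hl a)
      simpa [Matrix.conjTranspose_mul] using this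
    rw [Matrix.mul_sum, Matrix.sum_mul]
    refine Finset.sum_congr rfl fun a _ => ?_
    rw [Matrix.mul_sum, Matrix.sum_mul]
    refine Finset.sum_congr rfl fun b _ => ?_
    calc V₀ * ((slotMatrix m₁ m₂ a)ᴴ * M a b * slotMatrix m₁ m₂ b) * V₀ᴴ
        = (V₀ * (slotMatrix m₁ m₂ a)ᴴ) * M a b * (slotMatrix m₁ m₂ b * V₀ᴴ) := by
          simp only [Matrix.mul_assoc]
      _ = _ := by rw [hl, hr]; simp only [Matrix.mul_assoc]
  -- the corner `y ^ 2` may be replaced by the projection `J Jᴴ`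
  have hxJ : ∀ a, ‖x a * (J * Jᴴ) - x a‖ ≤ 3 * K * η := fun a => by
    have e : x a * (J * Jᴴ) - x a = x a * (J * Jᴴ - y ^ 2) + (x a * y ^ 2 - x a) := by
      rw [Matrix.mul_sub]; abel
    rw [e]
    refine (norm_add_le _ _).trans ?_
    have := norm_mul_le_of_le' (hxK a) (hJJ.trans (mul_le_mul_of_nonneg_left hy3 (by norm_num)))
    have := hxy a
    nlinarith
  have hVVt : ‖V₀ * V₀ᴴ - 1‖ < 1 := by
    have e : V₀ * V₀ᴴ - 1 = ∑ a, (x a * (J * Jᴴ) - x a) * (x a)ᴴ + (∑ a, x a * (x a)ᴴ - 1) := by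
      have h1 : V₀ * V₀ᴴ = ∑ a, x a * (J * Jᴴ) * (x a)ᴴ := by
        have h2 := hmid (fun a b => if a = b then 1 else 0)
        have h3 : ∑ a : Fin d, ∑ b : Fin d, (slotMatrix m₁ m₂ a)ᴴ *
            (if a = b then 1 else 0 : Matrix (Fin m₁ ⊕ Fin m₂) (Fin m₁ ⊕ Fin m₂) ℂ) *
            slotMatrix m₁ m₂ b
              = (1 : Matrix ((Fin d × Fin m₁) ⊕ (Fin d × Fin m₂)) _ ℂ) := by
          rw [← sum_conjTranspose_mul_slotMatrix]
          refine Finset.sum_congr rfl fun a _ => ?_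
          rw [Finset.sum_eq_single a]
          · simp
          · intro b _ hb; simp [Ne.symm hb]
          · simp
        rw [h3, Matrix.mul_one] at h2
        rw [h2]
        refine Finset.sum_congr rfl fun a _ => ?_
        rw [Finset.sum_eq_single a]
        · simp
        · intro b _ hb; simp [Ne.symm hb]
        · simp
      rw [h1]
      simp only [Matrix.sub_mul, Finset.sum_sub_distrib]
      abel
    rw [e]
    have h1 : ‖∑ a, (x a * (J * Jᴴ) - x a) * (x a)ᴴ‖ ≤ d * (3 * K * η * K) := by
      calc _ ≤ ∑ _a : Fin d, 3 * K * η * K :=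
            norm_sum_le_of_le _ fun a _ => norm_mul_le_of_le' (hxJ a) (hxK' a)
        _ = _ := by simp
    have h2 : d * (3 * K * η * K) ≤ 1 / 4 := by
      have h3 : (d : ℝ) ≤ d ^ 2 := by nlinarith
      have h4 : 0 ≤ K ^ 2 * η := by positivity
      nlinarith
    have h5 : η ≤ 1 / 12 := by
      have : 1 ≤ d ^ 2 * K ^ 2 := by nlinarith
      nlinarith
    calc _ ≤ d * (3 * K * η * K) + η := (norm_add_le _ _).trans (add_le_add h1 hsum)
      _ < 1 := by linarith
  -- both spaces have the same dimension, so that the isometry near `V₀` is unitary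
  obtain ⟨V, hV, hVn⟩ := exists_isometry_near V₀ (by linarith) hVVn
  have hc1 : Fintype.card ((Fin d × Fin m₁) ⊕ (Fin d × Fin m₂)) ≤ Fintype.card (Fin D) :=
    card_le_of_norm_sub_one_lt (A := V₀ᴴ) (B := V₀) (by linarith)
  have hc2 : Fintype.card (Fin D) ≤ Fintype.card ((Fin d × Fin m₁) ⊕ (Fin d × Fin m₂)) :=
    card_le_of_norm_sub_one_lt hVVt
  have hcard := le_antisymm hc2 hc1
  have hDd : D = d * (m₁ + m₂) := by
    simp only [Fintype.card_fin, Fintype.card_sum, Fintype.card_prod] at hcard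
    rw [hcard]; ring
  refine ⟨m₁, m₂, by rw [hDd, Nat.mul_div_cancel_left _ hd], V, hV,
    (Matrix.mul_eq_one_comm_of_equiv (Fintype.equivOfCardEq hcard.symm)).1 hV, ?_⟩
  intro A hA
  have hVle : ‖V‖ ≤ 1 := norm_le_one_of_isometry hV
  have hamp := norm_amplify_le m₁ m₂ hA
  -- the error comes from replacing `V` by `V₀`, and then `J Jᴴ` by `1` and `J σ Jᴴ` by `y`
  have e1 : V * amplify m₁ m₂ A * Vᴴ - V₀ * amplify m₁ m₂ A * V₀ᴴ =
      (V - V₀) * amplify m₁ m₂ A * Vᴴ + V₀ * amplify m₁ m₂ A * (V - V₀)ᴴ := by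
    simp only [Matrix.conjTranspose_sub, Matrix.sub_mul, Matrix.mul_sub]; abel
  have b1 : ‖V * amplify m₁ m₂ A * Vᴴ - V₀ * amplify m₁ m₂ A * V₀ᴴ‖
      ≤ (1 + d * K) * (2 * d ^ 2) * (6 * d ^ 2) * η := by
    rw [e1]
    refine (norm_add_le _ _).trans ?_
    have h1 := norm_mul_le_of_le' (norm_mul_le_of_le' hVn hamp)
      ((Matrix.l2_opNorm_conjTranspose V).le.trans hVle)
    have h2 := norm_mul_le_of_le' (norm_mul_le_of_le' hV₀n hamp)
      ((Matrix.l2_opNorm_conjTranspose (V - V₀)).le.trans hVn)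
    linarith
  have e2 : V₀ * amplify m₁ m₂ A * V₀ᴴ - ∑ a, ∑ b, x a * (((A a b).re : ℂ) • 1 +
      (((A a b).im : ℂ) * Complex.I) • y) * (x b)ᴴ =
      ∑ a, ∑ b, (((A a b).re : ℂ) • ((x a * (J * Jᴴ) - x a) * (x b)ᴴ) +
        (((A a b).im : ℂ) * Complex.I) • (x a * (J * signature m₁ m₂ * Jᴴ - y) * (x b)ᴴ)) := by
    rw [amplify_eq_sum, hmid (fun a b => ((A a b).re : ℂ) • 1 +
      (((A a b).im : ℂ) * Complex.I) • signature m₁ m₂), ← Finset.sum_sub_distrib]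
    refine Finset.sum_congr rfl fun a _ => ?_
    rw [← Finset.sum_sub_distrib]
    refine Finset.sum_congr rfl fun b _ => ?_
    simp only [Matrix.mul_add, Matrix.add_mul, Matrix.mul_smul, Matrix.smul_mul, Matrix.mul_one,
      Matrix.mul_sub, Matrix.sub_mul, smul_sub]
    abel
  have b2 : ‖V₀ * amplify m₁ m₂ A * V₀ᴴ - ∑ a, ∑ b, x a * (((A a b).re : ℂ) • 1 +
      (((A a b).im : ℂ) * Complex.I) • y) * (x b)ᴴ‖ ≤ 5 * d ^ 2 * K ^ 2 * η := by
    rw [e2]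
    have hb : ∀ a b, ‖((A a b).re : ℂ) • ((x a * (J * Jᴴ) - x a) * (x b)ᴴ) +
        (((A a b).im : ℂ) * Complex.I) • (x a * (J * signature m₁ m₂ * Jᴴ - y) * (x b)ᴴ)‖
          ≤ 5 * K ^ 2 * η := by
      intro a b
      refine (norm_add_le _ _).trans ?_
      rw [norm_smul, norm_smul]
      have h2 : ‖((A a b).re : ℂ)‖ ≤ 1 := by
        rw [Complex.norm_real]; exact (Complex.abs_re_le_norm _).trans (hA a b)
      have h3 : ‖((A a b).im : ℂ) * Complex.I‖ ≤ 1 := by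
        rw [norm_mul, Complex.norm_I, mul_one, Complex.norm_real]
        exact (Complex.abs_im_le_norm _).trans (hA a b)
      have h4 := mul_le_mul h2 (norm_mul_le_of_le' (hxJ a) (hxK' b)) (norm_nonneg _) zero_le_one
      have h5 := mul_le_mul h3 (norm_mul_le_of_le' (norm_mul_le_of_le' (hxK a)
        (hJσ.trans (mul_le_mul_of_nonneg_left hy3 (by norm_num)))) (hxK' b)) (norm_nonneg _)
        zero_le_one
      nlinarith
    calc _ ≤ ∑ _a : Fin d, ∑ _b : Fin d, 5 * K ^ 2 * η :=
          norm_sum_le_of_le _ fun a _ => norm_sum_le_of_le _ fun b _ => hb a b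
      _ = 5 * d ^ 2 * K ^ 2 * η := by simp; ring
  have e3 := norm_add_le (V * amplify m₁ m₂ A * Vᴴ - V₀ * amplify m₁ m₂ A * V₀ᴴ)
    (V₀ * amplify m₁ m₂ A * V₀ᴴ - ∑ a, ∑ b, x a * (((A a b).re : ℂ) • 1 +
      (((A a b).im : ℂ) * Complex.I) • y) * (x b)ᴴ)
  rw [sub_add_sub_cancel] at e3
  linarith

end CFR


/-! ### Bounded families modulo small families -/

namespace CFR

section AsymptoticAlgebra

variable {ι : Type*} (𝒜 : ι → Type*) [∀ i, NormedRing (𝒜 i)] [∀ i, StarRing (𝒜 i)]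
  [∀ i, CStarRing (𝒜 i)] [∀ i, NormedAlgebra ℂ (𝒜 i)] [∀ i, StarModule ℂ (𝒜 i)]

/-- The `*`-algebra of uniformly bounded families `(x i)`, with `x i` in the `C^*`-algebra `𝒜 i`. -/
def boundedFamilies : StarSubalgebra ℂ (∀ i, 𝒜 i) where
  carrier := {x | ∃ K : ℝ, ∀ i, ‖x i‖ ≤ K}
  mul_mem' := by
    rintro x y ⟨K, hK⟩ ⟨L, hL⟩
    exact ⟨K * L, fun i => (norm_mul_le _ _).trans
      (mul_le_mul (hK i) (hL i) (norm_nonneg _) ((norm_nonneg _).trans (hK i)))⟩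
  add_mem' := by
    rintro x y ⟨K, hK⟩ ⟨L, hL⟩
    exact ⟨K + L, fun i => (norm_add_le _ _).trans (add_le_add (hK i) (hL i))⟩
  algebraMap_mem' := by
    intro r
    refine ⟨‖r‖, fun i => ?_⟩
    have h1 : ‖(1 : 𝒜 i)‖ ≤ 1 := by
      have := CStarRing.norm_star_mul_self (x := (1 : 𝒜 i))
      rw [star_one, one_mul] at this
      nlinarith [norm_nonneg (1 : 𝒜 i)]
    rw [Pi.algebraMap_apply, Algebra.algebraMap_eq_smul_one, norm_smul]
    exact mul_le_of_le_one_right (norm_nonneg _) h1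
  star_mem' := by
    rintro x ⟨K, hK⟩
    exact ⟨K, fun i => by rw [Pi.star_apply, norm_star]; exact hK i⟩

/-- Two bounded families are congruent if their difference is `O(f)`. -/
def smallCon (f : ι → ℝ) : RingCon (boundedFamilies 𝒜) where
  r x y := ∃ K : ℝ, ∀ i, ‖x.1 i - y.1 i‖ ≤ K * |f i|
  iseqv := by
    refine ⟨fun x => ⟨0, fun i => by simp⟩, ?_, ?_⟩
    · rintro x y ⟨K, hK⟩
      exact ⟨K, fun i => by rw [norm_sub_rev]; exact hK i⟩
    · rintro x y z ⟨K, hK⟩ ⟨L, hL⟩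
      refine ⟨K + L, fun i => ?_⟩
      rw [← sub_add_sub_cancel (x.1 i) (y.1 i), add_mul]
      exact (norm_add_le _ _).trans (add_le_add (hK i) (hL i))
  add' := by
    rintro w x y z ⟨K, hK⟩ ⟨L, hL⟩
    refine ⟨K + L, fun i => ?_⟩
    have : (w + y).1 i - (x + z).1 i = (w.1 i - x.1 i) + (y.1 i - z.1 i) := by
      simp only [AddMemClass.coe_add, Pi.add_apply]; abel
    rw [this, add_mul]
    exact (norm_add_le _ _).trans (add_le_add (hK i) (hL i))
  mul' := by
    rintro w x y z ⟨K, hK⟩ ⟨L, hL⟩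
    obtain ⟨A, hA⟩ := w.2
    obtain ⟨B, hB⟩ := z.2
    refine ⟨A * L + K * B, fun i => ?_⟩
    have : (w * y).1 i - (x * z).1 i = w.1 i * (y.1 i - z.1 i) + (w.1 i - x.1 i) * z.1 i := by
      simp only [MulMemClass.coe_mul, Pi.mul_apply]; noncomm_ring
    rw [this]
    have h1 : ‖w.1 i * (y.1 i - z.1 i)‖ ≤ A * (L * |f i|) := (norm_mul_le _ _).trans
      (mul_le_mul (hA i) (hL i) (norm_nonneg _) ((norm_nonneg _).trans (hA i)))
    have h2 : ‖(w.1 i - x.1 i) * z.1 i‖ ≤ (K * |f i|) * B := (norm_mul_le _ _).trans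
      (mul_le_mul (hK i) (hB i) (norm_nonneg _) ((norm_nonneg _).trans (hK i)))
    have := norm_add_le (w.1 i * (y.1 i - z.1 i)) ((w.1 i - x.1 i) * z.1 i)
    linarith

/-- The algebra of bounded families modulo those that are `O(f)`. Relations that hold up to an
error `O(f)`, uniformly in `i`, become exact relations in this algebra. -/
abbrev AsymptoticAlgebra (f : ι → ℝ) := (smallCon 𝒜 f).Quotient

instance (f : ι → ℝ) : StarRing (AsymptoticAlgebra 𝒜 f) where
  star := Quotient.map' star (by
    rintro x y ⟨K, hK⟩
    refine ⟨K, fun i => ?_⟩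
    have : (star x).1 i - (star y).1 i = star (x.1 i - y.1 i) := by
      rw [star_sub]; rfl
    rw [this, norm_star]
    exact hK i)
  star_involutive := by
    intro x
    induction x using Quotient.inductionOn' with
    | _ x => exact congrArg Quotient.mk'' (star_star x)
  star_mul := by
    intro x y
    induction x using Quotient.inductionOn' with
    | _ x =>
      induction y using Quotient.inductionOn' with
      | _ y => exact congrArg Quotient.mk'' (star_mul x y)
  star_add := by
    intro x y
    induction x using Quotient.inductionOn' with
    | _ x =>
      induction y using Quotient.inductionOn' with
      | _ y => exact congrArg Quotient.mk'' (star_add x y)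

instance (f : ι → ℝ) : StarModule ℂ (AsymptoticAlgebra 𝒜 f) where
  star_smul := by
    intro r x
    induction x using Quotient.inductionOn' with
    | _ x => exact congrArg Quotient.mk'' (star_smul r x)

variable {𝒜}

/-- The class of a bounded family. -/
def asymp (f : ι → ℝ) (x : ∀ i, 𝒜 i) (hx : ∃ K : ℝ, ∀ i, ‖x i‖ ≤ K) : AsymptoticAlgebra 𝒜 f :=
  Quotient.mk'' (⟨x, hx⟩ : boundedFamilies 𝒜)

lemma exists_asymp_eq {f : ι → ℝ} (a : AsymptoticAlgebra 𝒜 f) :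
    ∃ (x : ∀ i, 𝒜 i) (hx : ∃ K : ℝ, ∀ i, ‖x i‖ ≤ K), asymp f x hx = a := by
  induction a using Quotient.inductionOn' with
  | _ x => exact ⟨x.1, x.2, rfl⟩

variable {f : ι → ℝ} {x y : ∀ i, 𝒜 i} {hx : ∃ K : ℝ, ∀ i, ‖x i‖ ≤ K} {hy : ∃ K : ℝ, ∀ i, ‖y i‖ ≤ K}

lemma asymp_eq_asymp :
    asymp f x hx = asymp f y hy ↔ ∃ K : ℝ, ∀ i, ‖x i - y i‖ ≤ K * |f i| :=
  Quotient.eq''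

lemma asymp_congr (h : x = y) : asymp f x hx = asymp f y hy := by
  subst h; rfl

lemma bounded_add (hx : ∃ K : ℝ, ∀ i, ‖x i‖ ≤ K) (hy : ∃ K : ℝ, ∀ i, ‖y i‖ ≤ K) :
    ∃ K : ℝ, ∀ i, ‖(x + y) i‖ ≤ K := (boundedFamilies 𝒜).add_mem hx hy

lemma bounded_sub (hx : ∃ K : ℝ, ∀ i, ‖x i‖ ≤ K) (hy : ∃ K : ℝ, ∀ i, ‖y i‖ ≤ K) :
    ∃ K : ℝ, ∀ i, ‖(x - y) i‖ ≤ K := (boundedFamilies 𝒜).sub_mem hx hy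

lemma bounded_mul (hx : ∃ K : ℝ, ∀ i, ‖x i‖ ≤ K) (hy : ∃ K : ℝ, ∀ i, ‖y i‖ ≤ K) :
    ∃ K : ℝ, ∀ i, ‖(x * y) i‖ ≤ K := (boundedFamilies 𝒜).mul_mem hx hy

lemma bounded_star (hx : ∃ K : ℝ, ∀ i, ‖x i‖ ≤ K) : ∃ K : ℝ, ∀ i, ‖(star x) i‖ ≤ K :=
  star_mem (s := boundedFamilies 𝒜) hx

lemma bounded_smul (c : ℂ) (hx : ∃ K : ℝ, ∀ i, ‖x i‖ ≤ K) : ∃ K : ℝ, ∀ i, ‖(c • x) i‖ ≤ K :=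
  (boundedFamilies 𝒜).smul_mem hx c

lemma bounded_one : ∃ K : ℝ, ∀ i, ‖(1 : ∀ i, 𝒜 i) i‖ ≤ K := (boundedFamilies 𝒜).one_mem

lemma bounded_zero : ∃ K : ℝ, ∀ i, ‖(0 : ∀ i, 𝒜 i) i‖ ≤ K := (boundedFamilies 𝒜).zero_mem

lemma bounded_sum {κ : Type*} (s : Finset κ) {x : κ → ∀ i, 𝒜 i}
    (hx : ∀ k, ∃ K : ℝ, ∀ i, ‖x k i‖ ≤ K) : ∃ K : ℝ, ∀ i, ‖(∑ k ∈ s, x k) i‖ ≤ K :=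
  sum_mem (S := boundedFamilies 𝒜) fun k _ => hx k

lemma asymp_add : asymp f x hx + asymp f y hy = asymp f (x + y) (bounded_add hx hy) := rfl

lemma asymp_mul : asymp f x hx * asymp f y hy = asymp f (x * y) (bounded_mul hx hy) := rfl

lemma asymp_sub : asymp f x hx - asymp f y hy = asymp f (x - y) (bounded_sub hx hy) := rfl

lemma asymp_star : star (asymp f x hx) = asymp f (star x) (bounded_star hx) := rfl

lemma asymp_smul (c : ℂ) : c • asymp f x hx = asymp f (c • x) (bounded_smul c hx) := rfl

lemma asymp_one : (1 : AsymptoticAlgebra 𝒜 f) = asymp f 1 bounded_one := rfl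

lemma asymp_zero : (0 : AsymptoticAlgebra 𝒜 f) = asymp f 0 bounded_zero := rfl

lemma asymp_sum {κ : Type*} (s : Finset κ) (x : κ → ∀ i, 𝒜 i)
    (hx : ∀ k, ∃ K : ℝ, ∀ i, ‖x k i‖ ≤ K) :
    ∑ k ∈ s, asymp f (x k) (hx k) = asymp f (∑ k ∈ s, x k) (bounded_sum s hx) := by
  classical
  induction s using Finset.induction_on with
  | empty => rfl
  | insert a s ha ih =>
    rw [Finset.sum_insert ha, ih, asymp_add]
    exact asymp_congr (Finset.sum_insert ha).symm

lemma bounded_pow (hx : ∃ K : ℝ, ∀ i, ‖x i‖ ≤ K) (n : ℕ) : ∃ K : ℝ, ∀ i, ‖(x ^ n) i‖ ≤ K :=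
  pow_mem (S := boundedFamilies 𝒜) hx n

lemma bound_of_asymp_eq (hf : ∀ i, 0 ≤ f i) (h : asymp f x hx = asymp f y hy) :
    ∃ K : ℝ, ∀ i, ‖x i - y i‖ ≤ K * f i := by
  obtain ⟨K, hK⟩ := asymp_eq_asymp.1 h
  exact ⟨K, fun i => by have := hK i; rwa [abs_of_nonneg (hf i)] at this⟩

end AsymptoticAlgebra

end CFR


/-! ### Graded matrix units -/

namespace CFR

/-- A system of `d × d` matrix units in a `*`-algebra, together with a self-adjoint square root `c`
of `1` that commutes with them. Such a system is the same as a unital `*`-homomorphism from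
`M_d × M_d`, the projection `(1 + c) / 2` being the image of `(1, 0)`. -/
structure GradedMatrixUnits (d : ℕ) (A : Type*) [Ring A] [StarRing A] [Algebra ℂ A] where
  /-- The matrix units. -/
  e : Fin d → Fin d → A
  /-- The grading. -/
  c : A
  e_mul_e : ∀ i j k l, e i j * e k l = if j = k then e i l else 0
  star_e : ∀ i j, star (e i j) = e j i
  sum_e : ∑ i, e i i = 1
  star_c : star c = c
  c_mul_c : c * c = 1
  c_comm : ∀ i j, c * e i j = e i j * c

namespace GradedMatrixUnits

variable {d : ℕ} {A : Type*} [Ring A] [StarRing A] [Algebra ℂ A]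

/-- The image of `(M, M^*)`, where `M^*` is the entrywise conjugate of `M`, under the homomorphism
from `M_d × M_d` that corresponds to a system of graded matrix units. -/
noncomputable def map (u : GradedMatrixUnits d A) (M : Matrix (Fin d) (Fin d) ℂ) : A :=
  ∑ a, ∑ b, (((M a b).re : ℂ) • 1 + (((M a b).im : ℂ) * Complex.I) • u.c) * u.e a b

lemma map_add (u : GradedMatrixUnits d A) (M N : Matrix (Fin d) (Fin d) ℂ) :
    u.map (M + N) = u.map M + u.map N := by
  simp only [map, ← Finset.sum_add_distrib, ← add_mul]
  refine Finset.sum_congr rfl fun a _ => Finset.sum_congr rfl fun b _ => ?_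
  congr 1
  simp only [Matrix.add_apply, Complex.add_re, Complex.add_im, Complex.ofReal_add, add_smul, add_mul]
  abel

lemma map_smul (u : GradedMatrixUnits d A) (r : ℝ) (M : Matrix (Fin d) (Fin d) ℂ) :
    u.map ((r : ℂ) • M) = (r : ℂ) • u.map M := by
  simp only [map, Finset.smul_sum, ← smul_mul_assoc, smul_add, smul_smul]
  refine Finset.sum_congr rfl fun a _ => Finset.sum_congr rfl fun b _ => ?_
  simp [mul_assoc]

lemma map_zero (u : GradedMatrixUnits d A) : u.map 0 = 0 := by
  simp [map]

lemma map_sum (u : GradedMatrixUnits d A) {κ : Type*} (s : Finset κ)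
    (M : κ → Matrix (Fin d) (Fin d) ℂ) : u.map (∑ k ∈ s, M k) = ∑ k ∈ s, u.map (M k) := by
  classical
  induction s using Finset.induction_on with
  | empty => simp [map_zero]
  | insert a s ha ih => rw [Finset.sum_insert ha, Finset.sum_insert ha, map_add, ih]

lemma map_one (u : GradedMatrixUnits d A) : u.map 1 = 1 := by
  rw [← u.sum_e, map]
  refine Finset.sum_congr rfl fun a _ => ?_
  rw [Finset.sum_eq_single a]
  · simp
  · intro b _ hb; simp [Matrix.one_apply_ne (Ne.symm hb)]
  · simp

end GradedMatrixUnits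

/-- Representatives of the first column `e_{a0}` of a system of graded matrix units, and a
self-adjoint one of the graded corner `c e_{00}`. -/
theorem GradedMatrixUnits.exists_representatives {d : ℕ} [NeZero d] {ι κ : Type*} [Fintype κ]
    {𝒜 : ι → Type*} [∀ i, NormedRing (𝒜 i)] [∀ i, StarRing (𝒜 i)] [∀ i, CStarRing (𝒜 i)]
    [∀ i, NormedAlgebra ℂ (𝒜 i)] [∀ i, StarModule ℂ (𝒜 i)] {f : ι → ℝ} (hf : ∀ i, 0 ≤ f i)
    (u : GradedMatrixUnits d (AsymptoticAlgebra 𝒜 f))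
    (P : κ → ∀ i, 𝒜 i) (hP : ∀ k, ∃ K : ℝ, ∀ i, ‖P k i‖ ≤ K) (M : κ → Matrix (Fin d) (Fin d) ℂ)
    (hu : ∀ k, asymp f (P k) (hP k) = u.map (M k)) :
    ∃ (K : ℝ) (x : Fin d → ∀ i, 𝒜 i) (y : ∀ i, 𝒜 i), 1 ≤ K ∧ (∀ i, star (y i) = y i) ∧
      (∀ a i, ‖x a i‖ ≤ K) ∧ (∀ i, ‖y i ^ 3 - y i‖ ≤ K * f i) ∧
      (∀ a b i, ‖star (x a i) * x b i - if a = b then y i ^ 2 else 0‖ ≤ K * f i) ∧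
      (∀ a i, ‖x a i * y i ^ 2 - x a i‖ ≤ K * f i) ∧
      (∀ i, ‖∑ a, x a i * star (x a i) - 1‖ ≤ K * f i) ∧
      ∀ k i, ‖∑ a, ∑ b, x a i * (((M k a b).re : ℂ) • 1 +
        (((M k a b).im : ℂ) * Complex.I) • y i) * star (x b i) - P k i‖ ≤ K * f i := by
  choose x hx hxe using fun a : Fin d => exists_asymp_eq (u.e a 0)
  obtain ⟨y₀, hy₀, hye⟩ := exists_asymp_eq (u.c * u.e 0 0)
  -- a self-adjoint representative of the graded corner
  set y := (1 / 2 : ℂ) • (y₀ + star y₀) with hy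
  have hyb : ∃ K : ℝ, ∀ i, ‖y i‖ ≤ K := bounded_smul _ (bounded_add hy₀ (bounded_star hy₀))
  have hyc : asymp f y hyb = u.c * u.e 0 0 := by
    have h1 : asymp f y hyb = (1 / 2 : ℂ) • (asymp f y₀ hy₀ + star (asymp f y₀ hy₀)) := rfl
    rw [h1, hye, star_mul, u.star_e, u.star_c, u.c_comm, ← two_smul ℂ, smul_smul]
    norm_num
  have hyH : ∀ i, star (y i) = y i := fun i => by
    have : star y = y := by
      rw [hy, star_smul, star_add, star_star, add_comm]
      simp
    exact congrFun this i
  have hy2 : (u.c * u.e 0 0) * (u.c * u.e 0 0) = u.e 0 0 := by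
    rw [mul_assoc, ← mul_assoc (u.e 0 0), ← u.c_comm, mul_assoc, u.e_mul_e, if_pos rfl, ← mul_assoc,
      u.c_mul_c, one_mul]
  -- each relation between the classes gives a bound for the representatives
  have r1 : ∃ K : ℝ, ∀ i, ‖y i ^ 3 - y i‖ ≤ K * f i := by
    have e : asymp f (y ^ 3) (bounded_pow hyb 3) = asymp f y hyb ^ 3 := rfl
    have h : asymp f (y ^ 3) (bounded_pow hyb 3) = asymp f y hyb := by
      refine e.trans ?_
      rw [hyc, pow_succ, sq, hy2, ← mul_assoc, ← u.c_comm, mul_assoc, u.e_mul_e, if_pos rfl]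
    exact bound_of_asymp_eq hf h
  have r2 : ∀ a b, ∃ K : ℝ, ∀ i, ‖star (x a i) * x b i - if a = b then y i ^ 2 else 0‖ ≤ K * f i := by
    intro a b
    have e : asymp f (star (x a) * x b) (bounded_mul (bounded_star (hx a)) (hx b)) =
        star (asymp f (x a) (hx a)) * asymp f (x b) (hx b) := rfl
    rw [hxe, hxe, u.star_e, u.e_mul_e] at e
    by_cases hab : a = b
    · have e' : asymp f (y ^ 2) (bounded_pow hyb 2) = asymp f y hyb ^ 2 := rfl
      rw [hyc, sq (u.c * u.e 0 0), hy2] at e'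
      simp only [if_pos hab] at e ⊢
      exact bound_of_asymp_eq hf (e.trans e'.symm)
    · simp only [if_neg hab] at e ⊢
      exact bound_of_asymp_eq (y := 0) (hy := bounded_zero) hf e
  have r3 : ∀ a, ∃ K : ℝ, ∀ i, ‖x a i * y i ^ 2 - x a i‖ ≤ K * f i := by
    intro a
    have e : asymp f (x a * y ^ 2) (bounded_mul (hx a) (bounded_pow hyb 2)) =
        asymp f (x a) (hx a) * asymp f y hyb ^ 2 := rfl
    have h : asymp f (x a * y ^ 2) (bounded_mul (hx a) (bounded_pow hyb 2)) =
        asymp f (x a) (hx a) := by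
      refine e.trans ?_
      rw [hyc, sq, hy2, hxe, u.e_mul_e, if_pos rfl]
    exact bound_of_asymp_eq hf h
  have r4 : ∃ K : ℝ, ∀ i, ‖∑ a, x a i * star (x a i) - 1‖ ≤ K * f i := by
    have h : asymp f (∑ a, x a * star (x a))
        (bounded_sum _ fun a => bounded_mul (hx a) (bounded_star (hx a)))
        = asymp f 1 bounded_one := by
      refine (asymp_sum (f := f) Finset.univ (fun a => x a * star (x a))
        (fun a => bounded_mul (hx a) (bounded_star (hx a)))).symm.trans ?_
      have e : ∀ a, asymp f (x a * star (x a)) (bounded_mul (hx a) (bounded_star (hx a)))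
          = asymp f (x a) (hx a) * star (asymp f (x a) (hx a)) := fun a => rfl
      simp only [e, hxe, u.star_e, u.e_mul_e, if_true]
      exact u.sum_e
    obtain ⟨K, hK⟩ := bound_of_asymp_eq hf h
    refine ⟨K, fun i => ?_⟩
    have := hK i
    rw [Finset.sum_apply] at this
    exact this
  have r5 : ∀ k, ∃ K : ℝ, ∀ i, ‖∑ a, ∑ b, x a i * (((M k a b).re : ℂ) • 1 +
      (((M k a b).im : ℂ) * Complex.I) • y i) * star (x b i) - P k i‖ ≤ K * f i := by
    intro k
    have hb : ∀ a b, ∃ K : ℝ, ∀ i, ‖(x a * (((M k a b).re : ℂ) • 1 +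
        (((M k a b).im : ℂ) * Complex.I) • y) * star (x b)) i‖ ≤ K := fun a b =>
      bounded_mul (bounded_mul (hx a) (bounded_add (bounded_smul _ bounded_one)
        (bounded_smul _ hyb))) (bounded_star (hx b))
    have h : asymp f (∑ a, ∑ b, x a * (((M k a b).re : ℂ) • 1 +
        (((M k a b).im : ℂ) * Complex.I) • y) * star (x b))
        (bounded_sum _ fun a => bounded_sum _ fun b => hb a b) = asymp f (P k) (hP k) := by
      rw [hu, GradedMatrixUnits.map]
      refine (asymp_sum (f := f) Finset.univ (fun a => ∑ b, x a * (((M k a b).re : ℂ) • 1 +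
        (((M k a b).im : ℂ) * Complex.I) • y) * star (x b))
        (fun a => bounded_sum _ fun b => hb a b)).symm.trans ?_
      refine Finset.sum_congr rfl fun a _ => ?_
      refine (asymp_sum (f := f) Finset.univ (fun b => x a * (((M k a b).re : ℂ) • 1 +
        (((M k a b).im : ℂ) * Complex.I) • y) * star (x b)) (fun b => hb a b)).symm.trans ?_
      refine Finset.sum_congr rfl fun b _ => ?_
      have e1 : asymp f (x a * (((M k a b).re : ℂ) • 1 +
          (((M k a b).im : ℂ) * Complex.I) • y) * star (x b)) (hb a b) =
          asymp f (x a) (hx a) * (((M k a b).re : ℂ) • 1 +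
          (((M k a b).im : ℂ) * Complex.I) • asymp f y hyb) * star (asymp f (x b) (hx b)) := rfl
      rw [e1, hxe, hxe, hyc, u.star_e]
      simp only [mul_add, add_mul, smul_mul_assoc, mul_smul_comm, mul_one, one_mul, u.e_mul_e,
        if_true]
      rw [← mul_assoc, ← u.c_comm, mul_assoc u.c, mul_assoc u.c, u.e_mul_e, if_pos rfl, u.e_mul_e,
        if_pos rfl]
    obtain ⟨K, hK⟩ := bound_of_asymp_eq hf h
    refine ⟨K, fun i => ?_⟩
    have := hK i
    simp only [Finset.sum_apply] at this
    exact this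
  obtain ⟨K₁, hK₁⟩ := r1
  choose K₂ hK₂ using r2
  choose K₃ hK₃ using r3
  obtain ⟨K₄, hK₄⟩ := r4
  choose K₅ hK₅ using r5
  have hx' := hx
  choose B hB using hx'
  -- a common bound for all the constants
  set K := 1 + |K₁| + ∑ a, ∑ b, |K₂ a b| + ∑ a, |K₃ a| + |K₄| + ∑ k, |K₅ k| + ∑ a, |B a| with hKdef
  have n2 : ∀ a, 0 ≤ ∑ b, |K₂ a b| := fun a => Finset.sum_nonneg fun _ _ => abs_nonneg _
  have n2' : 0 ≤ ∑ a, ∑ b, |K₂ a b| := Finset.sum_nonneg fun a _ => n2 a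
  have n3 : 0 ≤ ∑ a, |K₃ a| := Finset.sum_nonneg fun _ _ => abs_nonneg _
  have n5 : 0 ≤ ∑ k, |K₅ k| := Finset.sum_nonneg fun _ _ => abs_nonneg _
  have nB : 0 ≤ ∑ a, |B a| := Finset.sum_nonneg fun _ _ => abs_nonneg _
  have k1 := abs_nonneg K₁
  have k4 := abs_nonneg K₄
  have b1 : K₁ ≤ K := by linarith [le_abs_self K₁]
  have b4 : K₄ ≤ K := by linarith [le_abs_self K₄]
  have b2 : ∀ a b, K₂ a b ≤ K := fun a b => by
    have h1 := Finset.single_le_sum (f := fun b => |K₂ a b|) (fun _ _ => abs_nonneg _)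
      (Finset.mem_univ b)
    have h2 := Finset.single_le_sum (f := fun a => ∑ b, |K₂ a b|) (fun a _ => n2 a)
      (Finset.mem_univ a)
    linarith [le_abs_self (K₂ a b)]
  have b3 : ∀ a, K₃ a ≤ K := fun a => by
    have h1 := Finset.single_le_sum (f := fun b => |K₃ b|) (fun _ _ => abs_nonneg _)
      (Finset.mem_univ a)
    linarith [le_abs_self (K₃ a)]
  have b5 : ∀ a, K₅ a ≤ K := fun a => by
    have h1 := Finset.single_le_sum (f := fun b => |K₅ b|) (fun _ _ => abs_nonneg _)
      (Finset.mem_univ a)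
    linarith [le_abs_self (K₅ a)]
  have bB : ∀ a, B a ≤ K := fun a => by
    have h1 := Finset.single_le_sum (f := fun b => |B b|) (fun _ _ => abs_nonneg _)
      (Finset.mem_univ a)
    linarith [le_abs_self (B a)]
  have hK1 : 1 ≤ K := by linarith
  have hKpos : 0 < K := by linarith
  exact ⟨K, x, y, hK1, hyH, fun a i => (hB a i).trans (bB a),
    fun i => (hK₁ i).trans (mul_le_mul_of_nonneg_right b1 (hf i)),
    fun a b i => (hK₂ a b i).trans (mul_le_mul_of_nonneg_right (b2 a b) (hf i)),
    fun a i => (hK₃ a i).trans (mul_le_mul_of_nonneg_right (b3 a) (hf i)),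
    fun i => (hK₄ i).trans (mul_le_mul_of_nonneg_right b4 (hf i)),
    fun k i => (hK₅ k i).trans (mul_le_mul_of_nonneg_right (b5 k) (hf i))⟩

open scoped Matrix.Norms.L2Operator

/-- If the relations between the matrices `P i k`, modulo `O(f)`, are such that their classes come
from the matrices `M k` through a system of graded matrix units, then `P i` is within `O(f i)` of
an exact amplification of `M`, as soon as `f i` is small. -/
theorem exists_amplification_near {d : ℕ} [NeZero d] {ι κ : Type*} {D : ι → ℕ} {f : ι → ℝ}
    (hf : ∀ i, 0 ≤ f i) (P : κ → ∀ i, Matrix (Fin (D i)) (Fin (D i)) ℂ)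
    (hP : ∀ k, ∃ K : ℝ, ∀ i, ‖P k i‖ ≤ K) (M : κ → Matrix (Fin d) (Fin d) ℂ)
    (hM : ∀ k a b, ‖M k a b‖ ≤ 1) [Fintype κ]
    (u : GradedMatrixUnits d (AsymptoticAlgebra (fun i => Matrix (Fin (D i)) (Fin (D i)) ℂ) f))
    (hu : ∀ k, asymp f (P k) (hP k) = u.map (M k)) :
    ∃ C η₀ : ℝ, 0 < η₀ ∧ ∀ i, f i ≤ η₀ → ∃ m₁ m₂ : ℕ, m₁ + m₂ = D i / d ∧
      ∃ V : Matrix (Fin (D i)) ((Fin d × Fin m₁) ⊕ (Fin d × Fin m₂)) ℂ, Vᴴ * V = 1 ∧ V * Vᴴ = 1 ∧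
        ∀ k, ‖V * amplify m₁ m₂ (M k) * Vᴴ - P k i‖ ≤ C * f i := by
  obtain ⟨K, x, y, hK1, hyH, hB, h1, h2, h3, h4, h5⟩ := u.exists_representatives hf P hP M hu
  have hKpos : 0 < K := by linarith
  obtain ⟨C, η₀, hη₀, hC⟩ := exists_unitary_near (d := d) (NeZero.pos d) hK1
  refine ⟨C * K + K, η₀ / K, by positivity, fun i hi => ?_⟩
  have hη : K * f i ≤ η₀ := by rw [le_div_iff₀ hKpos] at hi; linarith
  obtain ⟨m₁, m₂, hm, V, hV, hV', hVP⟩ := hC (D i) (K * f i) (fun a => x a i) (y i) hη (hyH i)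
    (fun a => hB a i) (h1 i) (fun a b => h2 a b i) (fun a => h3 a i) (h4 i)
  refine ⟨m₁, m₂, hm, V, hV, hV', fun k => ?_⟩
  have h5' := h5 k i
  simp only [Matrix.star_eq_conjTranspose] at h5'
  have h6 := norm_add_le _ _ |>.trans (add_le_add (hVP (M k) (hM k)) h5')
  rw [sub_add_sub_cancel] at h6
  linarith

end CFR


namespace CFR

section Unbiased

variable {A : Type*} [Ring A] [StarRing A] [Algebra ℂ A] [StarModule ℂ A]

/-- A projection `f` that is unbiased to a resolution of the identity `z`, in the sense that
`d z_i f z_i = z_i` and `d f z_i f = f`, generates matrix units together with it. -/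
noncomputable def GradedMatrixUnits.ofUnbiased {d : ℕ} [NeZero d] (z : Fin d → A) (f c : A)
    (hz : ∀ i j, z i * z j = if i = j then z i else 0) (hsum : ∑ i, z i = 1)
    (hzs : ∀ i, star (z i) = z i) (hfs : star f = f)
    (hzf : ∀ i, (d : ℂ) • (z i * f * z i) = z i) (hfz : ∀ i, (d : ℂ) • (f * z i * f) = f)
    (hcs : star c = c) (hcc : c * c = 1) (hcz : ∀ i, c * z i = z i * c) (hcf : c * f = f * c) :
    GradedMatrixUnits d A where
  e i j := (d : ℂ) • (z i * f * z j)
  c := c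
  e_mul_e := by
    intro i j k l
    rw [smul_mul_smul_comm]
    by_cases hjk : j = k
    · subst hjk
      rw [if_pos rfl]
      have h1 : z i * f * z j * (z j * f * z l) = z i * (f * z j * f) * z l := by
        have := hz j j
        rw [if_pos rfl] at this
        calc _ = z i * f * (z j * z j) * f * z l := by simp only [mul_assoc]
          _ = _ := by rw [this]; simp only [mul_assoc]
      have h2 : (d : ℂ) • (z i * (f * z j * f) * z l) = z i * f * z l := by
        rw [← smul_mul_assoc, ← mul_smul_comm, hfz]
      rw [h1, mul_smul, h2]
    · have h1 : z i * f * z j * (z k * f * z l) = z i * f * (z j * z k) * f * z l := by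
        simp only [mul_assoc]
      rw [if_neg hjk, h1, hz, if_neg hjk]
      simp
  star_e := by
    intro i j
    simp [star_smul, hzs, hfs, mul_assoc]
  sum_e := by simp [hzf, hsum]
  star_c := hcs
  c_mul_c := hcc
  c_comm := by
    intro i j
    rw [mul_smul_comm, smul_mul_assoc]
    congr 1
    calc c * (z i * f * z j) = c * z i * f * z j := by simp only [mul_assoc]
      _ = z i * (c * f) * z j := by rw [hcz]; simp only [mul_assoc]
      _ = z i * f * (c * z j) := by rw [hcf]; simp only [mul_assoc]
      _ = _ := by rw [hcz]; simp only [mul_assoc]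

omit [StarModule ℂ A] in
lemma GradedMatrixUnits.map_of_c_eq_one {d : ℕ} (u : GradedMatrixUnits d A) (hc : u.c = 1)
    (M : Matrix (Fin d) (Fin d) ℂ) : u.map M = ∑ a, ∑ b, M a b • u.e a b := by
  refine Finset.sum_congr rfl fun a _ => Finset.sum_congr rfl fun b _ => ?_
  rw [hc, ← add_smul, Complex.re_add_im, smul_mul_assoc, one_mul]

end Unbiased

/-! ### The rays of Peres -/

/-- Integer coordinates of the rays of Peres. -/
def peresInt : Fin 24 → Fin 4 → ℤ :=
  ![![1, 0, 0, 0], ![0, 1, 0, 0], ![0, 0, 1, 0], ![0, 0, 0, 1],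
    ![1, 1, 1, 1], ![1, 1, -1, -1], ![1, -1, 1, -1], ![1, -1, -1, 1],
    ![1, 1, 1, -1], ![1, 1, -1, 1], ![1, -1, 1, 1], ![-1, 1, 1, 1],
    ![1, 1, 0, 0], ![1, -1, 0, 0], ![0, 0, 1, 1], ![0, 0, 1, -1],
    ![1, 0, 1, 0], ![1, 0, -1, 0], ![0, 1, 0, 1], ![0, 1, 0, -1],
    ![1, 0, 0, 1], ![1, 0, 0, -1], ![0, 1, 1, 0], ![0, 1, -1, 0]]

/-- The orthogonal bases formed by the rays of Peres. Each ray lies in four of them. -/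
def peresBasis : Fin 24 → Fin 4 → Fin 24 :=
  ![![0, 1, 2, 3], ![4, 5, 6, 7], ![8, 9, 10, 11], ![12, 13, 2, 3],
    ![12, 13, 14, 15], ![12, 14, 6, 7], ![12, 15, 10, 11], ![13, 14, 8, 9],
    ![13, 15, 4, 5], ![14, 15, 0, 1], ![16, 17, 1, 3], ![16, 17, 18, 19],
    ![16, 18, 5, 7], ![16, 19, 9, 11], ![17, 18, 8, 10], ![17, 19, 4, 6],
    ![18, 19, 0, 2], ![20, 21, 1, 2], ![20, 21, 22, 23], ![20, 22, 5, 6],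
    ![20, 23, 8, 11], ![21, 22, 9, 10], ![21, 23, 4, 7], ![22, 23, 0, 3]]

/-- Orthogonality of two rays of Peres. -/
def PeresOrth (i j : Fin 24) : Prop := i ≠ j ∧ ∑ a, peresInt i a * peresInt j a = 0

instance : DecidableRel PeresOrth := fun _ _ => inferInstanceAs (Decidable (_ ∧ _))

section Peres

variable {A : Type*} [Ring A]

/-- Products of signed sums of orthogonal idempotents. -/
lemma signed_sum_mul {f₁ f₂ f₃ f₄ : A} (h1 : f₁ * f₁ = f₁) (h2 : f₂ * f₂ = f₂) (h3 : f₃ * f₃ = f₃)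
    (h4 : f₄ * f₄ = f₄) (h12 : f₁ * f₂ = 0) (h21 : f₂ * f₁ = 0) (h13 : f₁ * f₃ = 0)
    (h31 : f₃ * f₁ = 0) (h14 : f₁ * f₄ = 0) (h41 : f₄ * f₁ = 0) (h23 : f₂ * f₃ = 0)
    (h32 : f₃ * f₂ = 0) (h24 : f₂ * f₄ = 0) (h42 : f₄ * f₂ = 0) (h34 : f₃ * f₄ = 0)
    (h43 : f₄ * f₃ = 0) :
    (f₁ + f₂ - f₃ - f₄) * (f₁ + f₃ - f₂ - f₄) = f₁ + f₄ - f₂ - f₃ := by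
  simp only [mul_sub, sub_mul, mul_add, add_mul, h1, h2, h3, h4, h12, h21, h13, h31, h14, h41, h23,
    h32, h24, h42, h34, h43]
  abel

/-- The rule by which a swap `p` of two coordinates `z`, `z'` loses its diagonal part: its products
with the swaps of the other pairs of coordinates are swaps again. -/
lemma compress_swap_eq_zero [Algebra ℂ A] {z p p' r r' s s' z' : A} (hp' : z * p' = 0)
    (hs' : z * s' = 0)
    (h1 : (p + p') * (r + r') = s + s') (h2 : (p - p') * (r - r') = s' - s)
    (hr : r * r = z + z') (hz' : p * z' = 0) : z * p * z = 0 := by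
  have h3 : z * p * (r + r') = z * s := by
    have := congrArg (z * ·) h1
    simp only [← mul_assoc, mul_add, add_mul, hp', hs'] at this
    rw [mul_add]
    simpa using this
  have h4 : z * p * (r - r') = -(z * s) := by
    have := congrArg (z * ·) h2
    simp only [← mul_assoc, mul_sub, sub_mul, hp', hs'] at this
    rw [mul_sub]
    simpa using this
  have h5 : (2 : ℂ) • (z * p * r) = 0 := by
    have h6 : z * p * (r + r') + z * p * (r - r') = (2 : ℂ) • (z * p * r) := by
      rw [two_smul, mul_add, mul_sub]; abel
    rw [← h6, h3, h4, add_neg_cancel]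
  have h6 : z * p * r = 0 := (smul_eq_zero_iff_right two_ne_zero).1 h5
  have h7 : z * p * (r * r) = 0 := by rw [← mul_assoc, h6, zero_mul]
  rw [hr, mul_add, mul_assoc z p z', hz', mul_zero, add_zero] at h7
  exact h7

/-- A swap of two coordinates exchanges the corresponding projections. -/
lemma swap_conj {z z' a : A} (hz' : z' * z' = z')
    (h' : z' * z = 0) (hl : z * a + z' * a = a) (hr : a * z + a * z' = a) (hsq : a * a = z + z')
    (hd : z * a * z = 0) (hd' : z' * a * z' = 0) :
    a = z * a * z' + z' * a * z ∧ a * z * a = z' := by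
  have h1 : z * a = z * a * z' := by
    conv_lhs => rw [← hr]
    rw [mul_add, ← mul_assoc, ← mul_assoc, hd, zero_add]
  have h2 : z' * a = z' * a * z := by
    conv_lhs => rw [← hr]
    rw [mul_add, ← mul_assoc, ← mul_assoc, hd', add_zero]
  have h3 : a * z = z' * a * z := by
    conv_lhs => rw [← hl]
    rw [add_mul, hd, zero_add]
  refine ⟨by rw [← h1, ← h2, hl], ?_⟩
  rw [h3, ← h2, mul_assoc, hsq, mul_add, h', hz', zero_add]

end Peres

variable {A : Type*} [Ring A] [StarRing A] [Algebra ℂ A] [StarModule ℂ A]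

set_option maxHeartbeats 1000000 in
/-- Twenty-four projections with the orthogonality relations and the bases of the rays of Peres are
the rays of Peres, in suitable matrix units. -/
theorem exists_peres_units (P : Fin 24 → A) (hsa : ∀ i, star (P i) = P i)
    (hid : ∀ i, P i * P i = P i) (o : ∀ i j, PeresOrth i j → P i * P j = 0)
    (hbasis : ∀ n, ∑ a, P (peresBasis n a) = 1) :
    ∃ u : GradedMatrixUnits 4 A, u.c = 1 ∧ ∀ k, P k = ∑ a, ∑ b,
      ((peresInt k a * peresInt k b : ℤ) / (∑ a, peresInt k a * peresInt k a : ℤ) : ℂ) •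
        u.e a b := by
  have B : ∀ i j k l, (∃ n, ![i, j, k, l] = peresBasis n) → P i + P j + P k + P l = 1 := by
    rintro i j k l ⟨n, h⟩
    have h1 := hbasis n
    rw [← h, Fin.sum_univ_four] at h1
    exact h1
  have bz := B 0 1 2 3 (by decide)
  have bf := B 4 5 6 7 (by decide)
  have bg := B 8 9 10 11 (by decide)
  -- the swap of the coordinates `i`, `j`
  obtain ⟨A₁₂, hA₁₂⟩ : ∃ x, x = P 12 - P 13 := ⟨_, rfl⟩
  obtain ⟨A₃₄, hA₃₄⟩ : ∃ x, x = P 14 - P 15 := ⟨_, rfl⟩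
  obtain ⟨A₁₃, hA₁₃⟩ : ∃ x, x = P 16 - P 17 := ⟨_, rfl⟩
  obtain ⟨A₂₄, hA₂₄⟩ : ∃ x, x = P 18 - P 19 := ⟨_, rfl⟩
  obtain ⟨A₁₄, hA₁₄⟩ : ∃ x, x = P 20 - P 21 := ⟨_, rfl⟩
  obtain ⟨A₂₃, hA₂₃⟩ : ∃ x, x = P 22 - P 23 := ⟨_, rfl⟩
  -- the sum and the difference of the swaps of complementary pairs are signed sums of the members of
  -- one of the two bases of rays without zero coordinates
  have e1 : A₁₂ + A₃₄ = P 4 + P 5 - P 6 - P 7 := by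
    have h1 := B 12 14 6 7 (by decide)
    have h2 := B 13 15 4 5 (by decide)
    linear_combination (norm := (simp only [hA₁₂, hA₃₄]; abel)) h1 - h2
  have e2 : A₁₃ + A₂₄ = P 4 + P 6 - P 5 - P 7 := by
    have h1 := B 16 18 5 7 (by decide)
    have h2 := B 17 19 4 6 (by decide)
    linear_combination (norm := (simp only [hA₁₃, hA₂₄]; abel)) h1 - h2
  have e3 : A₁₄ + A₂₃ = P 4 + P 7 - P 5 - P 6 := by
    have h1 := B 20 22 5 6 (by decide)
    have h2 := B 21 23 4 7 (by decide)
    linear_combination (norm := (simp only [hA₁₄, hA₂₃]; abel)) h1 - h2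
  have e4 : A₁₂ - A₃₄ = P 8 + P 9 - P 10 - P 11 := by
    have h1 := B 12 15 10 11 (by decide)
    have h2 := B 13 14 8 9 (by decide)
    linear_combination (norm := (simp only [hA₁₂, hA₃₄]; abel)) h1 - h2
  have e5 : A₁₃ - A₂₄ = P 8 + P 10 - P 9 - P 11 := by
    have h1 := B 16 19 9 11 (by decide)
    have h2 := B 17 18 8 10 (by decide)
    linear_combination (norm := (simp only [hA₁₃, hA₂₄]; abel)) h1 - h2
  have e6 : A₂₃ - A₁₄ = P 8 + P 11 - P 9 - P 10 := by
    have h1 := B 20 23 8 11 (by decide)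
    have h2 := B 21 22 9 10 (by decide)
    linear_combination (norm := (simp only [hA₁₄, hA₂₃]; abel)) h2 - h1
  have S : ∀ i j k l, (PeresOrth i j ∧ PeresOrth j i ∧ PeresOrth i k ∧ PeresOrth k i ∧
      PeresOrth i l ∧ PeresOrth l i ∧ PeresOrth j k ∧ PeresOrth k j ∧ PeresOrth j l ∧
      PeresOrth l j ∧ PeresOrth k l ∧ PeresOrth l k) →
      ∀ x y, x = P i + P j - P k - P l → y = P i + P k - P j - P l →
      x * y = P i + P l - P j - P k := by
    rintro i j k l h _ _ rfl rfl
    exact signed_sum_mul (hid i) (hid j) (hid k) (hid l) (o _ _ h.1) (o _ _ h.2.1)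
      (o _ _ h.2.2.1) (o _ _ h.2.2.2.1) (o _ _ h.2.2.2.2.1) (o _ _ h.2.2.2.2.2.1)
      (o _ _ h.2.2.2.2.2.2.1) (o _ _ h.2.2.2.2.2.2.2.1) (o _ _ h.2.2.2.2.2.2.2.2.1)
      (o _ _ h.2.2.2.2.2.2.2.2.2.1) (o _ _ h.2.2.2.2.2.2.2.2.2.2.1)
      (o _ _ h.2.2.2.2.2.2.2.2.2.2.2)
  -- the three sums multiply like the elements of a Klein four-group, and so do the three differences
  have m01 : (A₁₂ + A₃₄) * (A₁₃ + A₂₄) = A₁₄ + A₂₃ :=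
    (S 4 5 6 7 (by decide) _ _ (e1.trans (by abel)) (e2.trans (by abel))).trans
      (e3.trans (by abel)).symm
  have n01 : (A₁₂ - A₃₄) * (A₁₃ - A₂₄) = A₂₃ - A₁₄ :=
    (S 8 9 10 11 (by decide) _ _ (e4.trans (by abel)) (e5.trans (by abel))).trans
      (e6.trans (by abel)).symm
  have m02 : (A₁₂ + A₃₄) * (A₁₄ + A₂₃) = A₁₃ + A₂₄ :=
    (S 4 5 7 6 (by decide) _ _ (e1.trans (by abel)) (e3.trans (by abel))).trans
      (e2.trans (by abel)).symm
  have n02 : (A₁₂ - A₃₄) * (A₂₃ - A₁₄) = A₁₃ - A₂₄ :=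
    (S 8 9 11 10 (by decide) _ _ (e4.trans (by abel)) (e6.trans (by abel))).trans
      (e5.trans (by abel)).symm
  have m10 : (A₁₃ + A₂₄) * (A₁₂ + A₃₄) = A₁₄ + A₂₃ :=
    (S 4 6 5 7 (by decide) _ _ (e2.trans (by abel)) (e1.trans (by abel))).trans
      (e3.trans (by abel)).symm
  have n10 : (A₁₃ - A₂₄) * (A₁₂ - A₃₄) = A₂₃ - A₁₄ :=
    (S 8 10 9 11 (by decide) _ _ (e5.trans (by abel)) (e4.trans (by abel))).trans
      (e6.trans (by abel)).symm
  have m12 : (A₁₃ + A₂₄) * (A₁₄ + A₂₃) = A₁₂ + A₃₄ :=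
    (S 4 6 7 5 (by decide) _ _ (e2.trans (by abel)) (e3.trans (by abel))).trans
      (e1.trans (by abel)).symm
  have n12 : (A₁₃ - A₂₄) * (A₂₃ - A₁₄) = A₁₂ - A₃₄ :=
    (S 8 10 11 9 (by decide) _ _ (e5.trans (by abel)) (e6.trans (by abel))).trans
      (e4.trans (by abel)).symm
  have m20 : (A₁₄ + A₂₃) * (A₁₂ + A₃₄) = A₁₃ + A₂₄ :=
    (S 4 7 5 6 (by decide) _ _ (e3.trans (by abel)) (e1.trans (by abel))).trans
      (e2.trans (by abel)).symm
  have n20 : (A₂₃ - A₁₄) * (A₁₂ - A₃₄) = A₁₃ - A₂₄ :=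
    (S 8 11 9 10 (by decide) _ _ (e6.trans (by abel)) (e4.trans (by abel))).trans
      (e5.trans (by abel)).symm
  have m21 : (A₁₄ + A₂₃) * (A₁₃ + A₂₄) = A₁₂ + A₃₄ :=
    (S 4 7 6 5 (by decide) _ _ (e3.trans (by abel)) (e2.trans (by abel))).trans
      (e1.trans (by abel)).symm
  have n21 : (A₂₃ - A₁₄) * (A₁₃ - A₂₄) = A₁₂ - A₃₄ :=
    (S 8 11 10 9 (by decide) _ _ (e6.trans (by abel)) (e5.trans (by abel))).trans
      (e4.trans (by abel)).symm
  -- each swap squares to the projection on its two coordinates and annihilates the other two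
  have qA₁₂ : A₁₂ * A₁₂ = P 0 + P 1 := by
    have h1 := B 12 13 2 3 (by decide)
    simp only [hA₁₂, mul_sub, sub_mul, hid, o 12 13 (by decide), o 13 12 (by decide)]
    linear_combination (norm := abel) h1 - bz
  have z3A₁₂ : P 2 * A₁₂ = 0 := by
    rw [hA₁₂, mul_sub, o 2 12 (by decide), o 2 13 (by decide), sub_zero]
  have A₁₂z3 : A₁₂ * P 2 = 0 := by
    rw [hA₁₂, sub_mul, o 12 2 (by decide), o 13 2 (by decide), sub_zero]
  have z4A₁₂ : P 3 * A₁₂ = 0 := by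
    rw [hA₁₂, mul_sub, o 3 12 (by decide), o 3 13 (by decide), sub_zero]
  have A₁₂z4 : A₁₂ * P 3 = 0 := by
    rw [hA₁₂, sub_mul, o 12 3 (by decide), o 13 3 (by decide), sub_zero]
  have qA₃₄ : A₃₄ * A₃₄ = P 2 + P 3 := by
    have h1 := B 14 15 0 1 (by decide)
    simp only [hA₃₄, mul_sub, sub_mul, hid, o 14 15 (by decide), o 15 14 (by decide)]
    linear_combination (norm := abel) h1 - bz
  have z1A₃₄ : P 0 * A₃₄ = 0 := by
    rw [hA₃₄, mul_sub, o 0 14 (by decide), o 0 15 (by decide), sub_zero]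
  have A₃₄z1 : A₃₄ * P 0 = 0 := by
    rw [hA₃₄, sub_mul, o 14 0 (by decide), o 15 0 (by decide), sub_zero]
  have z2A₃₄ : P 1 * A₃₄ = 0 := by
    rw [hA₃₄, mul_sub, o 1 14 (by decide), o 1 15 (by decide), sub_zero]
  have A₃₄z2 : A₃₄ * P 1 = 0 := by
    rw [hA₃₄, sub_mul, o 14 1 (by decide), o 15 1 (by decide), sub_zero]
  have qA₁₃ : A₁₃ * A₁₃ = P 0 + P 2 := by
    have h1 := B 16 17 1 3 (by decide)
    simp only [hA₁₃, mul_sub, sub_mul, hid, o 16 17 (by decide), o 17 16 (by decide)]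
    linear_combination (norm := abel) h1 - bz
  have z2A₁₃ : P 1 * A₁₃ = 0 := by
    rw [hA₁₃, mul_sub, o 1 16 (by decide), o 1 17 (by decide), sub_zero]
  have A₁₃z2 : A₁₃ * P 1 = 0 := by
    rw [hA₁₃, sub_mul, o 16 1 (by decide), o 17 1 (by decide), sub_zero]
  have z4A₁₃ : P 3 * A₁₃ = 0 := by
    rw [hA₁₃, mul_sub, o 3 16 (by decide), o 3 17 (by decide), sub_zero]
  have A₁₃z4 : A₁₃ * P 3 = 0 := by
    rw [hA₁₃, sub_mul, o 16 3 (by decide), o 17 3 (by decide), sub_zero]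
  have qA₂₄ : A₂₄ * A₂₄ = P 1 + P 3 := by
    have h1 := B 18 19 0 2 (by decide)
    simp only [hA₂₄, mul_sub, sub_mul, hid, o 18 19 (by decide), o 19 18 (by decide)]
    linear_combination (norm := abel) h1 - bz
  have z1A₂₄ : P 0 * A₂₄ = 0 := by
    rw [hA₂₄, mul_sub, o 0 18 (by decide), o 0 19 (by decide), sub_zero]
  have A₂₄z1 : A₂₄ * P 0 = 0 := by
    rw [hA₂₄, sub_mul, o 18 0 (by decide), o 19 0 (by decide), sub_zero]
  have z3A₂₄ : P 2 * A₂₄ = 0 := by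
    rw [hA₂₄, mul_sub, o 2 18 (by decide), o 2 19 (by decide), sub_zero]
  have A₂₄z3 : A₂₄ * P 2 = 0 := by
    rw [hA₂₄, sub_mul, o 18 2 (by decide), o 19 2 (by decide), sub_zero]
  have qA₁₄ : A₁₄ * A₁₄ = P 0 + P 3 := by
    have h1 := B 20 21 1 2 (by decide)
    simp only [hA₁₄, mul_sub, sub_mul, hid, o 20 21 (by decide), o 21 20 (by decide)]
    linear_combination (norm := abel) h1 - bz
  have z2A₁₄ : P 1 * A₁₄ = 0 := by
    rw [hA₁₄, mul_sub, o 1 20 (by decide), o 1 21 (by decide), sub_zero]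
  have A₁₄z2 : A₁₄ * P 1 = 0 := by
    rw [hA₁₄, sub_mul, o 20 1 (by decide), o 21 1 (by decide), sub_zero]
  have z3A₁₄ : P 2 * A₁₄ = 0 := by
    rw [hA₁₄, mul_sub, o 2 20 (by decide), o 2 21 (by decide), sub_zero]
  have A₁₄z3 : A₁₄ * P 2 = 0 := by
    rw [hA₁₄, sub_mul, o 20 2 (by decide), o 21 2 (by decide), sub_zero]
  have qA₂₃ : A₂₃ * A₂₃ = P 1 + P 2 := by
    have h1 := B 22 23 0 3 (by decide)
    simp only [hA₂₃, mul_sub, sub_mul, hid, o 22 23 (by decide), o 23 22 (by decide)]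
    linear_combination (norm := abel) h1 - bz
  have z1A₂₃ : P 0 * A₂₃ = 0 := by
    rw [hA₂₃, mul_sub, o 0 22 (by decide), o 0 23 (by decide), sub_zero]
  have A₂₃z1 : A₂₃ * P 0 = 0 := by
    rw [hA₂₃, sub_mul, o 22 0 (by decide), o 23 0 (by decide), sub_zero]
  have z4A₂₃ : P 3 * A₂₃ = 0 := by
    rw [hA₂₃, mul_sub, o 3 22 (by decide), o 3 23 (by decide), sub_zero]
  have A₂₃z4 : A₂₃ * P 3 = 0 := by
    rw [hA₂₃, sub_mul, o 22 3 (by decide), o 23 3 (by decide), sub_zero]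
  -- the diagonal parts of the swaps vanish
  have d12 : P 0 * A₁₂ * P 0 = 0 :=
    compress_swap_eq_zero (r' := A₂₄) (s := A₁₄) z1A₃₄ z1A₂₃
      (by linear_combination (norm := noncomm_ring) m01)
      (by linear_combination (norm := noncomm_ring) n01)
      qA₁₃ A₁₂z3
  have d13 : P 0 * A₁₃ * P 0 = 0 :=
    compress_swap_eq_zero (r' := A₃₄) (s := A₁₄) z1A₂₄ z1A₂₃
      (by linear_combination (norm := noncomm_ring) m10)
      (by linear_combination (norm := noncomm_ring) n10)
      qA₁₂ A₁₃z2
  have d14 : P 0 * A₁₄ * P 0 = 0 :=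
    compress_swap_eq_zero (r' := A₃₄) (s := A₁₃) z1A₂₃ z1A₂₄
      (by linear_combination (norm := noncomm_ring) m20)
      (by linear_combination (norm := noncomm_ring) -n20)
      qA₁₂ A₁₄z2
  have d21 : P 1 * A₁₂ * P 1 = 0 :=
    compress_swap_eq_zero (r' := A₁₄) (s := A₂₄) z2A₃₄ z2A₁₃
      (by linear_combination (norm := noncomm_ring) m02)
      (by linear_combination (norm := noncomm_ring) n02)
      qA₂₃ A₁₂z3
  have d23 : P 1 * A₂₃ * P 1 = 0 :=
    compress_swap_eq_zero (r' := A₃₄) (s := A₂₄) z2A₁₄ z2A₁₃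
      (by linear_combination (norm := noncomm_ring) m20)
      (by linear_combination (norm := noncomm_ring) n20)
      (qA₁₂.trans (add_comm _ _)) A₂₃z1
  have d24 : P 1 * A₂₄ * P 1 = 0 :=
    compress_swap_eq_zero (r' := A₃₄) (s := A₂₃) z2A₁₃ z2A₁₄
      (by linear_combination (norm := noncomm_ring) m10)
      (by linear_combination (norm := noncomm_ring) -n10)
      (qA₁₂.trans (add_comm _ _)) A₂₄z1
  have d31 : P 2 * A₁₃ * P 2 = 0 :=
    compress_swap_eq_zero (r' := A₁₄) (s := A₃₄) z3A₂₄ z3A₁₂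
      (by linear_combination (norm := noncomm_ring) m12)
      (by linear_combination (norm := noncomm_ring) n12)
      (qA₂₃.trans (add_comm _ _)) A₁₃z2
  have d32 : P 2 * A₂₃ * P 2 = 0 :=
    compress_swap_eq_zero (r' := A₂₄) (s := A₃₄) z3A₁₄ z3A₁₂
      (by linear_combination (norm := noncomm_ring) m21)
      (by linear_combination (norm := noncomm_ring) n21)
      (qA₁₃.trans (add_comm _ _)) A₂₃z1
  have d34 : P 2 * A₃₄ * P 2 = 0 :=
    compress_swap_eq_zero (r' := A₂₄) (s := A₂₃) z3A₁₂ z3A₁₄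
      (by linear_combination (norm := noncomm_ring) m01)
      (by linear_combination (norm := noncomm_ring) -n01)
      (qA₁₃.trans (add_comm _ _)) A₃₄z1
  have d41 : P 3 * A₁₄ * P 3 = 0 :=
    compress_swap_eq_zero (r' := A₁₃) (s := A₃₄) z4A₂₃ z4A₁₂
      (by linear_combination (norm := noncomm_ring) m21)
      (by linear_combination (norm := noncomm_ring) n21)
      (qA₂₄.trans (add_comm _ _)) A₁₄z2
  have d42 : P 3 * A₂₄ * P 3 = 0 :=
    compress_swap_eq_zero (r' := A₂₃) (s := A₃₄) z4A₁₃ z4A₁₂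
      (by linear_combination (norm := noncomm_ring) m12)
      (by linear_combination (norm := noncomm_ring) n12)
      (qA₁₄.trans (add_comm _ _)) A₂₄z1
  have d43 : P 3 * A₃₄ * P 3 = 0 :=
    compress_swap_eq_zero (r' := A₂₃) (s := A₂₄) z4A₁₂ z4A₁₃
      (by linear_combination (norm := noncomm_ring) m02)
      (by linear_combination (norm := noncomm_ring) n02)
      (qA₁₄.trans (add_comm _ _)) A₃₄z1
  -- hence each swap is the sum of its two off-diagonal parts, and exchanges its two coordinates
  obtain ⟨w12, x12⟩ := swap_conj (a := A₁₂) (hid 1)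
    (o _ _ (by decide))
    (by linear_combination (norm := noncomm_ring) bz * A₁₂ - z3A₁₂ - z4A₁₂)
    (by linear_combination (norm := noncomm_ring) A₁₂ * bz - A₁₂z3 - A₁₂z4) qA₁₂ d12 d21
  obtain ⟨w34, x34⟩ := swap_conj (a := A₃₄) (hid 3)
    (o _ _ (by decide))
    (by linear_combination (norm := noncomm_ring) bz * A₃₄ - z1A₃₄ - z2A₃₄)
    (by linear_combination (norm := noncomm_ring) A₃₄ * bz - A₃₄z1 - A₃₄z2) qA₃₄ d34 d43
  obtain ⟨w13, x13⟩ := swap_conj (a := A₁₃) (hid 2)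
    (o _ _ (by decide))
    (by linear_combination (norm := noncomm_ring) bz * A₁₃ - z2A₁₃ - z4A₁₃)
    (by linear_combination (norm := noncomm_ring) A₁₃ * bz - A₁₃z2 - A₁₃z4) qA₁₃ d13 d31
  obtain ⟨w24, x24⟩ := swap_conj (a := A₂₄) (hid 3)
    (o _ _ (by decide))
    (by linear_combination (norm := noncomm_ring) bz * A₂₄ - z1A₂₄ - z3A₂₄)
    (by linear_combination (norm := noncomm_ring) A₂₄ * bz - A₂₄z1 - A₂₄z3) qA₂₄ d24 d42
  obtain ⟨w14, x14⟩ := swap_conj (a := A₁₄) (hid 3)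
    (o _ _ (by decide))
    (by linear_combination (norm := noncomm_ring) bz * A₁₄ - z2A₁₄ - z3A₁₄)
    (by linear_combination (norm := noncomm_ring) A₁₄ * bz - A₁₄z2 - A₁₄z3) qA₁₄ d14 d41
  obtain ⟨w23, x23⟩ := swap_conj (a := A₂₃) (hid 2)
    (o _ _ (by decide))
    (by linear_combination (norm := noncomm_ring) bz * A₂₃ - z1A₂₃ - z4A₂₃)
    (by linear_combination (norm := noncomm_ring) A₂₃ * bz - A₂₃z1 - A₂₃z4) qA₂₃ d23 d32
  -- the projection `P 4` on the ray `(1, 1, 1, 1)` is unbiased to the coordinates: its corners off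
  -- the diagonal are those of the swaps
  have hf : (4 : ℂ) • P 4 = 1 + (A₁₂ + A₃₄) + (A₁₃ + A₂₄) + (A₁₄ + A₂₃) := by
    rw [e1, e2, e3, ← bf]
    module
  have hf' : ∀ x y, (4 : ℂ) • (x * P 4 * y) = x * y + (x * A₁₂ * y + x * A₃₄ * y) +
      (x * A₁₃ * y + x * A₂₄ * y) + (x * A₁₄ * y + x * A₂₃ * y) := by
    intro x y
    rw [← smul_mul_assoc, ← mul_smul_comm, hf]
    noncomm_ring
  have E11 : (4 : ℂ) • (P 0 * P 4 * P 0) = P 0 := by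
    rw [hf']
    simp only [hid, z1A₃₄, z1A₂₄, z1A₂₃, d12, d13, d14, zero_mul, add_zero]
  have E12 : (4 : ℂ) • (P 0 * P 4 * P 1) = P 0 * A₁₂ * P 1 := by
    rw [hf']
    simp only [o 0 1 (by decide), z1A₃₄, z1A₂₄, z1A₂₃, zero_mul, add_zero, zero_add]
    simp only [mul_assoc, A₁₃z2, A₁₄z2, mul_zero, add_zero]
  have E13 : (4 : ℂ) • (P 0 * P 4 * P 2) = P 0 * A₁₃ * P 2 := by
    rw [hf']
    simp only [o 0 2 (by decide), z1A₃₄, z1A₂₄, z1A₂₃, zero_mul, add_zero, zero_add]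
    simp only [mul_assoc, A₁₂z3, A₁₄z3, mul_zero, add_zero, zero_add]
  have E14 : (4 : ℂ) • (P 0 * P 4 * P 3) = P 0 * A₁₄ * P 3 := by
    rw [hf']
    simp only [o 0 3 (by decide), z1A₃₄, z1A₂₄, z1A₂₃, zero_mul, add_zero, zero_add]
    simp only [mul_assoc, A₁₂z4, A₁₃z4, mul_zero, add_zero, zero_add]
  have E21 : (4 : ℂ) • (P 1 * P 4 * P 0) = P 1 * A₁₂ * P 0 := by
    rw [hf']
    simp only [o 1 0 (by decide), z2A₃₄, z2A₁₃, z2A₁₄, zero_mul, add_zero, zero_add]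
    simp only [mul_assoc, A₂₄z1, A₂₃z1, mul_zero, add_zero]
  have E22 : (4 : ℂ) • (P 1 * P 4 * P 1) = P 1 := by
    rw [hf']
    simp only [hid, z2A₃₄, z2A₁₃, z2A₁₄, d21, d23, d24, zero_mul, add_zero]
  have E23 : (4 : ℂ) • (P 1 * P 4 * P 2) = P 1 * A₂₃ * P 2 := by
    rw [hf']
    simp only [o 1 2 (by decide), z2A₃₄, z2A₁₃, z2A₁₄, zero_mul, add_zero, zero_add]
    simp only [mul_assoc, A₁₂z3, A₂₄z3, mul_zero, add_zero, zero_add]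
  have E24 : (4 : ℂ) • (P 1 * P 4 * P 3) = P 1 * A₂₄ * P 3 := by
    rw [hf']
    simp only [o 1 3 (by decide), z2A₃₄, z2A₁₃, z2A₁₄, zero_mul, add_zero, zero_add]
    simp only [mul_assoc, A₁₂z4, A₂₃z4, mul_zero, add_zero, zero_add]
  have E31 : (4 : ℂ) • (P 2 * P 4 * P 0) = P 2 * A₁₃ * P 0 := by
    rw [hf']
    simp only [o 2 0 (by decide), z3A₁₂, z3A₂₄, z3A₁₄, zero_mul, add_zero, zero_add]
    simp only [mul_assoc, A₃₄z1, A₂₃z1, mul_zero, add_zero, zero_add]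
  have E32 : (4 : ℂ) • (P 2 * P 4 * P 1) = P 2 * A₂₃ * P 1 := by
    rw [hf']
    simp only [o 2 1 (by decide), z3A₁₂, z3A₂₄, z3A₁₄, zero_mul, add_zero, zero_add]
    simp only [mul_assoc, A₃₄z2, A₁₃z2, mul_zero, add_zero, zero_add]
  have E33 : (4 : ℂ) • (P 2 * P 4 * P 2) = P 2 := by
    rw [hf']
    simp only [hid, z3A₁₂, z3A₂₄, z3A₁₄, d31, d32, d34, zero_mul, add_zero]
  have E34 : (4 : ℂ) • (P 2 * P 4 * P 3) = P 2 * A₃₄ * P 3 := by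
    rw [hf']
    simp only [o 2 3 (by decide), z3A₁₂, z3A₂₄, z3A₁₄, zero_mul, add_zero, zero_add]
    simp only [mul_assoc, A₁₃z4, A₂₃z4, mul_zero, add_zero]
  have E41 : (4 : ℂ) • (P 3 * P 4 * P 0) = P 3 * A₁₄ * P 0 := by
    rw [hf']
    simp only [o 3 0 (by decide), z4A₁₂, z4A₁₃, z4A₂₃, zero_mul, add_zero, zero_add]
    simp only [mul_assoc, A₃₄z1, A₂₄z1, mul_zero, add_zero, zero_add]
  have E42 : (4 : ℂ) • (P 3 * P 4 * P 1) = P 3 * A₂₄ * P 1 := by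
    rw [hf']
    simp only [o 3 1 (by decide), z4A₁₂, z4A₁₃, z4A₂₃, zero_mul, add_zero, zero_add]
    simp only [mul_assoc, A₃₄z2, A₁₄z2, mul_zero, add_zero, zero_add]
  have E43 : (4 : ℂ) • (P 3 * P 4 * P 2) = P 3 * A₃₄ * P 2 := by
    rw [hf']
    simp only [o 3 2 (by decide), z4A₁₂, z4A₁₃, z4A₂₃, zero_mul, add_zero, zero_add]
    simp only [mul_assoc, A₂₄z3, A₁₄z3, mul_zero, add_zero]
  have E44 : (4 : ℂ) • (P 3 * P 4 * P 3) = P 3 := by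
    rw [hf']
    simp only [hid, z4A₁₂, z4A₁₃, z4A₂₃, d41, d42, d43, zero_mul, add_zero]
  -- `P 4` is orthogonal to the rays `(1, -1, 0, 0)` and the like, so that
  -- `P 4 * A₁₂ = P 4 * (P 0 + P 1)`; it follows that it compresses the four coordinates equally
  have y2 : P 4 * P 1 * P 4 = P 4 * P 0 * P 4 := by
    have h1 : P 12 = P 0 + P 1 - P 13 := by
      linear_combination (norm := abel) B 12 13 2 3 (by decide) - bz
    have h2 : P 4 * A₁₂ = P 4 * P 0 + P 4 * P 1 := by
      rw [hA₁₂, h1, mul_sub, mul_sub, mul_add, o 4 13 (by decide), sub_zero, sub_zero]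
    have h3 : A₁₂ * P 4 = P 0 * P 4 + P 1 * P 4 := by
      rw [hA₁₂, h1, sub_mul, sub_mul, add_mul, o 13 4 (by decide), sub_zero, sub_zero]
    calc P 4 * P 1 * P 4 = P 4 * A₁₂ * P 0 * (A₁₂ * P 4) := by rw [← x12]; simp only [mul_assoc]
      _ = _ := by
        rw [h2, h3]
        simp only [add_mul, mul_add, mul_assoc, ← mul_assoc (P 0), hid, o 0 1 (by decide),
          o 1 0 (by decide), zero_mul, mul_zero, add_zero]
  have y3 : P 4 * P 2 * P 4 = P 4 * P 0 * P 4 := by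
    have h1 : P 16 = P 0 + P 2 - P 17 := by
      linear_combination (norm := abel) B 16 17 1 3 (by decide) - bz
    have h2 : P 4 * A₁₃ = P 4 * P 0 + P 4 * P 2 := by
      rw [hA₁₃, h1, mul_sub, mul_sub, mul_add, o 4 17 (by decide), sub_zero, sub_zero]
    have h3 : A₁₃ * P 4 = P 0 * P 4 + P 2 * P 4 := by
      rw [hA₁₃, h1, sub_mul, sub_mul, add_mul, o 17 4 (by decide), sub_zero, sub_zero]
    calc P 4 * P 2 * P 4 = P 4 * A₁₃ * P 0 * (A₁₃ * P 4) := by rw [← x13]; simp only [mul_assoc]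
      _ = _ := by
        rw [h2, h3]
        simp only [add_mul, mul_add, mul_assoc, ← mul_assoc (P 0), hid, o 0 2 (by decide),
          o 2 0 (by decide), zero_mul, mul_zero, add_zero]
  have y4 : P 4 * P 3 * P 4 = P 4 * P 0 * P 4 := by
    have h1 : P 20 = P 0 + P 3 - P 21 := by
      linear_combination (norm := abel) B 20 21 1 2 (by decide) - bz
    have h2 : P 4 * A₁₄ = P 4 * P 0 + P 4 * P 3 := by
      rw [hA₁₄, h1, mul_sub, mul_sub, mul_add, o 4 21 (by decide), sub_zero, sub_zero]
    have h3 : A₁₄ * P 4 = P 0 * P 4 + P 3 * P 4 := by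
      rw [hA₁₄, h1, sub_mul, sub_mul, add_mul, o 21 4 (by decide), sub_zero, sub_zero]
    calc P 4 * P 3 * P 4 = P 4 * A₁₄ * P 0 * (A₁₄ * P 4) := by rw [← x14]; simp only [mul_assoc]
      _ = _ := by
        rw [h2, h3]
        simp only [add_mul, mul_add, mul_assoc, ← mul_assoc (P 0), hid, o 0 3 (by decide),
          o 3 0 (by decide), zero_mul, mul_zero, add_zero]
  have y : (4 : ℂ) • (P 4 * P 0 * P 4) = P 4 := by
    have h1 : P 4 * P 0 * P 4 + P 4 * P 1 * P 4 + P 4 * P 2 * P 4 + P 4 * P 3 * P 4 = P 4 := by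
      rw [← add_mul, ← add_mul, ← add_mul, ← mul_add, ← mul_add, ← mul_add, bz, mul_one, hid]
    rw [y2, y3, y4] at h1
    nth_rewrite 3 [← h1]
    module
  let z : Fin 4 → A := fun i => P (i.castLE (by decide))
  let u := GradedMatrixUnits.ofUnbiased z (P 4) 1 (by
      intro i j
      split_ifs with h
      · rw [← h]; exact hid _
      · exact o _ _ (by revert i j; decide))
    (by rw [Fin.sum_univ_four]; exact bz) (fun i => hsa _) (hsa 4)
    (by
      intro i
      fin_cases i
      · exact E11
      · exact E22
      · exact E33
      · exact E44)
    (by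
      intro i
      fin_cases i
      · exact y
      · exact (congrArg _ y2).trans y
      · exact (congrArg _ y3).trans y
      · exact (congrArg _ y4).trans y)
    (star_one _) (one_mul 1) (fun i => (Commute.one_left _).eq) ((Commute.one_left _).eq)
  -- the projections in terms of the matrix units: all rays are combinations of coordinates and swaps
  have U1 : u.e 0 0 = P 0 := E11
  have U2 : u.e 1 1 = P 1 := E22
  have U3 : u.e 2 2 = P 2 := E33
  have U4 : u.e 3 3 = P 3 := E44
  have U12 : A₁₂ = u.e 0 1 + u.e 1 0 :=
    w12.trans (congrArg₂ _ E12.symm E21.symm)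
  have U34 : A₃₄ = u.e 2 3 + u.e 3 2 :=
    w34.trans (congrArg₂ _ E34.symm E43.symm)
  have U13 : A₁₃ = u.e 0 2 + u.e 2 0 :=
    w13.trans (congrArg₂ _ E13.symm E31.symm)
  have U24 : A₂₄ = u.e 1 3 + u.e 3 1 :=
    w24.trans (congrArg₂ _ E24.symm E42.symm)
  have U14 : A₁₄ = u.e 0 3 + u.e 3 0 :=
    w14.trans (congrArg₂ _ E14.symm E41.symm)
  have U23 : A₂₃ = u.e 1 2 + u.e 2 1 :=
    w23.trans (congrArg₂ _ E23.symm E32.symm)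
  have V1 := u.sum_e
  rw [Fin.sum_univ_four] at V1
  have s12 := B 12 13 2 3 (by decide)
  have s34 := B 14 15 0 1 (by decide)
  have s13 := B 16 17 1 3 (by decide)
  have s24 := B 18 19 0 2 (by decide)
  have s14 := B 20 21 1 2 (by decide)
  have s23 := B 22 23 0 3 (by decide)
  refine ⟨u, rfl, fun k => ?_⟩
  fin_cases k
  · simp [Fin.sum_univ_four, peresInt]
    linear_combination (norm := module) -U1
  · simp [Fin.sum_univ_four, peresInt]
    linear_combination (norm := module) -U2
  · simp [Fin.sum_univ_four, peresInt]
    linear_combination (norm := module) -U3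
  · simp [Fin.sum_univ_four, peresInt]
    linear_combination (norm := module) -U4
  · simp [Fin.sum_univ_four, peresInt]
    linear_combination (norm := module) (1 / 4 : ℂ) • (bf - V1 - e1 + (U12 + U34) - e2 + (U13 + U24) - e3 + (U14 + U23))
  · simp [Fin.sum_univ_four, peresInt]
    linear_combination (norm := module) (1 / 4 : ℂ) • (bf - V1 - e1 + (U12 + U34) + e2 - (U13 + U24) + e3 - (U14 + U23))
  · simp [Fin.sum_univ_four, peresInt]
    linear_combination (norm := module) (1 / 4 : ℂ) • (bf - V1 + e1 - (U12 + U34) - e2 + (U13 + U24) + e3 - (U14 + U23))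
  · simp [Fin.sum_univ_four, peresInt]
    linear_combination (norm := module) (1 / 4 : ℂ) • (bf - V1 + e1 - (U12 + U34) + e2 - (U13 + U24) - e3 + (U14 + U23))
  · simp [Fin.sum_univ_four, peresInt]
    linear_combination (norm := module) (1 / 4 : ℂ) • (bg - V1 - e4 + (U12 - U34) - e5 + (U13 - U24) - e6 + (U23 - U14))
  · simp [Fin.sum_univ_four, peresInt]
    linear_combination (norm := module) (1 / 4 : ℂ) • (bg - V1 - e4 + (U12 - U34) + e5 - (U13 - U24) + e6 - (U23 - U14))
  · simp [Fin.sum_univ_four, peresInt]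
    linear_combination (norm := module) (1 / 4 : ℂ) • (bg - V1 + e4 - (U12 - U34) - e5 + (U13 - U24) + e6 - (U23 - U14))
  · simp [Fin.sum_univ_four, peresInt]
    linear_combination (norm := module) (1 / 4 : ℂ) • (bg - V1 + e4 - (U12 - U34) + e5 - (U13 - U24) - e6 + (U23 - U14))
  · simp [Fin.sum_univ_four, peresInt]
    linear_combination (norm := module) (1 / 2 : ℂ) • (s12 - bz + U12 - hA₁₂ - U1 - U2)
  · simp [Fin.sum_univ_four, peresInt]
    linear_combination (norm := module) (1 / 2 : ℂ) • (s12 - bz - U12 + hA₁₂ - U1 - U2)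
  · simp [Fin.sum_univ_four, peresInt]
    linear_combination (norm := module) (1 / 2 : ℂ) • (s34 - bz + U34 - hA₃₄ - U3 - U4)
  · simp [Fin.sum_univ_four, peresInt]
    linear_combination (norm := module) (1 / 2 : ℂ) • (s34 - bz - U34 + hA₃₄ - U3 - U4)
  · simp [Fin.sum_univ_four, peresInt]
    linear_combination (norm := module) (1 / 2 : ℂ) • (s13 - bz + U13 - hA₁₃ - U1 - U3)
  · simp [Fin.sum_univ_four, peresInt]
    linear_combination (norm := module) (1 / 2 : ℂ) • (s13 - bz - U13 + hA₁₃ - U1 - U3)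
  · simp [Fin.sum_univ_four, peresInt]
    linear_combination (norm := module) (1 / 2 : ℂ) • (s24 - bz + U24 - hA₂₄ - U2 - U4)
  · simp [Fin.sum_univ_four, peresInt]
    linear_combination (norm := module) (1 / 2 : ℂ) • (s24 - bz - U24 + hA₂₄ - U2 - U4)
  · simp [Fin.sum_univ_four, peresInt]
    linear_combination (norm := module) (1 / 2 : ℂ) • (s14 - bz + U14 - hA₁₄ - U1 - U4)
  · simp [Fin.sum_univ_four, peresInt]
    linear_combination (norm := module) (1 / 2 : ℂ) • (s14 - bz - U14 + hA₁₄ - U1 - U4)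
  · simp [Fin.sum_univ_four, peresInt]
    linear_combination (norm := module) (1 / 2 : ℂ) • (s23 - bz + U23 - hA₂₃ - U2 - U3)
  · simp [Fin.sum_univ_four, peresInt]
    linear_combination (norm := module) (1 / 2 : ℂ) • (s23 - bz - U23 + hA₂₃ - U2 - U3)

end CFR


namespace CFR

/-! ### From the rays of CEG-18 to the rays of Peres -/

/-- The orthogonal bases formed by the rays of CEG-18. Each ray lies in two of them. The bases are
arranged as the vertices `3 r + c` of a rook's graph `K₃ □ K₃`, whose edges are the rays. -/
def cegBasis : Fin 9 → Fin 4 → Fin 18 :=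
  ![![1, 0, 3, 2], ![17, 0, 16, 15], ![17, 1, 8, 10], ![11, 13, 4, 2], ![12, 13, 14, 15],
    ![12, 11, 9, 10], ![6, 5, 4, 3], ![7, 5, 14, 16], ![7, 6, 9, 8]]

/-- The rays of CEG-18 are, up to a rotation, eighteen of the rays of Peres. -/
def cegPeres : Fin 18 → Fin 24 := ![0, 1, 14, 15, 13, 4, 5, 6, 20, 22, 21, 9, 10, 8, 17, 18, 19, 2]

/-- The ray of CEG-18 that corresponds to the edge of row `r` of the rook's graph not containing
column `c`. -/
def cegRow : Fin 3 → Fin 3 → Fin 18 := ![![17, 1, 0], ![12, 11, 13], ![7, 6, 5]]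

/-- The ray of CEG-18 that corresponds to the edge of column `c` of the rook's graph not containing
row `r`. -/
def cegCol : Fin 3 → Fin 3 → Fin 18 := ![![4, 14, 9], ![3, 16, 8], ![2, 15, 10]]

/-- The rays of Peres in terms of the rook's graph: the edges of the rows (`0`) and of the columns
(`1`), and six further rays, one for each row (`2`) and for each column (`3`). -/
def peresRook : Fin 24 → Fin 4 × Fin 3 × Fin 3 :=
  ![(0, 0, 2), (0, 0, 1), (0, 0, 0), (2, 0, 0), (0, 2, 2), (0, 2, 1),
    (0, 2, 0), (2, 2, 0), (0, 1, 2), (0, 1, 1), (0, 1, 0), (2, 1, 0),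
    (3, 0, 0), (1, 0, 0), (1, 2, 0), (1, 1, 0), (3, 0, 1), (1, 0, 1),
    (1, 2, 1), (1, 1, 1), (1, 1, 2), (1, 2, 2), (1, 0, 2), (3, 0, 2)]

/-- Orthogonality of the rays of Peres in terms of the rook's graph, up to symmetry. -/
def RookOrth : Fin 4 × Fin 3 × Fin 3 → Fin 4 × Fin 3 × Fin 3 → Prop
  | (0, r, c), (0, r', c') => r = r' ∧ c ≠ c'
  | (1, r, c), (1, r', c') => r ≠ r' ∧ c = c'
  | (0, r, c), (1, r', c') => r ≠ r' ∧ c ≠ c' ∨ r = r' ∧ c = c'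
  | (0, r, _), (2, r', _) => r = r'
  | (0, _, c), (3, _, c') => c = c'
  | (1, r, _), (2, r', _) => r = r'
  | (1, _, c), (3, _, c') => c = c'
  | (2, _, _), (3, _, _) => True
  | _, _ => False

instance : DecidableRel RookOrth
  | (0, r, c), (0, r', c') => inferInstanceAs (Decidable (r = r' ∧ c ≠ c'))
  | (1, r, c), (1, r', c') => inferInstanceAs (Decidable (r ≠ r' ∧ c = c'))
  | (0, r, c), (1, r', c') => inferInstanceAs (Decidable (r ≠ r' ∧ c ≠ c' ∨ r = r' ∧ c = c'))
  | (0, r, _), (2, r', _) => inferInstanceAs (Decidable (r = r'))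
  | (0, _, c), (3, _, c') => inferInstanceAs (Decidable (c = c'))
  | (1, r, _), (2, r', _) => inferInstanceAs (Decidable (r = r'))
  | (1, _, c), (3, _, c') => inferInstanceAs (Decidable (c = c'))
  | (2, _, _), (3, _, _) => inferInstanceAs (Decidable True)
  | (1, _, _), (0, _, _) => inferInstanceAs (Decidable False)
  | (2, _, _), (0, _, _) => inferInstanceAs (Decidable False)
  | (2, _, _), (1, _, _) => inferInstanceAs (Decidable False)
  | (2, _, _), (2, _, _) => inferInstanceAs (Decidable False)
  | (3, _, _), (0, _, _) => inferInstanceAs (Decidable False)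
  | (3, _, _), (1, _, _) => inferInstanceAs (Decidable False)
  | (3, _, _), (2, _, _) => inferInstanceAs (Decidable False)
  | (3, _, _), (3, _, _) => inferInstanceAs (Decidable False)

section Rook

variable {A : Type*} [Ring A]

/-- The projections that correspond to `RookOrth`: the six new ones complete the rows and the
columns. -/
def rookRay (h v : Fin 3 → Fin 3 → A) : Fin 4 × Fin 3 × Fin 3 → A
  | (0, r, c) => h r c
  | (1, r, c) => v r c
  | (2, r, _) => 1 - ∑ c, h r c
  | (3, _, c) => 1 - ∑ r, v r c

lemma isIdempotentElem_sum_of_orthogonal {ι : Type*} [Fintype ι] [DecidableEq ι] (f : ι → A)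
    (hid : ∀ i, f i * f i = f i) (ho : ∀ i j, i ≠ j → f i * f j = 0) :
    (∑ i, f i) * (∑ i, f i) = ∑ i, f i := by
  rw [Finset.sum_mul_sum]
  refine Finset.sum_congr rfl fun i _ => ?_
  rw [Finset.sum_eq_single i (fun j _ h => ho i j h.symm) (by simp), hid]

/-- Two idempotents whose sum is idempotent are orthogonal. -/
lemma mul_eq_zero_of_add_idem [Algebra ℂ A] {a b : A} (ha : a * a = a) (hb : b * b = b)
    (h : (a + b) * (a + b) = a + b) : a * b = 0 := by
  have h1 : a * b + b * a = 0 := by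
    have : (a + b) * (a + b) = a + b + (a * b + b * a) := by
      rw [add_mul, mul_add, mul_add, ha, hb]; abel
    rw [this] at h
    simpa using h
  have h2 : a * b + a * b * a = 0 := by
    have := congrArg (a * ·) h1
    simpa only [mul_add, ← mul_assoc, ha, mul_zero] using this
  have h3 : a * b * a + b * a = 0 := by
    have := congrArg (· * a) h1
    simpa only [add_mul, mul_assoc, ha, zero_mul] using this
  have h4 : a * b = b * a := by
    rw [eq_neg_of_add_eq_zero_left h2, eq_neg_of_add_eq_zero_right h3]
  rw [← h4, ← two_smul ℂ] at h1
  exact (smul_eq_zero_iff_right two_ne_zero).1 h1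

variable [Algebra ℂ A] {h v : Fin 3 → Fin 3 → A}

/-- The orthogonality relations of the six new rays. Those between two of them hold because the two
new rays of a vertex `(r, c)` have a sum that is complementary to the sum of two orthogonal rays. -/
lemma rookRay_mul_eq_zero (hh : ∀ r c, h r c * h r c = h r c) (hv : ∀ r c, v r c * v r c = v r c)
    (oh : ∀ r c c', c ≠ c' → h r c * h r c' = 0) (ov : ∀ r r' c, r ≠ r' → v r c * v r' c = 0)
    (ohv : ∀ r r' c c', r ≠ r' ∧ c ≠ c' ∨ r = r' ∧ c = c' → h r c * v r' c' = 0)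
    (ovh : ∀ r r' c c', r ≠ r' ∧ c ≠ c' ∨ r = r' ∧ c = c' → v r' c' * h r c = 0)
    (hb : ∀ r c, ∑ c', (if c' = c then 0 else h r c') + ∑ r', (if r' = r then 0 else v r' c) = 1)
    {x y : Fin 4 × Fin 3 × Fin 3} (hxy : RookOrth x y) :
    rookRay h v x * rookRay h v y = 0 := by
  have ih : ∀ r, (1 - ∑ c, h r c) * (1 - ∑ c, h r c) = 1 - ∑ c, h r c := fun r =>
    (IsIdempotentElem.one_sub (isIdempotentElem_sum_of_orthogonal _ (hh r) (oh r))).eq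
  have iv : ∀ c, (1 - ∑ r, v r c) * (1 - ∑ r, v r c) = 1 - ∑ r, v r c := fun c =>
    (IsIdempotentElem.one_sub (isIdempotentElem_sum_of_orthogonal _ (fun r => hv r c)
      (fun r r' => ov r r' c))).eq
  -- the two new rays of the vertex `(r, c)` sum to `1` together with `h r c` and `v r c`
  have key : ∀ r c, (1 - ∑ c, h r c) + (1 - ∑ r, v r c) = 1 - (h r c + v r c) := by
    intro r c
    have h1 : ∀ f : Fin 3 → A, ∀ i, ∑ j, f j = f i + ∑ j, if j = i then 0 else f j := by
      intro f i
      rw [← Finset.add_sum_erase _ _ (Finset.mem_univ i), ← Finset.add_sum_erase _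
        (fun j => if j = i then 0 else f j) (Finset.mem_univ i), if_pos rfl, zero_add]
      congr 1
      exact Finset.sum_congr rfl fun j hj => (if_neg (Finset.ne_of_mem_erase hj)).symm
    rw [h1 (h r) c, h1 (fun r => v r c) r]
    linear_combination (norm := abel) -hb r c
  -- the ray that completes a row or a column is orthogonal to its members
  have ah : ∀ r c, h r c * (1 - ∑ c, h r c) = 0 := by
    intro r c
    rw [mul_sub, mul_one, Finset.mul_sum,
      Finset.sum_eq_single c (fun j _ hj => oh r c j hj.symm) (by simp), hh, sub_self]
  have bv : ∀ r c, v r c * (1 - ∑ r, v r c) = 0 := by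
    intro r c
    rw [mul_sub, mul_one, Finset.mul_sum,
      Finset.sum_eq_single r (fun j _ hj => ov r j c hj.symm) (by simp), hv, sub_self]
  match x, y, hxy with
  | (0, r, c), (0, r', c'), hxy =>
    obtain ⟨rfl, h2⟩ := hxy
    exact oh _ _ _ h2
  | (1, r, c), (1, r', c'), hxy =>
    obtain ⟨h2, rfl⟩ := hxy
    exact ov _ _ _ h2
  | (0, r, c), (1, r', c'), hxy => exact ohv _ _ _ _ hxy
  | (0, r, c), (2, r', _), hxy =>
    obtain rfl : r = r' := hxy
    exact ah _ _
  | (0, r, c), (3, _, c'), hxy =>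
    obtain rfl : c = c' := hxy
    have := congrArg (h r c * ·) (key r c)
    simp only [mul_add, mul_sub (h r c) 1 (h r c + v r c), ah, hh, ohv r r c c (by simp),
      mul_one, zero_add, add_zero, sub_self] at this
    exact this
  | (1, r, c), (2, r', _), hxy =>
    obtain rfl : r = r' := hxy
    have := congrArg (v r c * ·) (key r c)
    simp only [mul_add, mul_sub (v r c) 1 (h r c + v r c), bv, hv, ovh r r c c (by simp),
      mul_one, zero_add, add_zero, sub_self] at this
    exact this
  | (1, r, c), (3, _, c'), hxy =>
    obtain rfl : c = c' := hxy
    exact bv _ _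
  | (2, r, _), (3, _, c), _ =>
    refine mul_eq_zero_of_add_idem (ih r) (iv c) ?_
    change ((1 - ∑ c, h r c) + (1 - ∑ r, v r c)) * ((1 - ∑ c, h r c) + (1 - ∑ r, v r c)) =
      (1 - ∑ c, h r c) + (1 - ∑ r, v r c)
    rw [key]
    refine (IsIdempotentElem.one_sub ?_).eq
    change _ * _ = _
    rw [add_mul, mul_add, mul_add, hh, hv, ohv r r c c (by simp), ovh r r c c (by simp), add_zero,
      zero_add]

end Rook

variable {A : Type*} [Ring A] [StarRing A] [Algebra ℂ A] [StarModule ℂ A]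

set_option maxHeartbeats 1000000 in
/-- Eighteen projections with the orthogonality relations and the bases of the rays of CEG-18 are
rays of Peres, in suitable matrix units: the six missing rays can be recovered. -/
theorem exists_ceg_units (P : Fin 18 → A) (hsa : ∀ i, star (P i) = P i)
    (hid : ∀ i, P i * P i = P i) (o : ∀ i j, PeresOrth (cegPeres i) (cegPeres j) → P i * P j = 0)
    (hbasis : ∀ n, ∑ a, P (cegBasis n a) = 1) :
    ∃ u : GradedMatrixUnits 4 A, u.c = 1 ∧ ∀ k, P k = ∑ a, ∑ b,
      ((peresInt (cegPeres k) a * peresInt (cegPeres k) b : ℤ) /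
        (∑ a, peresInt (cegPeres k) a * peresInt (cegPeres k) a : ℤ) : ℂ) • u.e a b := by
  let h : Fin 3 → Fin 3 → A := fun r c => P (cegRow r c)
  let v : Fin 3 → Fin 3 → A := fun r c => P (cegCol r c)
  -- the four edges at each vertex of the rook's graph form a basis
  have hb : ∀ r c, ∑ c', (if c' = c then 0 else h r c') + ∑ r', (if r' = r then 0 else v r' c)
      = 1 := by
    intro r c
    have := hbasis (finProdFinEquiv (r, c))
    rw [Fin.sum_univ_four] at this
    rw [← this, Fin.sum_univ_three, Fin.sum_univ_three]
    fin_cases r <;> fin_cases c <;>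
      simp [h, v, cegRow, cegCol, cegBasis, finProdFinEquiv] <;> abel
  have o' : ∀ x y, RookOrth x y → rookRay h v x * rookRay h v y = 0 := fun x y =>
    rookRay_mul_eq_zero (fun r c => hid _) (fun r c => hid _)
      (fun r c c' hc => o _ _ (by revert r c c'; decide))
      (fun r r' c hr => o _ _ (by revert r r' c; decide))
      (fun r r' c c' hc => o _ _ (by revert r r' c c'; decide))
      (fun r r' c c' hc => o _ _ (by revert r r' c c'; decide)) hb
  have hsa' : ∀ x, star (rookRay h v x) = rookRay h v x := by
    rintro ⟨i, r, c⟩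
    fin_cases i <;> simp [rookRay, h, v, hsa]
  have hid' : ∀ x, rookRay h v x * rookRay h v x = rookRay h v x := by
    rintro ⟨i, r, c⟩
    fin_cases i
    · exact hid _
    · exact hid _
    · exact (IsIdempotentElem.one_sub (isIdempotentElem_sum_of_orthogonal _ (fun c => hid _)
        fun c c' hc => o' (0, r, c) (0, r, c') ⟨rfl, hc⟩)).eq
    · exact (IsIdempotentElem.one_sub (isIdempotentElem_sum_of_orthogonal _ (fun r => hid _)
        fun r r' hr => o' (1, r, c) (1, r', c) ⟨hr, rfl⟩)).eq
  obtain ⟨u, hu, hP⟩ := exists_peres_units (fun i => rookRay h v (peresRook i))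
    (fun i => hsa' _) (fun i => hid' _)
    (by
      intro i j hij
      have : RookOrth (peresRook i) (peresRook j) ∨ RookOrth (peresRook j) (peresRook i) := by
        revert i j; decide
      rcases this with h1 | h1
      · exact o' _ _ h1
      · rw [← hsa' (peresRook i), ← hsa' (peresRook j), ← star_mul, o' _ _ h1, star_zero])
    (by
      -- each basis sums to `1` by definition of the new rays or by the basis of a single vertex
      have hb' := hb
      simp only [Fin.sum_univ_three] at hb'
      intro n
      fin_cases n <;>
        simp [Fin.sum_univ_four, peresBasis, peresRook, rookRay, Fin.sum_univ_three]
      · abel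
      · abel
      · abel
      · linear_combination (norm := (simp; abel)) -hb' 0 0
      · abel
      · linear_combination (norm := (simp; abel)) -hb' 2 0
      · linear_combination (norm := (simp; abel)) -hb' 1 0
      · linear_combination (norm := (simp; abel)) hb' 1 0
      · linear_combination (norm := (simp; abel)) hb' 2 0
      · linear_combination (norm := (simp; abel)) hb' 0 0
      · linear_combination (norm := (simp; abel)) -hb' 0 1
      · abel
      · linear_combination (norm := (simp; abel)) -hb' 2 1
      · linear_combination (norm := (simp; abel)) -hb' 1 1
      · linear_combination (norm := (simp; abel)) hb' 1 1
      · linear_combination (norm := (simp; abel)) hb' 2 1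
      · linear_combination (norm := (simp; abel)) hb' 0 1
      · linear_combination (norm := (simp; abel)) hb' 0 2
      · abel
      · linear_combination (norm := (simp; abel)) hb' 2 2
      · linear_combination (norm := (simp; abel)) -hb' 1 2
      · linear_combination (norm := (simp; abel)) hb' 1 2
      · linear_combination (norm := (simp; abel)) -hb' 2 2
      · linear_combination (norm := (simp; abel)) -hb' 0 2)
  refine ⟨u, hu, fun k => ?_⟩
  rw [← hP]
  fin_cases k <;> rfl

end CFR


namespace CFR

/-! ### The rays of YO-13 -/

/-- Integer coordinates of the rays of YO-13. -/
def yoInt : Fin 13 → Fin 3 → ℤ :=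
  ![![1, 0, 0], ![0, 1, 0], ![0, 0, 1], ![0, 1, 1], ![0, 1, -1], ![1, 0, 1], ![1, 0, -1],
    ![1, 1, 0], ![1, -1, 0], ![1, 1, 1], ![1, 1, -1], ![-1, 1, 1], ![1, -1, 1]]

/-- Orthogonality of two rays of YO-13. -/
def YoOrth (i j : Fin 13) : Prop := i ≠ j ∧ ∑ a, yoInt i a * yoInt j a = 0

instance : DecidableRel YoOrth := fun _ _ => inferInstanceAs (Decidable (_ ∧ _))

/-- The orthogonal bases formed by the rays of YO-13. -/
def yoBasis : Fin 4 → Fin 3 → Fin 13 := ![![0, 1, 2], ![0, 3, 4], ![1, 5, 6], ![2, 7, 8]]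

/-- The rays of YO-13 that belong to none of these bases. -/
def yoApex : Fin 4 → Fin 13 := ![9, 10, 11, 12]

/-- The three neighbours of a ray of `yoApex` in the graph of orthogonality. -/
def yoNbr : Fin 4 → Fin 3 → Fin 13 := ![![4, 6, 8], ![3, 5, 8], ![4, 5, 7], ![3, 6, 7]]

section Swaps

variable {A : Type*} [Ring A]

/-- Anticommutation with a swap `b` exchanges `a` and `c`; since `b` annihilates the coordinate `z`, it
follows that `a` has no diagonal part there. -/
lemma anticommutator_diag_eq_zero {z a b c : A} (hz : z * b = 0)
    (hsq : b * b = 1 - z) (h1 : a * b + b * a = c) (h2 : c * b + b * c = a) : z * a * z = 0 := by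
  have h3 : z * a * b = z * c := by
    rw [← h1, mul_add, ← mul_assoc, ← mul_assoc, hz, zero_mul, add_zero]
  have h4 : z * c * b = z * a := by
    rw [← h2, mul_add, ← mul_assoc, ← mul_assoc, hz, zero_mul, add_zero]
  have h5 : z * a * (b * b) = z * a := by rw [← mul_assoc, h3, h4]
  rw [hsq, mul_sub, mul_one] at h5
  simpa using h5

end Swaps

variable {A : Type*} [Ring A] [StarRing A] [Algebra ℂ A] [StarModule ℂ A]

set_option maxHeartbeats 1000000 in
/-- Thirteen projections with the orthogonality relations and the bases of the rays of YO-13, of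
which the last four are the given linear combinations of the others, are the rays of YO-13, in
suitable matrix units. -/
theorem exists_yo_units (P : Fin 13 → A) (hsa : ∀ i, star (P i) = P i)
    (hid : ∀ i, P i * P i = P i) (o : ∀ i j, YoOrth i j → P i * P j = 0)
    (hbasis : ∀ n, ∑ a, P (yoBasis n a) = 1)
    (hapex : ∀ n, P (yoApex n) = 1 - (2 / 3 : ℂ) • ∑ a, P (yoNbr n a)) :
    ∃ u : GradedMatrixUnits 3 A, u.c = 1 ∧ ∀ k, P k = ∑ a, ∑ b,
      ((yoInt k a * yoInt k b : ℤ) / (∑ a, yoInt k a * yoInt k a : ℤ) : ℂ) • u.e a b := by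
  let z : Fin 3 → A := fun i => P (![0, 1, 2] i)
  let y : Fin 3 → A := fun i => P (![3, 5, 7] i)
  let y' : Fin 3 → A := fun i => P (![4, 6, 8] i)
  -- the swap of the two coordinates other than `i`
  obtain ⟨a, ha⟩ : ∃ a : Fin 3 → A, ∀ i, a i = y i - y' i := ⟨_, fun _ => rfl⟩
  have bz : z 0 + z 1 + z 2 = 1 := (Fin.sum_univ_three _).symm.trans (hbasis 0)
  have by' : ∀ i, z i + y i + y' i = 1 := by
    intro i
    fin_cases i
    · exact (Fin.sum_univ_three _).symm.trans (hbasis 1)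
    · exact (Fin.sum_univ_three _).symm.trans (hbasis 2)
    · exact (Fin.sum_univ_three _).symm.trans (hbasis 3)
  have hz : ∀ i, z i * z i = z i := fun i => hid _
  have hzz : ∀ i j, i ≠ j → z i * z j = 0 := fun i j h => o _ _ (by revert i j; decide)
  have za : ∀ i, z i * a i = 0 := by
    intro i
    rw [ha, mul_sub, o _ _ (by revert i; decide), o _ _ (by revert i; decide), sub_zero]
  have az : ∀ i, a i * z i = 0 := by
    intro i
    rw [ha, sub_mul, o _ _ (by revert i; decide), o _ _ (by revert i; decide), sub_zero]
  have sq : ∀ i, a i * a i = 1 - z i := by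
    intro i
    rw [ha, mul_sub, sub_mul, sub_mul, hid, hid, o _ _ (by revert i; decide),
      o _ _ (by revert i; decide), ← by' i]
    abel
  have hy : ∀ i, y i = (1 / 2 : ℂ) • (1 - z i + a i) := by
    intro i
    rw [ha, ← by' i]; module
  have hy' : ∀ i, y' i = (1 / 2 : ℂ) • (1 - z i - a i) := by
    intro i
    rw [ha, ← by' i]; module
  -- the rays of `yoApex` are, up to a factor, `1` plus a signed sum of the three swaps
  have p0 : (3 : ℂ) • P 9 = 1 + (a 0 + a 1 + a 2) := by
    have h1 : P 9 = 1 - (2 / 3 : ℂ) • (y' 0 + y' 1 + y' 2) := by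
      have h2 := hapex 0
      rw [Fin.sum_univ_three] at h2
      exact h2
    rw [h1, hy', hy', hy']
    linear_combination (norm := module) bz
  have p1 : (3 : ℂ) • P 10 = 1 + (-a 0 - a 1 + a 2) := by
    have h1 : P 10 = 1 - (2 / 3 : ℂ) • (y 0 + y 1 + y' 2) := by
      have h2 := hapex 1
      rw [Fin.sum_univ_three] at h2
      exact h2
    rw [h1, hy, hy, hy']
    linear_combination (norm := module) bz
  have p2 : (3 : ℂ) • P 11 = 1 + (a 0 - a 1 - a 2) := by
    have h1 : P 11 = 1 - (2 / 3 : ℂ) • (y' 0 + y 1 + y 2) := by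
      have h2 := hapex 2
      rw [Fin.sum_univ_three] at h2
      exact h2
    rw [h1, hy, hy, hy']
    linear_combination (norm := module) bz
  have p3 : (3 : ℂ) • P 12 = 1 + (-a 0 + a 1 - a 2) := by
    have h1 : P 12 = 1 - (2 / 3 : ℂ) • (y 0 + y' 1 + y 2) := by
      have h2 := hapex 3
      rw [Fin.sum_univ_three] at h2
      exact h2
    rw [h1, hy, hy, hy']
    linear_combination (norm := module) bz
  -- idempotency of such a ray is a quadratic equation for the signed sum
  have hS : ∀ (k : Fin 13) (s : A), (3 : ℂ) • P k = 1 + s → s * s = s + (1 + 1) := by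
    intro k s h
    have h1 : ((3 : ℂ) • P k) * ((3 : ℂ) • P k) = (3 : ℂ) • ((3 : ℂ) • P k) := by
      rw [smul_mul_smul_comm, hid, smul_smul]
    rw [h] at h1
    have h2 : (3 : ℂ) • (1 + s) = 1 + s + (1 + s) + (1 + s) := by module
    rw [h2] at h1
    linear_combination (norm := noncomm_ring) h1
  have s0 := hS _ _ p0
  have s1 := hS _ _ p1
  have s2 := hS _ _ p2
  have s3 := hS _ _ p3
  have two : ∀ x : A, x + x = 0 → x = 0 := by
    intro x h
    rw [← two_smul ℂ] at h
    exact (smul_eq_zero_iff_right two_ne_zero).1 h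
  have hsum : a 0 * a 0 + a 1 * a 1 + a 2 * a 2 = 1 + 1 := by
    rw [sq, sq, sq]
    linear_combination (norm := abel) -bz
  -- adding two of the four equations isolates one anticommutator
  have c2 : a 0 * a 1 + a 1 * a 0 = a 2 :=
    sub_eq_zero.1 (two _ (by linear_combination (norm := noncomm_ring) s0 + s1 - hsum - hsum))
  have c0 : a 1 * a 2 + a 2 * a 1 = a 0 :=
    sub_eq_zero.1 (two _ (by linear_combination (norm := noncomm_ring) s0 + s2 - hsum - hsum))
  have c1 : a 0 * a 2 + a 2 * a 0 = a 1 :=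
    sub_eq_zero.1 (two _ (by linear_combination (norm := noncomm_ring) s0 + s3 - hsum - hsum))
  -- the diagonal parts of the swaps vanish
  have d : ∀ i j, i ≠ j → z i * a j * z i = 0 := by
    intro i j h
    fin_cases i <;> fin_cases j <;> first | exact absurd rfl h | skip
    · exact anticommutator_diag_eq_zero (za 0) (sq 0) (c := a 2) ((add_comm _ _).trans c2)
        ((add_comm _ _).trans c1)
    · exact anticommutator_diag_eq_zero (za 0) (sq 0) (c := a 1) ((add_comm _ _).trans c1)
        ((add_comm _ _).trans c2)
    · exact anticommutator_diag_eq_zero (za 1) (sq 1) (c := a 2) c2 ((add_comm _ _).trans c0)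
    · exact anticommutator_diag_eq_zero (za 1) (sq 1) (c := a 0) ((add_comm _ _).trans c0) c2
    · exact anticommutator_diag_eq_zero (za 2) (sq 2) (c := a 1) c1 c0
    · exact anticommutator_diag_eq_zero (za 2) (sq 2) (c := a 0) c0 c1
  obtain ⟨w2, x2⟩ := swap_conj (a := a 2) (hz 1) (hzz 1 0 (by decide))
    (by linear_combination (norm := noncomm_ring) bz * a 2 - za 2)
    (by linear_combination (norm := noncomm_ring) a 2 * bz - az 2)
    (by linear_combination (norm := abel) sq 2 - bz) (d 0 2 (by decide)) (d 1 2 (by decide))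
  obtain ⟨w1, x1⟩ := swap_conj (a := a 1) (hz 2) (hzz 2 0 (by decide))
    (by linear_combination (norm := noncomm_ring) bz * a 1 - za 1)
    (by linear_combination (norm := noncomm_ring) a 1 * bz - az 1)
    (by linear_combination (norm := abel) sq 1 - bz) (d 0 1 (by decide)) (d 2 1 (by decide))
  obtain ⟨w0, x0⟩ := swap_conj (a := a 0) (hz 2) (hzz 2 1 (by decide))
    (by linear_combination (norm := noncomm_ring) bz * a 0 - za 0)
    (by linear_combination (norm := noncomm_ring) a 0 * bz - az 0)
    (by linear_combination (norm := abel) sq 0 - bz) (d 1 0 (by decide)) (d 2 0 (by decide))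
  -- the projection `P 9` on the ray `(1, 1, 1)` is unbiased to the coordinates
  have hf : ∀ x y, (3 : ℂ) • (x * P 9 * y) = x * y + (x * a 0 * y + x * a 1 * y + x * a 2 * y) := by
    intro x y
    rw [← smul_mul_assoc, ← mul_smul_comm, p0]
    noncomm_ring
  have E : ∀ i, (3 : ℂ) • (z i * P 9 * z i) = z i := by
    intro i
    have h1 : ∀ j, z i * a j * z i = 0 := by
      intro j
      by_cases hij : i = j
      · rw [← hij, za, zero_mul]
      · exact d i j hij
    rw [hf, h1, h1, h1, hz, add_zero, add_zero, add_zero]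
  have E01 : (3 : ℂ) • (z 0 * P 9 * z 1) = z 0 * a 2 * z 1 := by
    rw [hf, hzz 0 1 (by decide), za 0, mul_assoc _ (a 1), az 1]
    simp only [zero_mul, mul_zero, zero_add, add_zero]
  have E10 : (3 : ℂ) • (z 1 * P 9 * z 0) = z 1 * a 2 * z 0 := by
    rw [hf, hzz 1 0 (by decide), za 1, mul_assoc _ (a 0), az 0]
    simp only [zero_mul, mul_zero, zero_add, add_zero]
  have E02 : (3 : ℂ) • (z 0 * P 9 * z 2) = z 0 * a 1 * z 2 := by
    rw [hf, hzz 0 2 (by decide), za 0, mul_assoc _ (a 2), az 2]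
    simp only [zero_mul, mul_zero, zero_add, add_zero]
  have E20 : (3 : ℂ) • (z 2 * P 9 * z 0) = z 2 * a 1 * z 0 := by
    rw [hf, hzz 2 0 (by decide), za 2, mul_assoc _ (a 0), az 0]
    simp only [zero_mul, mul_zero, zero_add, add_zero]
  have E12 : (3 : ℂ) • (z 1 * P 9 * z 2) = z 1 * a 0 * z 2 := by
    rw [hf, hzz 1 2 (by decide), za 1, mul_assoc _ (a 2), az 2]
    simp only [zero_mul, mul_zero, zero_add, add_zero]
  have E21 : (3 : ℂ) • (z 2 * P 9 * z 1) = z 2 * a 0 * z 1 := by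
    rw [hf, hzz 2 1 (by decide), za 2, mul_assoc _ (a 1), az 1]
    simp only [zero_mul, mul_zero, zero_add, add_zero]
  -- `P 9` is orthogonal to the rays `(1, -1, 0)` and the like, so that
  -- `P 9 * a 2 = P 9 * (z 0 + z 1)`; it follows that it compresses the three coordinates equally
  have y1 : P 9 * z 1 * P 9 = P 9 * z 0 * P 9 := by
    have h0 : y 2 = z 0 + z 1 - y' 2 := by linear_combination (norm := abel) by' 2 - bz
    have h2 : P 9 * a 2 = P 9 * z 0 + P 9 * z 1 := by
      rw [ha, h0, mul_sub, mul_sub, mul_add, show P 9 * y' 2 = 0 from o 9 8 (by decide), sub_zero, sub_zero]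
    have h3 : a 2 * P 9 = z 0 * P 9 + z 1 * P 9 := by
      rw [ha, h0, sub_mul, sub_mul, add_mul, show y' 2 * P 9 = 0 from o 8 9 (by decide), sub_zero, sub_zero]
    calc P 9 * z 1 * P 9 = P 9 * a 2 * z 0 * (a 2 * P 9) := by rw [← x2]; simp only [mul_assoc]
      _ = _ := by
        rw [h2, h3]
        simp only [add_mul, mul_add, mul_assoc, ← mul_assoc (z 0), hz, hzz 0 1 (by decide),
          hzz 1 0 (by decide), zero_mul, mul_zero, add_zero]
  have y2 : P 9 * z 2 * P 9 = P 9 * z 0 * P 9 := by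
    have h0 : y 1 = z 0 + z 2 - y' 1 := by linear_combination (norm := abel) by' 1 - bz
    have h2 : P 9 * a 1 = P 9 * z 0 + P 9 * z 2 := by
      rw [ha, h0, mul_sub, mul_sub, mul_add, show P 9 * y' 1 = 0 from o 9 6 (by decide), sub_zero, sub_zero]
    have h3 : a 1 * P 9 = z 0 * P 9 + z 2 * P 9 := by
      rw [ha, h0, sub_mul, sub_mul, add_mul, show y' 1 * P 9 = 0 from o 6 9 (by decide), sub_zero, sub_zero]
    calc P 9 * z 2 * P 9 = P 9 * a 1 * z 0 * (a 1 * P 9) := by rw [← x1]; simp only [mul_assoc]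
      _ = _ := by
        rw [h2, h3]
        simp only [add_mul, mul_add, mul_assoc, ← mul_assoc (z 0), hz, hzz 0 2 (by decide),
          hzz 2 0 (by decide), zero_mul, mul_zero, add_zero]
  have y0 : (3 : ℂ) • (P 9 * z 0 * P 9) = P 9 := by
    have h1 : P 9 * z 0 * P 9 + P 9 * z 1 * P 9 + P 9 * z 2 * P 9 = P 9 := by
      rw [← add_mul, ← add_mul, ← mul_add, ← mul_add, bz, mul_one, hid]
    rw [y1, y2] at h1
    nth_rewrite 3 [← h1]
    module
  let u := GradedMatrixUnits.ofUnbiased z (P 9) 1 (by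
      intro i j
      split_ifs with h
      · rw [← h]; exact hz _
      · exact hzz _ _ h)
    (by rw [Fin.sum_univ_three]; exact bz) (fun i => hsa _) (hsa 9) E
    (by
      intro i
      fin_cases i
      · exact y0
      · exact (congrArg _ y1).trans y0
      · exact (congrArg _ y2).trans y0)
    (star_one _) (one_mul 1) (fun i => (Commute.one_left _).eq) ((Commute.one_left _).eq)
  have U : ∀ i, u.e i i = z i := E
  have V2 : a 2 = u.e 0 1 + u.e 1 0 :=
    w2.trans (congrArg₂ _ E01.symm E10.symm)
  have V1 : a 1 = u.e 0 2 + u.e 2 0 :=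
    w1.trans (congrArg₂ _ E02.symm E20.symm)
  have V0 : a 0 = u.e 1 2 + u.e 2 1 :=
    w0.trans (congrArg₂ _ E12.symm E21.symm)
  have V := u.sum_e
  rw [Fin.sum_univ_three] at V
  have Y : ∀ i, y i = (1 / 2 : ℂ) • (1 - u.e i i + a i) := fun i => by rw [U, hy]
  have Y' : ∀ i, y' i = (1 / 2 : ℂ) • (1 - u.e i i - a i) := fun i => by rw [U, hy']
  refine ⟨u, rfl, fun k => ?_⟩
  fin_cases k
  · simp [Fin.sum_univ_three, yoInt]
    exact (U 0).symm
  · simp [Fin.sum_univ_three, yoInt]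
    exact (U 1).symm
  · simp [Fin.sum_univ_three, yoInt]
    exact (U 2).symm
  · simp [Fin.sum_univ_three, yoInt]
    have h : P 3 = (1 / 2 : ℂ) • (1 - u.e 0 0 + a 0) := Y 0
    linear_combination (norm := module) h + (1 / 2 : ℂ) • (V0 - V)
  · simp [Fin.sum_univ_three, yoInt]
    have h : P 4 = (1 / 2 : ℂ) • (1 - u.e 0 0 - a 0) := Y' 0
    linear_combination (norm := module) h - (1 / 2 : ℂ) • (V0 + V)
  · simp [Fin.sum_univ_three, yoInt]
    have h : P 5 = (1 / 2 : ℂ) • (1 - u.e 1 1 + a 1) := Y 1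
    linear_combination (norm := module) h + (1 / 2 : ℂ) • (V1 - V)
  · simp [Fin.sum_univ_three, yoInt]
    have h : P 6 = (1 / 2 : ℂ) • (1 - u.e 1 1 - a 1) := Y' 1
    linear_combination (norm := module) h - (1 / 2 : ℂ) • (V1 + V)
  · simp [Fin.sum_univ_three, yoInt]
    have h : P 7 = (1 / 2 : ℂ) • (1 - u.e 2 2 + a 2) := Y 2
    linear_combination (norm := module) h + (1 / 2 : ℂ) • (V2 - V)
  · simp [Fin.sum_univ_three, yoInt]
    have h : P 8 = (1 / 2 : ℂ) • (1 - u.e 2 2 - a 2) := Y' 2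
    linear_combination (norm := module) h - (1 / 2 : ℂ) • (V2 + V)
  · simp [Fin.sum_univ_three, yoInt]
    linear_combination (norm := module) (1 / 3 : ℂ) • (p0 - V + V0 + V1 + V2)
  · simp [Fin.sum_univ_three, yoInt]
    linear_combination (norm := module) (1 / 3 : ℂ) • (p1 - V - V0 - V1 + V2)
  · simp [Fin.sum_univ_three, yoInt]
    linear_combination (norm := module) (1 / 3 : ℂ) • (p2 - V + V0 - V1 - V2)
  · simp [Fin.sum_univ_three, yoInt]
    linear_combination (norm := module) (1 / 3 : ℂ) • (p3 - V - V0 + V1 - V2)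

end CFR


namespace CFR

/-! ### The rays of BBC-21 -/

lemma q_pow_three : q ^ 3 = 1 := by
  rw [q, ← Complex.exp_nat_mul, Complex.exp_eq_one_iff]
  exact ⟨1, by push_cast; ring⟩

lemma q_ne_one : q ≠ 1 := by
  rw [q, Ne, Complex.exp_eq_one_iff]
  rintro ⟨n, hn⟩
  have h2 : (2 * Real.pi * Complex.I : ℂ) ≠ 0 := Complex.two_pi_I_ne_zero
  have h3 : (n : ℂ) * 3 = 1 := by
    apply mul_left_cancel₀ h2
    linear_combination -3 * hn
  have h4 : n * 3 = 1 := by exact_mod_cast h3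
  omega

lemma q_sum : 1 + q + q ^ 2 = 0 := by
  have h : (q - 1) * (1 + q + q ^ 2) = 0 := by linear_combination q_pow_three
  exact (mul_eq_zero.1 h).resolve_left (sub_ne_zero.2 q_ne_one)

lemma star_q : star q = q ^ 2 := by
  have h1 : star q * q = 1 := by
    have : ‖q‖ = 1 := by
      rw [q, show (2 * Real.pi * Complex.I / 3 : ℂ) = ((2 * Real.pi / 3 : ℝ) : ℂ) * Complex.I by
        push_cast; ring]
      exact Complex.norm_exp_ofReal_mul_I _
    rw [Complex.star_def, Complex.conj_mul', this]
    simp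
  linear_combination q ^ 2 * h1 - star q * q_pow_three

/-- The character `k ↦ q ^ k` of the group `ℤ / 3`. -/
noncomputable def cubeChar : Fin 3 → ℂ := ![1, q, q ^ 2]

lemma cubeChar_add (a b : Fin 3) : cubeChar (a + b) = cubeChar a * cubeChar b := by
  fin_cases a <;> fin_cases b <;> simp [cubeChar] <;>
    first | ring1 | linear_combination -q_pow_three | linear_combination -q * q_pow_three

lemma cubeChar_zero : cubeChar 0 = 1 := rfl

lemma star_cubeChar (a : Fin 3) : star (cubeChar a) = cubeChar (-a) := by
  have h : star q = q ^ 2 := star_q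
  rw [Complex.star_def] at *
  fin_cases a
  · simp [cubeChar]
  · simpa [cubeChar] using h
  · simp [cubeChar, h]
    linear_combination q * q_pow_three

lemma cubeChar_mul_neg (a : Fin 3) : cubeChar a * cubeChar (-a) = 1 := by
  rw [← cubeChar_add, add_neg_cancel, cubeChar_zero]

lemma sum_cubeChar : ∑ a, cubeChar a = 0 := by
  rw [Fin.sum_univ_three]
  exact q_sum

lemma sum_cubeChar_neg : ∑ a, cubeChar (-a) = 0 :=
  (Equiv.sum_comp (Equiv.neg (Fin 3)) cubeChar).trans sum_cubeChar

section Group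

/-- The group-theoretic core of the analysis of BBC-21: the relations of the Heisenberg group. -/
lemma commute_of_cubes {G : Type*} [Group G] {a b w : G} (hb : b ^ 3 = 1)
    (hw : w ^ 3 = 1) (h : w * a = b * w) (h1 : (w * a) ^ 3 = 1) (h2 : (w * a * a) ^ 3 = 1) :
    a * b = b * a ∧ w * (a⁻¹ * b) = a⁻¹ * b * w := by
  obtain ⟨c, hc⟩ : ∃ c, w * b = c * w := ⟨w * b * w⁻¹, by group⟩
  have e : w * w * w = 1 := by rw [← hw, pow_succ, pow_two]
  have h3 : b * c * a = 1 := by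
    have h4 : b * w * (b * w) * (w * a) = 1 := by rw [← h, ← h1, pow_succ, pow_two]
    calc b * c * a = b * c * (w * w * w) * a := by rw [e, mul_one]
      _ = b * (c * w) * w * (w * a) := by simp only [mul_assoc]
      _ = b * w * (b * w) * (w * a) := by rw [← hc]; simp only [mul_assoc]
      _ = 1 := h4
  have h4 : b * b * (c * c) * (a * a) = 1 := by
    have h5 : w * a * a = b * b * w := by rw [h, mul_assoc, h, mul_assoc]
    have h6 : b * b * w * (b * b * w) * (w * a * a) = 1 := by
      rw [← h5, ← h2, pow_succ, pow_two]
    calc b * b * (c * c) * (a * a) = b * b * (c * c) * (w * w * w) * (a * a) := by rw [e, mul_one]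
      _ = b * b * (c * (c * w)) * w * (w * a * a) := by simp only [mul_assoc]
      _ = b * b * w * (b * b * w) * (w * a * a) := by
        rw [← hc, ← mul_assoc c w b, ← hc]; simp only [mul_assoc]
      _ = 1 := h6
  have h5 : c = b⁻¹ * a⁻¹ := by
    rw [eq_inv_mul_iff_mul_eq, eq_inv_iff_mul_eq_one, h3]
  have h6 : a * b = b * a := by
    rw [h5] at h4
    have h7 : b * a⁻¹ * b⁻¹ * a = 1 := by
      rw [← h4]; group
    have h8 : b * a⁻¹ = a⁻¹ * b := by
      rw [← mul_inv_eq_one, ← h7]; group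
    calc a * b = a * (b * a⁻¹) * a := by group
      _ = b * a := by rw [h8]; group
  refine ⟨h6, ?_⟩
  have h7 : w * a⁻¹ = b⁻¹ * w := by
    rw [mul_inv_eq_iff_eq_mul, mul_assoc, h]; group
  have h8 : b⁻¹ * b⁻¹ = b := by
    rw [← mul_inv_rev, inv_eq_iff_mul_eq_one, ← hb, pow_succ, pow_two]
  calc w * (a⁻¹ * b) = b⁻¹ * (w * b) := by rw [← mul_assoc, h7, mul_assoc]
    _ = b⁻¹ * b⁻¹ * a⁻¹ * w := by rw [hc, h5]; simp only [mul_assoc]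
    _ = a⁻¹ * b * w := by
      rw [h8, (show b * a⁻¹ = a⁻¹ * b from by
        rw [mul_inv_eq_iff_eq_mul, mul_assoc, ← h6]; group)]

end Group

section Fourier

variable {A : Type*} [Ring A] [Algebra ℂ A]

/-- A linear combination of the members of a projective measurement with three outcomes. -/
def pvmSum (M : Fin 3 → A) (f : Fin 3 → ℂ) : A := ∑ k, f k • M k

lemma pvmSum_mul {M : Fin 3 → A} (hM : ∀ i j, M i * M j = if i = j then M i else 0)
    (f g : Fin 3 → ℂ) : pvmSum M f * pvmSum M g = pvmSum M (fun k => f k * g k) := by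
  rw [pvmSum, pvmSum, Finset.sum_mul_sum]
  refine Finset.sum_congr rfl fun i _ => ?_
  rw [Finset.sum_eq_single i]
  · rw [smul_mul_smul_comm, hM, if_pos rfl]
  · intro j _ hj
    rw [smul_mul_smul_comm, hM, if_neg hj.symm, smul_zero]
  · simp

lemma pvmSum_one {M : Fin 3 → A} (hM : ∑ i, M i = 1) : pvmSum M (fun _ => 1) = 1 := by
  simp [pvmSum, hM]

lemma star_pvmSum [StarRing A] [StarModule ℂ A] {M : Fin 3 → A} (hM : ∀ i, star (M i) = M i)
    (f : Fin 3 → ℂ) : star (pvmSum M f) = pvmSum M (fun k => star (f k)) := by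
  simp [pvmSum, star_sum, star_smul, hM]

/-- Recovery of the members of a measurement from its Fourier transform. -/
lemma three_smul_pvm (M : Fin 3 → A) (hM : ∑ i, M i = 1) (k : Fin 3) :
    (3 : ℂ) • M k = 1 + cubeChar (-k) • pvmSum M cubeChar +
      cubeChar k • pvmSum M (fun l => cubeChar (-l)) := by
  have h : ∀ l, (1 : ℂ) + cubeChar (-k) * cubeChar l + cubeChar k * cubeChar (-l) =
      if l = k then 3 else 0 := by
    intro l
    rw [← cubeChar_add, ← cubeChar_add]
    have h2 := q_sum
    have e1 : (-1 + 2 : Fin 3) = 1 := rfl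
    have e2 : (1 + -2 : Fin 3) = 2 := rfl
    have e3 : (-2 + 1 : Fin 3) = 2 := rfl
    have e4 : (2 + -1 : Fin 3) = 1 := rfl
    fin_cases k <;> fin_cases l <;> simp [cubeChar, e1, e2, e3, e4] <;>
      first | linear_combination h2 | norm_num
  have h3 : (3 : ℂ) • M k = ∑ l, (if l = k then (3 : ℂ) else 0) • M l := by simp
  rw [h3, ← hM, pvmSum, pvmSum, Finset.smul_sum, Finset.smul_sum, ← Finset.sum_add_distrib,
    ← Finset.sum_add_distrib]
  refine Finset.sum_congr rfl fun l _ => ?_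
  rw [← h]
  module

/-- The Fourier transform of the relation that expresses that the sum of the lines through a point
acts as a scalar on each of them. -/
lemma fourier_relation {e : Fin 3 → ℂ} (he : ∀ a b, e (a + b) = e a * e b) (hsum : ∑ a, e a = 0)
    {L Z B C : Fin 3 → A} (hL : ∑ k, L k = 1)
    (h : ∀ k x, L k * (Z x + B (k + x) + C (k - x)) = L k) :
    pvmSum Z e + pvmSum L (fun k => e (-k)) * pvmSum B e +
      pvmSum L e * pvmSum C (fun k => e (-k)) = 0 := by
  have h1 : ∑ k, ∑ x, e x • (L k * (Z x + B (k + x) + C (k - x))) = 0 := by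
    simp only [h, ← Finset.sum_smul, hsum, zero_smul, Finset.sum_const_zero]
  have h2 : pvmSum L (fun k => e (-k)) * pvmSum B e = ∑ k, ∑ x, e x • (L k * B (k + x)) := by
    rw [pvmSum, pvmSum, Finset.sum_mul_sum]
    refine Finset.sum_congr rfl fun k _ => ?_
    rw [← Equiv.sum_comp (Equiv.addLeft k)]
    refine Finset.sum_congr rfl fun x _ => ?_
    rw [smul_mul_smul_comm, ← he]
    simp
  have h3 : pvmSum L e * pvmSum C (fun k => e (-k)) = ∑ k, ∑ x, e x • (L k * C (k - x)) := by
    rw [pvmSum, pvmSum, Finset.sum_mul_sum]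
    refine Finset.sum_congr rfl fun k _ => ?_
    rw [← Equiv.sum_comp (Equiv.subLeft k)]
    refine Finset.sum_congr rfl fun x _ => ?_
    rw [smul_mul_smul_comm, ← he]
    simp
  have h4 : pvmSum Z e = ∑ k, ∑ x, e x • (L k * Z x) := by
    rw [Finset.sum_comm]
    refine Finset.sum_congr rfl fun x _ => ?_
    rw [← Finset.smul_sum, ← Finset.sum_mul, hL, one_mul]
  rw [h2, h3, h4, ← Finset.sum_add_distrib, ← Finset.sum_add_distrib, ← h1]
  refine Finset.sum_congr rfl fun k _ => ?_
  rw [← Finset.sum_add_distrib, ← Finset.sum_add_distrib]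
  refine Finset.sum_congr rfl fun x _ => ?_
  rw [mul_add, mul_add, smul_add, smul_add]

end Fourier

end CFR


namespace CFR

section Heisenberg

variable {A : Type*} [Ring A] [StarRing A] [Algebra ℂ A] [StarModule ℂ A]

/-- The twelve lines of the affine plane over the field with three elements, in the form of
four projective measurements, generate the Heisenberg group, up to a central unitary `u` that
is a primitive cube root of unity: the Fourier transforms `Z` and `W c` of the measurements satisfy
the Weyl commutation relations. -/
theorem exists_central_phase {z : Fin 3 → A} {M : Fin 3 → Fin 3 → A}
    (hzs : ∀ i, star (z i) = z i) (hMs : ∀ c i, star (M c i) = M c i)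
    (hz : ∀ i j, z i * z j = if i = j then z i else 0)
    (hM : ∀ c i j, M c i * M c j = if i = j then M c i else 0)
    (hz1 : ∑ i, z i = 1) (hM1 : ∀ c, ∑ i, M c i = 1)
    (hpt : ∀ c k x, M c k * (z x + M (c + 1) (k + x) + M (c + 2) (k - x)) = M c k)
    {Z : A} {W : Fin 3 → A} (hZ : Z = pvmSum z cubeChar)
    (hW : ∀ c, W c = pvmSum (M c) fun k => cubeChar (-k)) :
    ∃ u : A, star u * u = 1 ∧ 1 + u + star u = 0 ∧ Commute u Z ∧ (∀ c, Commute u (W c)) ∧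
      W 0 * Z = u * Z * W 0 ∧ W 2 = W 0 * (Z * u) ∧ W 1 = W 2 * (Z * u) := by
  have hWs : ∀ c, star (W c) = pvmSum (M c) cubeChar := by
    intro c
    rw [hW, star_pvmSum (hMs c)]
    simp only [star_cubeChar, neg_neg]
  have hZs : star Z = pvmSum z fun k => cubeChar (-k) := by
    rw [hZ, star_pvmSum hzs]
    simp only [star_cubeChar]
  have hmn : ∀ k, cubeChar (-k) * cubeChar k = 1 := fun k => by
    rw [mul_comm, cubeChar_mul_neg]
  have hc : ∀ k, cubeChar k * cubeChar k * cubeChar k = 1 := by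
    intro k
    rw [← cubeChar_add, ← cubeChar_add, ← cubeChar_zero]
    congr 1
    revert k
    decide
  have W1 : ∀ c, W c * star (W c) = 1 ∧ star (W c) * W c = 1 := by
    intro c
    rw [hWs, hW, pvmSum_mul (hM c), pvmSum_mul (hM c)]
    simp only [cubeChar_mul_neg, hmn, pvmSum_one (hM1 c), and_self]
  have Z1 : star Z * Z = 1 ∧ Z * star Z = 1 := by
    rw [hZs, hZ, pvmSum_mul hz, pvmSum_mul hz]
    simp only [cubeChar_mul_neg, hmn, pvmSum_one hz1, and_self]
  have W3 : ∀ c, W c * W c * W c = 1 := by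
    intro c
    rw [hW, pvmSum_mul (hM c), pvmSum_mul (hM c)]
    simp only [hc, pvmSum_one (hM1 c)]
  -- the relations of the points, and their adjoints, after Fourier transformation
  have F : ∀ c, Z + W c * star (W (c + 1)) + star (W c) * W (c + 2) = 0 := by
    intro c
    rw [hWs, hWs, hW, hW, hZ]
    exact fourier_relation cubeChar_add sum_cubeChar (hM1 c) (hpt c)
  have G : ∀ c, Z + star (W (c + 1)) * W c + W (c + 2) * star (W c) = 0 := by
    intro c
    have h1 := fourier_relation (e := fun k => cubeChar (-k)) (fun a b => by
      rw [neg_add, cubeChar_add]) sum_cubeChar_neg (hM1 c) (hpt c)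
    simp only [neg_neg, ← hW, ← hWs, ← hZs] at h1
    have h2 := congrArg star h1
    simpa only [star_add, star_mul, star_star, star_zero] using h2
  have F0 : Z + W 0 * star (W 1) + star (W 0) * W 2 = 0 := F 0
  have F1 : Z + W 1 * star (W 2) + star (W 1) * W 0 = 0 := F 1
  have F2 : Z + W 2 * star (W 0) + star (W 2) * W 1 = 0 := F 2
  have G0 : Z + star (W 1) * W 0 + W 2 * star (W 0) = 0 := G 0
  have G1 : Z + star (W 2) * W 1 + W 0 * star (W 1) = 0 := G 1
  have G2 : Z + star (W 0) * W 2 + W 1 * star (W 2) = 0 := G 2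
  -- differences of these relations identify the quotients of the `W c`
  have b01 : W 1 * star (W 2) = W 0 * star (W 1) := by
    linear_combination (norm := abel) G2 - F0
  have b02 : W 2 * star (W 0) = W 0 * star (W 1) := by
    linear_combination (norm := abel) G0 - F1 + G2 - F0
  have a02 : star (W 0) * W 2 = star (W 1) * W 0 := by
    linear_combination (norm := abel) F0 - G1 + F2 - G0
  have a12 : star (W 2) * W 1 = star (W 1) * W 0 := by
    linear_combination (norm := abel) F2 - G0
  -- the relations between the unitaries, in the unitary group
  obtain ⟨w, hw⟩ : ∃ w : Fin 3 → unitary A, ∀ c, (w c : A) = W c :=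
    ⟨fun c => ⟨W c, (W1 c).2, (W1 c).1⟩, fun c => rfl⟩
  obtain ⟨ζ, hζ⟩ : ∃ ζ : unitary A, (ζ : A) = Z := ⟨⟨Z, Z1⟩, rfl⟩
  obtain ⟨a, ha⟩ : ∃ a, a = (w 1)⁻¹ * w 0 := ⟨_, rfl⟩
  obtain ⟨b, hb⟩ : ∃ b, b = w 0 * (w 1)⁻¹ := ⟨_, rfl⟩
  have hstar : ∀ c, (((w c)⁻¹ : unitary A) : A) = star (W c) := fun c => by rw [← hw]; rfl
  have ha' : (a : A) = star (W 1) * W 0 := by rw [ha, Submonoid.coe_mul, hstar, hw]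
  have hb' : (b : A) = W 0 * star (W 1) := by rw [hb, Submonoid.coe_mul, hstar, hw]
  have g3 : ∀ c, w c ^ 3 = 1 := by
    intro c
    ext
    rw [pow_succ, pow_two, Submonoid.coe_mul, Submonoid.coe_mul, hw, W3]
    rfl
  have e1 : w 1 * a = w 0 := by rw [ha]; group
  have e1' : w 0 = b * w 1 := by rw [hb]; group
  have e2 : w 1 = b * w 2 := by
    have h1 : w 1 * (w 2)⁻¹ = b := by
      ext
      rw [Submonoid.coe_mul, hstar, hw, hb', b01]
    rw [← h1]; group
  have e3 : w 2 = b * w 0 := by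
    have h1 : w 2 * (w 0)⁻¹ = b := by
      ext
      rw [Submonoid.coe_mul, hstar, hw, hb', b02]
    rw [← h1]; group
  have e4 : w 2 = w 0 * a := by
    have h1 : (w 0)⁻¹ * w 2 = a := by
      ext
      rw [Submonoid.coe_mul, hstar, hw, ha', a02]
    rw [← h1]; group
  have e5 : w 1 = w 2 * a := by
    have h1 : (w 2)⁻¹ * w 1 = a := by
      ext
      rw [Submonoid.coe_mul, hstar, hw, ha', a12]
    rw [← h1]; group
  have hb3 : b ^ 3 = 1 := by
    have h1 : b ^ 3 * w 0 = w 0 := by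
      conv_rhs => rw [e1', e2, e3]
      rw [pow_succ, pow_two]
      simp only [mul_assoc]
    exact mul_eq_right.1 h1
  obtain ⟨hab, hu⟩ := commute_of_cubes hb3 (g3 1) (e1.trans e1') (by rw [e1, g3])
    (by rw [e1, ← e4, g3])
  -- the quotient of the left and the right translation between the `W c` is the central phase
  obtain ⟨u, hu'⟩ : ∃ u, u = a⁻¹ * b := ⟨_, rfl⟩
  rw [← hu'] at hu
  have hau : Commute u a := by
    have : Commute a b := hab
    rw [hu']
    exact ((Commute.refl a).inv_left.mul_left this.symm)
  have huw : Commute u (w 1) := hu.symm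
  have hbu : b = a * u := by rw [hu']; group
  have hu1 : star (u : A) * u = 1 := u.2.1
  have hZa : Z = -((a : A) * (1 + u)) := by
    have h1 : (b : A) = a * u := by rw [hbu]; rfl
    rw [mul_add, mul_one, ← h1, ha', hb']
    linear_combination (norm := abel) F1 - b01
  -- unitarity of `Z` says that the phase is a primitive cube root of unity
  have hsum : 1 + (u : A) + star (u : A) = 0 := by
    have h1 : star Z * Z = (1 + star (u : A)) * (1 + u) := by
      rw [hZa, star_neg, neg_mul_neg, star_mul, star_add, star_one, mul_assoc,
        ← mul_assoc (star (a : A)), show star (a : A) * a = 1 from a.2.1, one_mul]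
    rw [Z1.1, mul_add, add_mul, add_mul, hu1] at h1
    simp only [mul_one, one_mul] at h1
    linear_combination (norm := abel) -h1
  have hζa : ζ * u = a := by
    ext
    rw [Submonoid.coe_mul, hζ, hZa, neg_mul, mul_assoc, ← mul_neg]
    have h1 : -((1 + (u : A)) * u) = 1 := by
      have h2 : 1 + (u : A) = -star (u : A) := eq_neg_of_add_eq_zero_left hsum
      rw [h2, neg_mul, neg_neg, hu1]
    rw [h1, mul_one]
  have hζ' : ζ = a * u⁻¹ := by rw [← hζa]; group
  have huζ : Commute u ζ := by
    rw [hζ']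
    exact hau.mul_right (Commute.refl u).inv_right
  have hu0 : Commute u (w 0) := by
    rw [← e1]
    exact huw.mul_right hau
  have hu2 : Commute u (w 2) := by
    rw [e4]
    exact hu0.mul_right hau
  have toA : ∀ {x y : unitary A}, Commute x y → Commute (x : A) (y : A) := fun h =>
    congrArg Subtype.val h.eq
  refine ⟨u, hu1, hsum, hζ ▸ toA huζ, fun c => ?_, ?_, ?_, ?_⟩
  · rw [← hw]
    fin_cases c
    · exact toA hu0
    · exact toA huw
    · exact toA hu2
  · have h1 : w 0 * ζ = u * ζ * w 0 := by
      calc w 0 * ζ = b * w 1 * (a * u⁻¹) := by rw [← e1', hζ']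
        _ = a * (u * (w 1 * a)) * u⁻¹ := by rw [hbu]; simp only [mul_assoc]
        _ = a * w 0 := by rw [e1, hu0.eq]; group
        _ = u * ζ * w 0 := by rw [huζ.eq, hζa]
    have h2 := congrArg Subtype.val h1
    simpa only [Submonoid.coe_mul, hw, hζ] using h2
  · have h1 := congrArg Subtype.val e4
    rw [← hζa] at h1
    simpa only [Submonoid.coe_mul, hw, hζ] using h1
  · have h1 := congrArg Subtype.val e5
    rw [← hζa] at h1
    simpa only [Submonoid.coe_mul, hw, hζ] using h1

end Heisenberg

end CFR


namespace CFR

/-- The `k`-th projector of the `c`-th of the three bases that are mutually unbiased to the standard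
basis of `ℂ³`. -/
noncomputable def lineMatrix (c k : Fin 3) : Matrix (Fin 3) (Fin 3) ℂ := Matrix.of fun a b =>
  if a = b then 1 / 3 else if b = a + 1 then cubeChar (k + c * (a + b)) / 3
    else cubeChar (-(k + c * (a + b))) / 3

section PVM

variable {A : Type*} [Ring A] [Algebra ℂ A]

lemma mul_pvmSum {M : Fin 3 → A} (hM : ∀ i j, M i * M j = if i = j then M i else 0)
    (f : Fin 3 → ℂ) (i : Fin 3) : M i * pvmSum M f = f i • M i := by
  rw [pvmSum, Finset.mul_sum, Finset.sum_eq_single i]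
  · rw [mul_smul_comm, hM, if_pos rfl]
  · intro j _ hj
    rw [mul_smul_comm, hM, if_neg hj.symm, smul_zero]
  · simp

lemma pvmSum_mul_self {M : Fin 3 → A} (hM : ∀ i j, M i * M j = if i = j then M i else 0)
    (f : Fin 3 → ℂ) (i : Fin 3) : pvmSum M f * M i = f i • M i := by
  rw [pvmSum, Finset.sum_mul, Finset.sum_eq_single i]
  · rw [smul_mul_assoc, hM, if_pos rfl]
  · intro j _ hj
    rw [smul_mul_assoc, hM, if_neg hj, smul_zero]
  · simp

lemma grading_mul {c X Y : A} (hX : c * X = X) (hY : c * Y = -Y) (ζ : ℂ) :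
    ((ζ.re : ℂ) • 1 + ((ζ.im : ℂ) * Complex.I) • c) * (X + Y) = ζ • X + star ζ • Y := by
  have h2 : star ζ = ζ.re - ζ.im * Complex.I := by
    apply Complex.ext <;> simp
  have h1 : ζ • X = ((ζ.re : ℂ) + ζ.im * Complex.I) • X := by rw [Complex.re_add_im]
  rw [h1, h2, mul_add, add_mul, add_mul, smul_mul_assoc, smul_mul_assoc, smul_mul_assoc,
    smul_mul_assoc, hX, hY, one_mul, one_mul]
  module

end PVM

variable {A : Type*} [Ring A] [StarRing A] [Algebra ℂ A] [StarModule ℂ A]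

set_option maxHeartbeats 1000000 in
/-- Four projective measurements with three outcomes that satisfy the relations of the lines
through the points of the affine plane are four mutually unbiased bases of `ℂ³`, in suitable graded
matrix units. The grading distinguishes the two values of the central cube root of unity, that is,
the two orientations. -/
theorem exists_plane_units {z : Fin 3 → A} {M : Fin 3 → Fin 3 → A}
    (hzs : ∀ i, star (z i) = z i) (hMs : ∀ c i, star (M c i) = M c i)
    (hz : ∀ i j, z i * z j = if i = j then z i else 0)
    (hM : ∀ c i j, M c i * M c j = if i = j then M c i else 0)
    (hz1 : ∑ i, z i = 1) (hM1 : ∀ c, ∑ i, M c i = 1)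
    (hpt : ∀ c k x, M c k * (z x + M (c + 1) (k + x) + M (c + 2) (k - x)) = M c k) :
    ∃ v : GradedMatrixUnits 3 A, (∀ x, z x = v.e x x) ∧
      ∀ c k, M c k = v.map (lineMatrix c k) := by
  obtain ⟨Z, hZ⟩ : ∃ Z, Z = pvmSum z cubeChar := ⟨_, rfl⟩
  obtain ⟨W, hW⟩ : ∃ W : Fin 3 → A, ∀ c, W c = pvmSum (M c) fun k => cubeChar (-k) :=
    ⟨_, fun _ => rfl⟩
  obtain ⟨u, hu1, hu, huZ, huW, hWZ, hW2, hW1⟩ :=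
    exists_central_phase hzs hMs hz hM hz1 hM1 hpt hZ hW
  have hWs : ∀ c, star (W c) = pvmSum (M c) cubeChar := by
    intro c
    rw [hW, star_pvmSum (hMs c)]
    simp only [star_cubeChar, neg_neg]
  have hZs : star Z = pvmSum z fun k => cubeChar (-k) := by
    rw [hZ, star_pvmSum hzs]
    simp only [star_cubeChar]
  have hus : star u = -1 - u := by linear_combination (norm := abel) hu
  have huu : u * u = -1 - u := by
    have h1 : u * (1 + u + star u) = 0 := by rw [hu, mul_zero]
    have h2 : u * star u = star u * u := by rw [hus]; noncomm_ring
    rw [mul_add, mul_add, h2, hu1, mul_one] at h1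
    linear_combination (norm := abel) h1
  have hstar : ∀ {x}, Commute u x → Commute u (star x) := by
    intro x hx
    have h1 : Commute (star u) x := by
      rw [hus]
      exact ((Commute.one_left x).neg_left).sub_left hx
    have h2 := h1.star_star
    rwa [star_star] at h2
  have three : ∀ x y : A, (3 : ℂ) • x = (3 : ℂ) • y → x = y := fun x y h =>
    smul_right_injective A (by norm_num : (3 : ℂ) ≠ 0) h
  have hzc : ∀ x, Commute u (z x) := by
    intro x
    have h1 : Commute u ((3 : ℂ) • z x) := by
      rw [three_smul_pvm z hz1, ← hZ, ← hZs]
      exact ((Commute.one_right u).add_right (huZ.smul_right _)).add_right ((hstar huZ).smul_right _)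
    have h2 := h1.smul_right (3⁻¹ : ℂ)
    rwa [smul_smul, inv_mul_cancel₀ (by norm_num), one_smul] at h2
  have hM3 : ∀ c k, (3 : ℂ) • M c k = 1 + cubeChar k • W c + cubeChar (-k) • star (W c) := by
    intro c k
    rw [three_smul_pvm (M c) (hM1 c), ← hWs, ← hW]
    abel
  -- a product on which the phase acts trivially vanishes
  have hX : ∀ X, u * X = X → X = 0 := by
    intro X h
    have h1 : (1 + u + star u) * X = 0 := by rw [hu, zero_mul]
    have h2 : star u * X = X := by
      conv_lhs => rw [← h]
      rw [← mul_assoc, hu1, one_mul]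
    rw [add_mul, add_mul, one_mul, h, h2] at h1
    refine three _ _ ?_
    rw [smul_zero, ← h1]
    module
  -- by the Weyl relation the phase acts as the scalar `q^(b - a)` on the `(a, b)` entry of `W 0`; so the
  -- diagonal entries vanish, and on the others the phase distinguishes the two orientations
  have huN : ∀ a b, u * (z a * W 0 * z b) = cubeChar (b - a) • (z a * W 0 * z b) := by
    intro a b
    have h1 : cubeChar b • (z a * W 0 * z b) = cubeChar a • (u * (z a * W 0 * z b)) := by
      calc cubeChar b • (z a * W 0 * z b) = z a * W 0 * (Z * z b) := by
            rw [hZ, pvmSum_mul_self hz, mul_smul_comm]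
        _ = z a * (W 0 * Z) * z b := by simp only [mul_assoc]
        _ = (u * (z a * Z)) * W 0 * z b := by
            rw [hWZ, ← mul_assoc u, (hzc a).eq]; simp only [mul_assoc]
        _ = _ := by
            rw [hZ, mul_pvmSum hz]
            simp only [mul_smul_comm, smul_mul_assoc, mul_assoc]
    have h2 := congrArg (cubeChar (-a) • ·) h1
    simp only [smul_smul, ← cubeChar_add, neg_add_cancel, cubeChar_zero, one_smul] at h2
    rw [← h2, sub_eq_add_neg, add_comm]
  have hN0 : ∀ a, z a * W 0 * z a = 0 := by
    intro a
    refine hX _ ?_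
    rw [huN, sub_self, cubeChar_zero, one_smul]
  have step : ∀ a b X Y, Y = X * (Z * u) → Commute u X → z a * Y * z b =
      cubeChar b • (u * (z a * X * z b)) := by
    rintro a b X _ rfl hX
    calc z a * (X * (Z * u)) * z b = z a * (u * X) * (Z * z b) := by
          rw [hX.eq, ← huZ.eq]; simp only [mul_assoc]
      _ = _ := by
          rw [hZ, pvmSum_mul_self hz, mul_smul_comm, ← mul_assoc u, ← mul_assoc u, (hzc a).eq]
          simp only [mul_assoc]
  -- the entries of the other `W c` are multiples of those of `W 0`
  have hNc : ∀ c a b, z a * W c * z b = cubeChar (c * (a + b)) • (z a * W 0 * z b) := by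
    intro c a b
    have h2 : z a * W 2 * z b = cubeChar (2 * (a + b)) • (z a * W 0 * z b) := by
      rw [step a b _ _ hW2 (huW 0), huN, smul_smul, ← cubeChar_add]
      congr 2
      revert a b
      decide
    have h1 : z a * W 1 * z b = cubeChar (1 * (a + b)) • (z a * W 0 * z b) := by
      rw [step a b _ _ hW1 (huW 2), h2, mul_smul_comm, huN, smul_smul, smul_smul, ← cubeChar_add,
        ← cubeChar_add]
      congr 2
      clear h2
      revert a b
      decide
    fin_cases c
    · simp [cubeChar_zero]
    · exact h1
    · exact h2
  have hNs : ∀ c a b, z a * star (W c) * z b =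
      cubeChar (-(c * (a + b))) • star (z b * W 0 * z a) := by
    intro c a b
    have h1 := congrArg star (hNc c b a)
    simp only [star_mul, star_smul, hzs, star_cubeChar, ← mul_assoc] at h1
    rw [h1, add_comm b a]
    simp only [star_mul, hzs, ← mul_assoc]
  have hf0 : ∀ x y, (3 : ℂ) • (x * M 0 0 * y) = x * y + x * W 0 * y + x * star (W 0) * y := by
    intro x y
    rw [← smul_mul_assoc, ← mul_smul_comm, hM3]
    simp only [neg_zero, cubeChar_zero, one_smul]
    noncomm_ring
  -- the projection `M 0 0` is unbiased to the coordinates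
  have hzf : ∀ i, (3 : ℂ) • (z i * M 0 0 * z i) = z i := by
    intro i
    rw [hf0, hNs, hN0, star_zero, smul_zero, hz, if_pos rfl, add_zero, add_zero]
  have hfW : M 0 0 * W 0 = M 0 0 := by
    rw [hW, mul_pvmSum (hM 0)]
    simp [cubeChar_zero]
  have hWf : W 0 * M 0 0 = M 0 0 := by
    rw [hW, pvmSum_mul_self (hM 0)]
    simp [cubeChar_zero]
  have huf : Commute u (M 0 0) := by
    have h1 : Commute u ((3 : ℂ) • M 0 0) := by
      rw [hM3]
      exact ((Commute.one_right u).add_right ((huW 0).smul_right _)).add_right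
        ((hstar (huW 0)).smul_right _)
    have h2 := h1.smul_right (3⁻¹ : ℂ)
    rwa [smul_smul, inv_mul_cancel₀ (by norm_num), one_smul] at h2
  have hfZ : M 0 0 * Z * M 0 0 = 0 := by
    refine hX _ ?_
    calc u * (M 0 0 * Z * M 0 0) = M 0 0 * (u * Z * (W 0 * M 0 0)) := by
          rw [hWf, ← mul_assoc, ← mul_assoc, huf.eq]; simp only [mul_assoc]
      _ = M 0 0 * (u * Z * W 0) * M 0 0 := by simp only [mul_assoc]
      _ = M 0 0 * W 0 * Z * M 0 0 := by rw [← hWZ]; simp only [mul_assoc]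
      _ = _ := by rw [hfW]
  have hfZs : M 0 0 * star Z * M 0 0 = 0 := by
    have h1 := congrArg star hfZ
    simpa only [star_mul, hMs, star_zero, ← mul_assoc] using h1
  have hff : M 0 0 * M 0 0 = M 0 0 := by rw [hM, if_pos rfl]
  have hfz : ∀ i, (3 : ℂ) • (M 0 0 * z i * M 0 0) = M 0 0 := by
    intro i
    rw [← smul_mul_assoc, ← mul_smul_comm, three_smul_pvm z hz1, ← hZ, ← hZs, mul_add, mul_add,
      add_mul, add_mul, mul_smul_comm, mul_smul_comm, smul_mul_assoc, smul_mul_assoc, hfZ, hfZs,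
      mul_one, hff, smul_zero, smul_zero, add_zero, add_zero]
  -- the grading
  have hq0 : (1 + 2 * q) * (1 + 2 * q) = -3 := by linear_combination 4 * q_sum
  have hq : (1 + 2 * q) ≠ 0 := by
    intro h
    rw [h] at hq0
    norm_num at hq0
  obtain ⟨c, hc⟩ : ∃ c : A, c = (1 + 2 * q)⁻¹ • (1 + (u + u)) := ⟨_, rfl⟩
  have hcs : star c = c := by
    have h1 : star ((1 + 2 * q)⁻¹) = -(1 + 2 * q)⁻¹ := by
      rw [star_inv₀, star_add, star_mul, star_q, star_one, star_ofNat, ← inv_neg]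
      congr 1
      linear_combination 2 * q_sum
    rw [hc, star_smul, h1, star_add, star_add, star_one, hus]
    module
  have hcc : c * c = 1 := by
    have h1 : (1 + (u + u)) * (1 + (u + u)) = (-3 : ℂ) • (1 : A) := by
      have h2 : (1 + (u + u)) * (1 + (u + u)) = 1 + u + u + u + u + u * u + u * u + u * u + u * u := by
        noncomm_ring
      rw [h2, huu]
      module
    rw [hc, smul_mul_smul_comm, h1, smul_smul, ← mul_inv, hq0]
    norm_num
  have hcu : ∀ {x}, Commute u x → Commute c x := by
    intro x hx
    rw [hc]
    exact ((Commute.one_left x).add_left (hx.add_left hx)).smul_left _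
  have hcN : ∀ a, c * (z a * W 0 * z (a + 1)) = z a * W 0 * z (a + 1) := by
    intro a
    rw [hc, smul_mul_assoc, add_mul, add_mul, huN, one_mul, add_sub_cancel_left]
    have h1 : cubeChar 1 = q := rfl
    rw [h1, inv_smul_eq_iff₀ hq]
    module
  have hcN' : ∀ a, c * (z (a + 1) * W 0 * z a) = -(z (a + 1) * W 0 * z a) := by
    intro a
    rw [hc, smul_mul_assoc, add_mul, add_mul, huN, one_mul, inv_smul_eq_iff₀ hq]
    have h1 : cubeChar (a - (a + 1)) = -1 - q := by
      have h2 : a - (a + 1) = 2 := by revert a; decide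
      have h3 : cubeChar 2 = q ^ 2 := rfl
      rw [h2, h3]
      linear_combination q_sum
    rw [h1]
    module
  have hcs' : ∀ {x y : A}, c * x = y → Commute u x → c * star x = star y := by
    intro x y h hx
    rw [← h, star_mul, hcs, (hcu (hstar hx)).eq]
  have huN' : ∀ a b, Commute u (z a * W 0 * z b) := fun a b =>
    ((hzc a).mul_right (huW 0)).mul_right (hzc b)
  let v := GradedMatrixUnits.ofUnbiased z (M 0 0) c hz hz1 hzs (hMs 0 0) hzf hfz hcs hcc
    (fun i => (hcu (hzc i)).eq) (hcu huf).eq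
  have hve : ∀ a b, v.e a b = (3 : ℂ) • (z a * M 0 0 * z b) := fun a b => rfl
  have hvc : v.c = c := rfl
  -- a matrix unit off the diagonal is the sum of the parts of degree `1` and `-1`
  have hvn : ∀ a b, a ≠ b → v.e a b = z a * W 0 * z b + star (z b * W 0 * z a) := by
    intro a b hab
    rw [hve, hf0, hNs, hz, if_neg hab, zero_add, zero_mul, neg_zero, cubeChar_zero, one_smul]
  refine ⟨v, fun x => (hzf x).symm, fun e k => ?_⟩
  have hsplit : M e k = ∑ a, ∑ b, z a * M e k * z b := by
    simp only [← Finset.mul_sum, ← Finset.sum_mul, hz1, one_mul, mul_one]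
  have hent : ∀ a b, (3 : ℂ) • (z a * M e k * z b) = z a * z b +
      cubeChar (k + e * (a + b)) • (z a * W 0 * z b) +
      cubeChar (-(k + e * (a + b))) • star (z b * W 0 * z a) := by
    intro a b
    rw [← smul_mul_assoc, ← mul_smul_comm, hM3, mul_add, mul_add, add_mul, add_mul, mul_smul_comm,
      mul_smul_comm, smul_mul_assoc, smul_mul_assoc, hNc, hNs, smul_smul, smul_smul, mul_one,
      ← cubeChar_add, ← cubeChar_add, neg_add]
  have hent' : ∀ a b, a ≠ b → z a * M e k * z b =
      (cubeChar (k + e * (a + b)) / 3) • (z a * W 0 * z b) +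
      (cubeChar (-(k + e * (a + b))) / 3) • star (z b * W 0 * z a) := by
    intro a b hab
    refine three _ _ ?_
    rw [hent, hz, if_neg hab, smul_add, smul_smul, smul_smul, zero_add, mul_div_cancel₀ _ three_ne_zero,
      mul_div_cancel₀ _ three_ne_zero]
  have hstar3 : ∀ x, star (cubeChar x / 3) = cubeChar (-x) / 3 := by
    intro x
    rw [star_div₀, star_cubeChar, star_ofNat]
  rw [hsplit, GradedMatrixUnits.map]
  refine Finset.sum_congr rfl fun a _ => Finset.sum_congr rfl fun b _ => ?_
  rw [lineMatrix, Matrix.of_apply, hvc]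
  have hcases : b = a ∨ b = a + 1 ∨ a = b + 1 := by revert a b; decide
  rcases hcases with rfl | rfl | rfl
  · rw [if_pos rfl]
    refine three _ _ ?_
    rw [hent, hN0, star_zero, smul_zero, smul_zero, add_zero, add_zero, hz, if_pos rfl, hve, hzf]
    have h1 : ((1 / 3 : ℂ).re : ℂ) = 1 / 3 := by norm_num
    have h2 : ((1 / 3 : ℂ).im : ℂ) = 0 := by norm_num
    rw [h1, h2, zero_mul, zero_smul, add_zero, smul_mul_assoc, one_mul, smul_smul]
    norm_num
  · have hne : a ≠ a + 1 := by revert a; decide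
    rw [if_neg hne, if_pos rfl, hvn _ _ hne, grading_mul (hcN a), hent' _ _ hne, hstar3]
    rw [hcs' (hcN' a) (huN' _ _), star_neg]
  · have hne : b + 1 ≠ b := by revert b; decide
    have hne' : b ≠ b + 1 + 1 := by revert b; decide
    rw [if_neg hne, if_neg hne', hvn _ _ hne, add_comm (z (b + 1) * W 0 * z b), grading_mul
      (hcs' (hcN b) (huN' _ _)) (hcN' b), hent' _ _ hne, hstar3, neg_neg, add_comm]

end CFR


namespace CFR

/-- The four orthogonal bases formed by the rays of BBC-21. -/
def bbcBasis : Fin 4 → Fin 3 → Fin 21 := ![![9, 10, 11], ![12, 14, 13], ![17, 16, 15], ![19, 18, 20]]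

/-- The neighbours, one in each basis, of the first nine rays of BBC-21. -/
def bbcNbr : Fin 9 → Fin 4 → Fin 21 :=
  ![![9, 12, 17, 19], ![9, 13, 15, 20], ![9, 14, 16, 18], ![10, 12, 16, 20], ![10, 14, 15, 19],
    ![10, 13, 17, 18], ![11, 12, 15, 18], ![11, 13, 16, 19], ![11, 14, 17, 20]]

/-- The first nine rays of BBC-21. -/
def bbcPoint (j : Fin 9) : Fin 21 := j.castLE (by decide)

/-- Orthogonality of two rays of BBC-21. -/
def BbcOrth (i j : Fin 21) : Prop :=
  (∃ n a b, a ≠ b ∧ i = bbcBasis n a ∧ j = bbcBasis n b) ∨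
    ∃ p m, i = bbcPoint p ∧ j = bbcNbr p m ∨ j = bbcPoint p ∧ i = bbcNbr p m

instance : DecidableRel BbcOrth := fun _ _ => inferInstanceAs (Decidable (_ ∨ _))

lemma rankOneProj_apply {d : ℕ} (v : Fin d → ℂ) (a b : Fin d) :
    rankOneProj v a b = (star v ⬝ᵥ v)⁻¹ * (v a * star (v b)) := rfl

lemma conj_q : (starRingEnd ℂ) q = q ^ 2 := star_q

lemma bbc21_norm (i : Fin 21) :
    star (bbc21 i) ⬝ᵥ bbc21 i = if i < 9 then 2 else if i < 12 then 1 else 3 := by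
  have h := q_pow_three
  have h1 : (1 : Fin 21) < 9 := by decide
  fin_cases i <;> simp [dotProduct, Fin.sum_univ_three, bbc21, conj_q, g] <;> grind

lemma bbc21_orth {i j : Fin 21} (h : BbcOrth i j) : star (bbc21 i) ⬝ᵥ bbc21 j = 0 := by
  have key : ∀ p m, star (bbc21 (bbcPoint p)) ⬝ᵥ bbc21 (bbcNbr p m) = 0 := by
    have h1 := q_pow_three
    have h2 := q_sum
    intro p m
    fin_cases p <;> fin_cases m <;>
      simp [dotProduct, Fin.sum_univ_three, bbc21, conj_q, g, bbcNbr, bbcPoint] <;> grind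
  have key2 : ∀ n a b, a ≠ b → star (bbc21 (bbcBasis n a)) ⬝ᵥ bbc21 (bbcBasis n b) = 0 := by
    have h1 := q_pow_three
    have h2 := q_sum
    intro n a b hab
    fin_cases n <;> fin_cases a <;> fin_cases b <;> first | exact absurd rfl hab | skip
    all_goals
      simp [dotProduct, Fin.sum_univ_three, bbc21, conj_q, g, bbcBasis]
    all_goals grind
  rcases h with ⟨n, a, b, hab, rfl, rfl⟩ | ⟨p, m, ⟨rfl, rfl⟩ | ⟨rfl, rfl⟩⟩
  · exact key2 n a b hab
  · exact key p m
  · have h2 := congrArg star (key p m)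
    rwa [Matrix.star_dotProduct, star_star, star_zero] at h2

lemma rankOneProj_bbc21_line (c k : Fin 3) :
    rankOneProj (bbc21 (bbcBasis (Fin.succ c) k)) = lineMatrix c k := by
  have h1 := q_pow_three
  have h2 := q_sum
  have e : ∀ x : Fin 3, cubeChar x = if x = 0 then 1 else if x = 1 then q else q ^ 2 := by
    intro x
    fin_cases x <;> simp [cubeChar]
  ext a b
  have h3 : (star (bbc21 (bbcBasis (Fin.succ c) k)) ⬝ᵥ bbc21 (bbcBasis (Fin.succ c) k))⁻¹
      = 1 / 3 := by
    rw [bbc21_norm, if_neg (by revert c k; decide), if_neg (by revert c k; decide), one_div]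
  rw [rankOneProj_apply, h3, lineMatrix, Matrix.of_apply, e, e]
  have h4 : ∀ x y : ℂ, x = 3 * y → 1 / 3 * x = y := fun x y h => by rw [h]; ring
  apply h4
  fin_cases c <;> fin_cases k <;> fin_cases a <;> fin_cases b <;>
    simp [bbc21, conj_q, g, bbcBasis, mul_div_cancel₀, Fin.ext_iff]
  all_goals grind

lemma rankOneProj_bbc21_standard (k : Fin 3) :
    rankOneProj (bbc21 (bbcBasis 0 k)) = Matrix.single k k 1 := by
  ext a b
  have h3 : (star (bbc21 (bbcBasis 0 k)) ⬝ᵥ bbc21 (bbcBasis 0 k))⁻¹ = 1 := by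
    rw [bbc21_norm, if_neg (by revert k; decide), if_pos (by revert k; decide), inv_one]
  rw [rankOneProj_apply, h3, one_mul]
  fin_cases k <;> fin_cases a <;> fin_cases b <;> simp [bbc21, bbcBasis, Matrix.single]

set_option maxHeartbeats 2000000 in
/-- In the ideal family, the four lines through a point sum to twice the projection on the orthogonal
complement of the ray of the point. -/
lemma rankOneProj_bbc21_point (p : Fin 9) :
    rankOneProj (bbc21 (bbcPoint p)) =
      1 - (1 / 2 : ℂ) • ∑ m, rankOneProj (bbc21 (bbcNbr p m)) := by
  have h1 := q_pow_three
  have h2 := q_sum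
  have h4 : ∀ m : Fin 3, (star (bbc21 (bbcNbr p m.succ)) ⬝ᵥ bbc21 (bbcNbr p m.succ))⁻¹ = 1 / 3 := by
    intro m
    rw [bbc21_norm, if_neg (by revert p m; decide), if_neg (by revert p m; decide), one_div]
  have h5 : (star (bbc21 (bbcNbr p 0)) ⬝ᵥ bbc21 (bbcNbr p 0))⁻¹ = 1 := by
    rw [bbc21_norm, if_neg (by clear h4; revert p; decide), if_pos (by clear h4; revert p; decide), inv_one]
  have h3 : (star (bbc21 (bbcPoint p)) ⬝ᵥ bbc21 (bbcPoint p))⁻¹ = 1 / 2 := by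
    rw [bbc21_norm, if_pos (by clear h4 h5; revert p; decide), one_div]
  ext a b
  rw [Matrix.sub_apply, Matrix.smul_apply, Fin.sum_univ_succ, Matrix.add_apply, Matrix.sum_apply]
  simp only [rankOneProj_apply, h3, h4, h5]
  simp only [Fin.sum_univ_three]
  have h6 : ∀ x y z s : ℂ, x = 2 * s - y - 1 / 3 * z →
      1 / 2 * x = s - (1 / 2 : ℂ) • (1 * y + 1 / 3 * z) := by
    intro x y z s h
    rw [h, smul_eq_mul]
    ring
  rw [← mul_add, ← mul_add]
  apply h6
  fin_cases p <;> fin_cases a <;> fin_cases b <;>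
    simp [bbc21, conj_q, g, bbcNbr, bbcPoint]
  all_goals grind

variable {A : Type*} [Ring A] [StarRing A] [Algebra ℂ A] [StarModule ℂ A]

/-- Twenty-one projections with the orthogonality relations and the bases of the rays of BBC-21, of
which the first nine are the given linear combinations of the others, are the rays of BBC-21, in
suitable graded matrix units. -/
theorem exists_bbc_units (P : Fin 21 → A) (hsa : ∀ i, star (P i) = P i)
    (hid : ∀ i, P i * P i = P i) (o : ∀ i j, BbcOrth i j → P i * P j = 0)
    (hbasis : ∀ n, ∑ a, P (bbcBasis n a) = 1)
    (hpoint : ∀ p, P (bbcPoint p) = 1 - (1 / 2 : ℂ) • ∑ m, P (bbcNbr p m)) :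
    ∃ u : GradedMatrixUnits 3 A, ∀ k, P k = u.map (rankOneProj (bbc21 k)) := by
  have hb : ∀ n i j, P (bbcBasis n i) * P (bbcBasis n j) = if i = j then P (bbcBasis n i) else 0 := by
    intro n i j
    split_ifs with h
    · rw [h, hid]
    · exact o _ _ (Or.inl ⟨n, i, j, h, rfl, rfl⟩)
  -- the sum of the lines through a point acts as `2` on each of them
  have hT : ∀ p m, P (bbcNbr p m) * ∑ k, P (bbcNbr p k) = P (bbcNbr p m) + P (bbcNbr p m) := by
    intro p m
    have h1 : P (bbcNbr p m) * P (bbcPoint p) = 0 := o _ _ (Or.inr ⟨p, m, Or.inr ⟨rfl, rfl⟩⟩)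
    rw [hpoint, mul_sub, mul_one, mul_smul_comm, sub_eq_zero] at h1
    rw [← two_smul ℂ (P (bbcNbr p m))]
    nth_rewrite 2 [h1]
    rw [smul_smul]
    norm_num
  have hpt : ∀ c k x : Fin 3, P (bbcBasis c.succ k) * (P (bbcBasis 0 x) +
      P (bbcBasis (c + 1).succ (k + x)) + P (bbcBasis (c + 2).succ (k - x))) =
      P (bbcBasis c.succ k) := by
    intro c k x
    -- through two lines of different classes passes one point, which lies on a line of each other class
    have key : ∀ c k x : Fin 3, ∃ p, bbcNbr p 0 = bbcBasis 0 x ∧ bbcNbr p c.succ = bbcBasis c.succ k ∧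
        bbcNbr p (c + 1).succ = bbcBasis (c + 1).succ (k + x) ∧
        bbcNbr p (c + 2).succ = bbcBasis (c + 2).succ (k - x) := by decide
    obtain ⟨p, h0, h1, h2, h3⟩ := key c k x
    rw [← h0, ← h1, ← h2, ← h3]
    have h4 : ∀ f : Fin 4 → A, ∑ k, f k = f c.succ + (f 0 + f (c + 1).succ + f (c + 2).succ) := by
      intro f
      rw [Fin.sum_univ_four]
      fin_cases c
      · change _ = f 1 + (f 0 + f 2 + f 3)
        abel
      · change _ = f 2 + (f 0 + f 3 + f 1)
        abel
      · change _ = f 3 + (f 0 + f 1 + f 2)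
        abel
    have h5 := hT p c.succ
    rw [h4, mul_add, hid] at h5
    exact add_left_cancel h5
  obtain ⟨u, hz, hM⟩ := exists_plane_units (z := fun k => P (bbcBasis 0 k))
    (M := fun c k => P (bbcBasis c.succ k)) (fun _ => hsa _) (fun _ _ => hsa _) (hb 0)
    (fun c => hb _) (hbasis 0) (fun c => hbasis _) hpt
  have hline : ∀ n k, P (bbcBasis n k) = u.map (rankOneProj (bbc21 (bbcBasis n k))) := by
    intro n k
    induction n using Fin.cases with
    | zero =>
      rw [rankOneProj_bbc21_standard, GradedMatrixUnits.map, hz]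
      rw [Finset.sum_eq_single k, Finset.sum_eq_single k]
      · simp
      · intro b _ hb
        simp [Matrix.single_apply_of_ne, hb.symm]
      · simp
      · intro a _ ha
        refine Finset.sum_eq_zero fun b _ => ?_
        simp [Matrix.single_apply_of_ne, ha.symm]
      · simp
    | succ c => rw [rankOneProj_bbc21_line, hM]
  have hcover : ∀ k : Fin 21, (∃ n a, k = bbcBasis n a) ∨ ∃ p, k = bbcPoint p := by decide
  have hnbr : ∀ p m, ∃ n a, bbcNbr p m = bbcBasis n a := by decide
  refine ⟨u, fun k => ?_⟩
  rcases hcover k with ⟨n, a, rfl⟩ | ⟨p, rfl⟩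
  · exact hline n a
  · have h1 : ∀ m, P (bbcNbr p m) = u.map (rankOneProj (bbc21 (bbcNbr p m))) := by
      intro m
      obtain ⟨n, a, h⟩ := hnbr p m
      rw [h, hline]
    rw [hpoint, rankOneProj_bbc21_point, sub_eq_add_neg, sub_eq_add_neg, ← neg_smul, ← neg_smul,
      show (-(1 / 2) : ℂ) = ((-(1 / 2) : ℝ) : ℂ) by norm_num, u.map_add, u.map_one, u.map_smul,
      u.map_sum]
    simp only [h1]

end CFR


/-! ### Averaging over the slots of an amplification -/

namespace CFR

open scoped Matrix.Norms.L2Operator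

variable {D d m₁ m₂ : ℕ}

lemma amplify_conjTranspose (A : Matrix (Fin d) (Fin d) ℂ) :
    (amplify m₁ m₂ A)ᴴ = amplify m₁ m₂ Aᴴ := by
  have h : (A.map star)ᴴ = Aᴴ.map star := by ext; simp
  rw [amplify, amplify, Matrix.fromBlocks_conjTranspose, Matrix.conjTranspose_kronecker,
    Matrix.conjTranspose_kronecker, Matrix.conjTranspose_one, Matrix.conjTranspose_one,
    Matrix.conjTranspose_zero, Matrix.conjTranspose_zero, h]

/-- On the vectors `φ` of one of the two summands of the multiplicity space, an amplification acts
through its matrix entries (first summand) or their conjugates (second summand). -/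
lemma amplify_mulVec_slot {φ : Fin m₁ ⊕ Fin m₂ → ℂ} {χ : ℂ →+* ℂ}
    (hχ : ∀ z : ℂ, ((z.re : ℂ) • 1 + ((z.im : ℂ) * Complex.I) • signature m₁ m₂) *ᵥ φ = χ z • φ)
    (A : Matrix (Fin d) (Fin d) ℂ) (c : Fin d) :
    amplify m₁ m₂ A *ᵥ ((slotMatrix m₁ m₂ c)ᴴ *ᵥ φ) =
      ∑ b, χ (A b c) • ((slotMatrix m₁ m₂ b)ᴴ *ᵥ φ) := by
  rw [amplify_eq_sum, Matrix.sum_mulVec]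
  refine Finset.sum_congr rfl fun b _ => ?_
  rw [Matrix.sum_mulVec, Finset.sum_eq_single c]
  · rw [Matrix.mulVec_mulVec, Matrix.mul_assoc, slotMatrix_mul_conjTranspose, if_pos rfl,
      Matrix.mul_one, ← Matrix.mulVec_mulVec, hχ, Matrix.mulVec_smul]
  · intro a _ hac
    rw [Matrix.mulVec_mulVec, Matrix.mul_assoc, slotMatrix_mul_conjTranspose, if_neg hac]
    simp
  · simp

lemma sum_dotProduct_amplify_eq_zero {φ : Fin m₁ ⊕ Fin m₂ → ℂ} {χ : ℂ →+* ℂ}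
    (hχ : ∀ z : ℂ, ((z.re : ℂ) • 1 + ((z.im : ℂ) * Complex.I) • signature m₁ m₂) *ᵥ φ = χ z • φ)
    (hχs : ∀ z, star (χ z) = χ (star z)) {A B : Matrix (Fin d) (Fin d) ℂ} (h : B * A = 0)
    (Z : Matrix ((Fin d × Fin m₁) ⊕ (Fin d × Fin m₂)) ((Fin d × Fin m₁) ⊕ (Fin d × Fin m₂)) ℂ) :
    ∑ a, star ((slotMatrix m₁ m₂ a)ᴴ *ᵥ φ) ⬝ᵥ
      ((amplify m₁ m₂ A * Z * amplify m₁ m₂ B) *ᵥ ((slotMatrix m₁ m₂ a)ᴴ *ᵥ φ)) = 0 := by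
  have h1 : ∀ a, star ((slotMatrix m₁ m₂ a)ᴴ *ᵥ φ) ⬝ᵥ
      ((amplify m₁ m₂ A * Z * amplify m₁ m₂ B) *ᵥ ((slotMatrix m₁ m₂ a)ᴴ *ᵥ φ)) =
      ∑ c, ∑ b, (χ (A a b) * χ (B c a)) *
        (star ((slotMatrix m₁ m₂ b)ᴴ *ᵥ φ) ⬝ᵥ (Z *ᵥ ((slotMatrix m₁ m₂ c)ᴴ *ᵥ φ))) := by
    intro a
    have h2 : star ((slotMatrix m₁ m₂ a)ᴴ *ᵥ φ) ᵥ* amplify m₁ m₂ A =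
        ∑ b, χ (A a b) • star ((slotMatrix m₁ m₂ b)ᴴ *ᵥ φ) := by
      have h3 := congrArg star (amplify_mulVec_slot hχ Aᴴ a)
      rw [Matrix.star_mulVec, amplify_conjTranspose, Matrix.conjTranspose_conjTranspose] at h3
      rw [h3, star_sum]
      refine Finset.sum_congr rfl fun b _ => ?_
      rw [star_smul, hχs, Matrix.conjTranspose_apply, star_star]
    rw [← Matrix.mulVec_mulVec, ← Matrix.mulVec_mulVec, Matrix.dotProduct_mulVec, h2,
      amplify_mulVec_slot hχ, Matrix.mulVec_sum, dotProduct_sum]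
    refine Finset.sum_congr rfl fun c _ => ?_
    rw [sum_dotProduct]
    refine Finset.sum_congr rfl fun b _ => ?_
    rw [Matrix.mulVec_smul, smul_dotProduct, dotProduct_smul, smul_eq_mul, smul_eq_mul]
    ring
  simp only [h1]
  rw [Finset.sum_comm]
  refine Finset.sum_eq_zero fun c _ => ?_
  rw [Finset.sum_comm]
  refine Finset.sum_eq_zero fun b _ => ?_
  rw [← Finset.sum_mul]
  have h2 : ∑ a, χ (A a b) * χ (B c a) = 0 := by
    have h3 := congrArg χ (congrFun (congrFun h c) b)
    rw [Matrix.mul_apply, map_sum, Matrix.zero_apply, map_zero] at h3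
    rw [← h3]
    exact Finset.sum_congr rfl fun a _ => by rw [map_mul, mul_comm]
  rw [h2, zero_mul]

/-- If the positive operator `∑ Rᴴ R` is bounded by first-order terms `A Z B`, where `A` and
`B` are near amplifications of matrices with `B A = 0`, then averaging over the slots of the
amplification turns these terms into second-order ones. -/
theorem norm_sq_le_of_first_order
    {V : Matrix (Fin D) ((Fin d × Fin m₁) ⊕ (Fin d × Fin m₂)) ℂ} (hV : Vᴴ * V = 1)
    (hV' : V * Vᴴ = 1) {ρ τ : Type*} [Fintype ρ] [Fintype τ]
    {R : ρ → Matrix (Fin D) (Fin D) ℂ} {A Z B : τ → Matrix (Fin D) (Fin D) ℂ}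
    {a b : τ → Matrix (Fin d) (Fin d) ℂ} (hab : ∀ t, b t * a t = 0)
    (ha : ∀ t i j, ‖a t i j‖ ≤ 1) {θ δ c : ℝ} (hθ : 0 ≤ θ) (hδ : 0 ≤ δ) (hc : 0 ≤ c)
    (hA : ∀ t, ‖V * amplify m₁ m₂ (a t) * Vᴴ - A t‖ ≤ θ)
    (hB : ∀ t, ‖V * amplify m₁ m₂ (b t) * Vᴴ - B t‖ ≤ θ)
    (hB1 : ∀ t, ‖B t‖ ≤ 1) (hZ : ∀ t, ‖Z t‖ ≤ δ)
    (h : ∀ ψ, IsState ψ → ∑ r, expect ((R r)ᴴ * R r) ψ ≤ ∑ t, expect (A t * Z t * B t) ψ + c)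
    (r : ρ) :
    ‖R r‖ ^ 2 ≤ 4 * d ^ 2 * (d * (c + Fintype.card τ * ((1 + 2 * d ^ 2) * (θ * δ)))) := by
  set β : ℝ := d * (c + Fintype.card τ * ((1 + 2 * d ^ 2) * (θ * δ))) with hβ
  have hβ0 : 0 ≤ β := by positivity
  have hV1 : ‖V‖ ≤ 1 := norm_le_one_of_isometry hV
  have hVs1 : ‖Vᴴ‖ ≤ 1 := by rwa [Matrix.l2_opNorm_conjTranspose]
  -- a vector of one summand of the multiplicity space, placed in any of the slots
  have key : ∀ (φ : Fin m₁ ⊕ Fin m₂ → ℂ) (χ : ℂ →+* ℂ),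
      (∀ z : ℂ, ((z.re : ℂ) • 1 + ((z.im : ℂ) * Complex.I) • signature m₁ m₂) *ᵥ φ = χ z • φ) →
      (∀ z, star (χ z) = χ (star z)) → star φ ⬝ᵥ φ = 1 → ∀ s : Fin d,
      ‖(WithLp.toLp 2 (R r *ᵥ (V *ᵥ ((slotMatrix m₁ m₂ s)ᴴ *ᵥ φ))) : EuclideanSpace ℂ (Fin D))‖ ≤
        √β := by
    intro φ χ hχ hχs hφ s
    have hst : ∀ s : Fin d, IsState (V *ᵥ ((slotMatrix m₁ m₂ s)ᴴ *ᵥ φ)) := by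
      intro s
      rw [IsState, Matrix.star_mulVec, ← Matrix.dotProduct_mulVec, Matrix.mulVec_mulVec, hV,
        Matrix.one_mulVec, Matrix.star_mulVec, ← Matrix.dotProduct_mulVec, Matrix.mulVec_mulVec,
        Matrix.conjTranspose_conjTranspose, slotMatrix_mul_conjTranspose, if_pos rfl,
        Matrix.one_mulVec, hφ]
    have hterm : ∀ t, ∑ s : Fin d, expect (A t * Z t * B t) (V *ᵥ ((slotMatrix m₁ m₂ s)ᴴ *ᵥ φ)) ≤
        d * ((1 + 2 * d ^ 2) * (θ * δ)) := by
      intro t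
      obtain ⟨A', hA'⟩ : ∃ A', A' = V * amplify m₁ m₂ (a t) * Vᴴ := ⟨_, rfl⟩
      obtain ⟨B', hB'⟩ : ∃ B', B' = V * amplify m₁ m₂ (b t) * Vᴴ := ⟨_, rfl⟩
      have h0 : A t * Z t * B t = A' * Z t * B' + ((A t - A') * Z t * B t + A' * Z t * (B t - B')) := by
        noncomm_ring
      -- with the exact amplifications in place of `A t`, `B t` the average over the slots vanishes
      have h1 : ∑ s : Fin d, expect (A' * Z t * B') (V *ᵥ ((slotMatrix m₁ m₂ s)ᴴ *ᵥ φ)) = 0 := by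
        have h2 := sum_dotProduct_amplify_eq_zero hχ hχs (hab t) (Vᴴ * Z t * V)
        simp only [expect]
        rw [← Complex.re_sum, ← Complex.zero_re, ← h2]
        congr 1
        refine Finset.sum_congr rfl fun s _ => ?_
        generalize (slotMatrix m₁ m₂ s)ᴴ *ᵥ φ = e
        rw [Matrix.star_mulVec, ← Matrix.dotProduct_mulVec, Matrix.mulVec_mulVec,
          Matrix.mulVec_mulVec]
        congr 2
        rw [hA', hB']
        calc Vᴴ * (V * amplify m₁ m₂ (a t) * Vᴴ * Z t * (V * amplify m₁ m₂ (b t) * Vᴴ)) * V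
            = (Vᴴ * V) * amplify m₁ m₂ (a t) * (Vᴴ * Z t * V) * amplify m₁ m₂ (b t) * (Vᴴ * V) := by
              simp only [Matrix.mul_assoc]
          _ = _ := by rw [hV, Matrix.one_mul, Matrix.mul_one]
      have hA'1 : ‖A'‖ ≤ 2 * d ^ 2 := by
        rw [hA']
        exact (norm_mul_le_of_le' (norm_mul_le_of_le' hV1 (norm_amplify_le m₁ m₂ (ha t))) hVs1).trans
          (by linarith)
      have hAd : ‖A t - A'‖ ≤ θ := by rw [norm_sub_rev, hA']; exact hA t
      have hBd : ‖B t - B'‖ ≤ θ := by rw [norm_sub_rev, hB']; exact hB t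
      have h3 : ‖(A t - A') * Z t * B t + A' * Z t * (B t - B')‖ ≤ (1 + 2 * d ^ 2) * (θ * δ) := by
        have e1 := norm_mul_le_of_le' (norm_mul_le_of_le' hAd (hZ t)) (hB1 t)
        have e2 := norm_mul_le_of_le' (norm_mul_le_of_le' hA'1 (hZ t)) hBd
        refine (norm_add_le _ _).trans ((add_le_add e1 e2).trans (le_of_eq ?_))
        ring
      rw [h0]
      simp only [expect_add _ ((A t - A') * Z t * B t + A' * Z t * (B t - B'))]
      rw [Finset.sum_add_distrib, h1, zero_add]
      calc _ ≤ ∑ s : Fin d, (1 + 2 * d ^ 2) * (θ * δ) := by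
            refine Finset.sum_le_sum fun s _ => ?_
            exact (le_abs_self _).trans ((abs_expect_le_norm _ (hst s)).trans h3)
        _ = _ := by simp
    have h1 : ∑ s : Fin d, ∑ r, expect ((R r)ᴴ * R r) (V *ᵥ ((slotMatrix m₁ m₂ s)ᴴ *ᵥ φ)) ≤ β := by
      calc _ ≤ ∑ s : Fin d, (∑ t, expect (A t * Z t * B t) (V *ᵥ ((slotMatrix m₁ m₂ s)ᴴ *ᵥ φ)) + c) :=
            Finset.sum_le_sum fun s _ => h _ (hst s)
        _ = ∑ t, ∑ s : Fin d, expect (A t * Z t * B t) (V *ᵥ ((slotMatrix m₁ m₂ s)ᴴ *ᵥ φ)) + d * c := by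
            rw [Finset.sum_add_distrib, Finset.sum_comm]; simp
        _ ≤ ∑ t : τ, (d * ((1 + 2 * d ^ 2) * (θ * δ)) : ℝ) + d * c := by
            gcongr with t _
            exact hterm t
        _ = β := by
            rw [hβ, Finset.sum_const, Finset.card_univ, nsmul_eq_mul]
            ring
    have h2 : expect ((R r)ᴴ * R r) (V *ᵥ ((slotMatrix m₁ m₂ s)ᴴ *ᵥ φ)) ≤ β := by
      have h3 : ∀ s : Fin d, 0 ≤ ∑ r, expect ((R r)ᴴ * R r) (V *ᵥ ((slotMatrix m₁ m₂ s)ᴴ *ᵥ φ)) :=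
        fun s => Finset.sum_nonneg fun r _ => expect_conjTranspose_mul_self_nonneg _ _
      exact (Finset.single_le_sum (f := fun r => expect ((R r)ᴴ * R r) _)
        (fun r _ => expect_conjTranspose_mul_self_nonneg _ _) (Finset.mem_univ r)).trans
        ((Finset.single_le_sum (fun s _ => h3 s) (Finset.mem_univ s)).trans h1)
    rw [expect_conjTranspose_mul_self] at h2
    exact Real.le_sqrt_of_sq_le h2
  -- the same without normalization
  have key' : ∀ (φ : Fin m₁ ⊕ Fin m₂ → ℂ) (χ : ℂ →+* ℂ),
      (∀ z : ℂ, ((z.re : ℂ) • 1 + ((z.im : ℂ) * Complex.I) • signature m₁ m₂) *ᵥ φ = χ z • φ) →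
      (∀ z, star (χ z) = χ (star z)) → ∀ s : Fin d,
      ‖(WithLp.toLp 2 (R r *ᵥ (V *ᵥ ((slotMatrix m₁ m₂ s)ᴴ *ᵥ φ))) : EuclideanSpace ℂ (Fin D))‖ ≤
        √β * ‖(WithLp.toLp 2 φ : EuclideanSpace ℂ (Fin m₁ ⊕ Fin m₂))‖ := by
    intro φ χ hχ hχs s
    set n := ‖(WithLp.toLp 2 φ : EuclideanSpace ℂ (Fin m₁ ⊕ Fin m₂))‖ with hn
    rcases eq_or_ne n 0 with h0 | h0
    · have hφ : φ = 0 := by simpa using norm_eq_zero.1 (hn.symm.trans h0)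
      simp [hφ, h0]
    · have hφ : φ = (n : ℂ) • ((n⁻¹ : ℝ) : ℂ) • φ := by
        rw [smul_smul, ← Complex.ofReal_mul, mul_inv_cancel₀ h0, Complex.ofReal_one, one_smul]
      have h1 := key (((n⁻¹ : ℝ) : ℂ) • φ) χ
        (fun z => by rw [Matrix.mulVec_smul, hχ, smul_comm]) hχs
        (by
          rw [star_smul, smul_dotProduct, dotProduct_smul, smul_eq_mul, smul_eq_mul]
          have h2 : star φ ⬝ᵥ φ = ((n ^ 2 : ℝ) : ℂ) := by
            rw [← inner_toLp, inner_self_eq_norm_sq_to_K, ← hn]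
            norm_cast
          rw [h2, Complex.star_def, Complex.conj_ofReal, ← Complex.ofReal_mul, ← Complex.ofReal_mul]
          norm_cast
          field_simp) s
      rw [hφ]
      simp only [Matrix.mulVec_smul _ (n : ℂ), WithLp.toLp_smul, norm_smul (n : ℂ)]
      rw [Complex.norm_real, Real.norm_of_nonneg (norm_nonneg _), mul_comm]
      exact mul_le_mul_of_nonneg_right h1 (norm_nonneg _)
  have hJ : signature m₁ m₂ * signature m₁ m₂ = 1 := by
    rw [signature, Matrix.diagonal_mul_diagonal, ← Matrix.diagonal_one]
    congr 1
    ext i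
    rcases i with i | i <;> simp
  -- each vector is a sum over the `d` slots and the two summands, whence the factor `2 d`
  have hfinal : ‖R r‖ ≤ 2 * d * √β := by
    refine norm_le_of_mulVec _ (by positivity) fun ψ => ?_
    have hψ : ψ = ∑ s : Fin d, V *ᵥ ((slotMatrix m₁ m₂ s)ᴴ *ᵥ (slotMatrix m₁ m₂ s *ᵥ (Vᴴ *ᵥ ψ))) := by
      rw [← Matrix.mulVec_sum]
      simp only [Matrix.mulVec_mulVec (Vᴴ *ᵥ ψ)]
      rw [← Matrix.sum_mulVec, sum_conjTranspose_mul_slotMatrix, Matrix.one_mulVec,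
        Matrix.mulVec_mulVec, hV', Matrix.one_mulVec]
    set N := ‖(WithLp.toLp 2 ψ : EuclideanSpace ℂ (Fin D))‖ with hN
    have hs : ∀ s : Fin d, ‖(WithLp.toLp 2 (R r *ᵥ (V *ᵥ ((slotMatrix m₁ m₂ s)ᴴ *ᵥ
        (slotMatrix m₁ m₂ s *ᵥ (Vᴴ *ᵥ ψ))))) : EuclideanSpace ℂ (Fin D))‖ ≤ 2 * √β * N := by
      intro s
      obtain ⟨φ, hφ⟩ : ∃ φ, φ = slotMatrix m₁ m₂ s *ᵥ (Vᴴ *ᵥ ψ) := ⟨_, rfl⟩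
      rw [← hφ]
      have hφN : ‖(WithLp.toLp 2 φ : EuclideanSpace ℂ (Fin m₁ ⊕ Fin m₂))‖ ≤ N := by
        rw [hφ, Matrix.mulVec_mulVec]
        refine (norm_toLp_mulVec_le _ _).trans ?_
        have h1 := norm_mul_le_of_le' (norm_slotMatrix_le (m₁ := m₁) (m₂ := m₂) s) hVs1
        rw [one_mul] at h1
        exact mul_le_of_le_one_left (norm_nonneg _) h1
      have hJφ : ‖(WithLp.toLp 2 (signature m₁ m₂ *ᵥ φ) : EuclideanSpace ℂ (Fin m₁ ⊕ Fin m₂))‖ ≤ N :=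
        (norm_toLp_mulVec_le _ _).trans
          ((mul_le_of_le_one_left (norm_nonneg _) (norm_signature_le _ _)).trans hφN)
      have hJJ : signature m₁ m₂ *ᵥ (signature m₁ m₂ *ᵥ φ) = φ := by
        rw [Matrix.mulVec_mulVec, hJ, Matrix.one_mulVec]
      have hp : ‖(WithLp.toLp 2 ((1 / 2 : ℂ) • (φ + signature m₁ m₂ *ᵥ φ)) :
          EuclideanSpace ℂ (Fin m₁ ⊕ Fin m₂))‖ ≤ N := by
        rw [WithLp.toLp_smul, WithLp.toLp_add, norm_smul]
        have := norm_add_le (WithLp.toLp 2 φ : EuclideanSpace ℂ (Fin m₁ ⊕ Fin m₂))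
          (WithLp.toLp 2 (signature m₁ m₂ *ᵥ φ))
        norm_num
        linarith
      have hm : ‖(WithLp.toLp 2 ((1 / 2 : ℂ) • (φ - signature m₁ m₂ *ᵥ φ)) :
          EuclideanSpace ℂ (Fin m₁ ⊕ Fin m₂))‖ ≤ N := by
        rw [WithLp.toLp_smul, WithLp.toLp_sub, norm_smul]
        have := norm_sub_le (WithLp.toLp 2 φ : EuclideanSpace ℂ (Fin m₁ ⊕ Fin m₂))
          (WithLp.toLp 2 (signature m₁ m₂ *ᵥ φ))
        norm_num
        linarith
      have k1 := key' ((1 / 2 : ℂ) • (φ + signature m₁ m₂ *ᵥ φ)) (RingHom.id ℂ)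
        (fun z => by
          rw [Matrix.mulVec_smul, Matrix.add_mulVec, Matrix.smul_mulVec, Matrix.smul_mulVec,
            Matrix.one_mulVec, Matrix.mulVec_add, hJJ, RingHom.id_apply]
          conv_rhs => rw [← Complex.re_add_im z]
          module) (fun z => rfl) s
      have k2 := key' ((1 / 2 : ℂ) • (φ - signature m₁ m₂ *ᵥ φ)) (starRingEnd ℂ)
        (fun z => by
          have hz : (starRingEnd ℂ) z = (z.re : ℂ) - z.im * Complex.I := by
            apply Complex.ext <;> simp
          rw [Matrix.mulVec_smul, Matrix.add_mulVec, Matrix.smul_mulVec, Matrix.smul_mulVec,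
            Matrix.one_mulVec, Matrix.mulVec_sub, hJJ, hz]
          module) (fun z => rfl) s
      have hsplit : φ = (1 / 2 : ℂ) • (φ + signature m₁ m₂ *ᵥ φ) +
          (1 / 2 : ℂ) • (φ - signature m₁ m₂ *ᵥ φ) := by module
      rw [hsplit, Matrix.mulVec_add, Matrix.mulVec_add, Matrix.mulVec_add, WithLp.toLp_add]
      refine (norm_add_le _ _).trans ?_
      have k3 := mul_le_mul_of_nonneg_left hp (Real.sqrt_nonneg β)
      have k4 := mul_le_mul_of_nonneg_left hm (Real.sqrt_nonneg β)
      linarith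
    rw [hψ, Matrix.mulVec_sum, WithLp.toLp_sum]
    refine (norm_sum_le _ _).trans ((Finset.sum_le_sum fun s _ => hs s).trans (le_of_eq ?_))
    rw [Finset.sum_const, Finset.card_univ, Fintype.card_fin, nsmul_eq_mul]
    ring
  calc ‖R r‖ ^ 2 ≤ (2 * d * √β) ^ 2 := by gcongr
    _ = 4 * d ^ 2 * β := by
      rw [mul_pow, mul_pow, Real.sq_sqrt hβ0]
      ring

end CFR


/-! ### Estimates for nearly orthogonal projections -/

namespace CFR

open scoped Matrix.Norms.L2Operator

variable {D : ℕ}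

lemma expect_conjTranspose (A : Matrix (Fin D) (Fin D) ℂ) (ψ : Fin D → ℂ) :
    expect Aᴴ ψ = expect A ψ := by
  rw [expect, expect, Matrix.dotProduct_mulVec, ← Matrix.star_mulVec, Matrix.star_dotProduct,
    Complex.star_def, Complex.conj_re]

section Projections

variable {p P Q : Matrix (Fin D) (Fin D) ℂ}

lemma conjTranspose_of_isStarProjection (hp : IsStarProjection p) : pᴴ = p :=
  hp.isSelfAdjoint.star_eq

lemma norm_le_one_of_isStarProjection (hp : IsStarProjection p) : ‖p‖ ≤ 1 := by
  have h := Matrix.l2_opNorm_conjTranspose_mul_self p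
  rw [conjTranspose_of_isStarProjection hp, hp.isIdempotentElem.eq] at h
  nlinarith [norm_nonneg p]

lemma norm_mul_comm_of_isStarProjection (hP : IsStarProjection P) (hQ : IsStarProjection Q) :
    ‖P * Q‖ = ‖Q * P‖ := by
  rw [← Matrix.l2_opNorm_conjTranspose, Matrix.conjTranspose_mul,
    conjTranspose_of_isStarProjection hP, conjTranspose_of_isStarProjection hQ]

/-- The overlap condition of a realization says that adjacent projections are `√ε`-nearly
orthogonal. -/
lemma norm_mul_le_of_expect (hP : IsStarProjection P) (hQ : IsStarProjection Q) {ε : ℝ} (hε : 0 ≤ ε)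
    (h : ∀ ψ, IsState ψ → expect (P * Q * P) ψ ≤ ε) : ‖Q * P‖ ≤ √ε := by
  refine Real.le_sqrt_of_sq_le (norm_sq_le_of_expect _ hε fun ψ hψ => ?_)
  rw [Matrix.conjTranspose_mul, conjTranspose_of_isStarProjection hP,
    conjTranspose_of_isStarProjection hQ]
  have : P * Q * (Q * P) = P * Q * P := by
    rw [Matrix.mul_assoc, ← Matrix.mul_assoc Q, hQ.isIdempotentElem.eq, ← Matrix.mul_assoc]
  rw [this]
  exact h ψ hψ

/-- A Hermitian matrix with expectation value `1` in each state is the identity. -/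
lemma eq_one_of_expect {A : Matrix (Fin D) (Fin D) ℂ} (hA : A.IsHermitian)
    (h : ∀ ψ, IsState ψ → expect A ψ = 1) : A = 1 := by
  have h1 : ‖A - 1‖ ≤ 0 := norm_le_of_abs_expect (hA.sub Matrix.isHermitian_one) le_rfl
    fun ψ hψ => by rw [expect_sub, h ψ hψ, expect_one hψ, sub_self, abs_zero]
  exact sub_eq_zero.1 (norm_le_zero_iff.1 h1)

end Projections

/-- A Hermitian matrix `T` with `T ^ 2 ≤ T + s` satisfies `T ≤ 1 + s`. -/
lemma expect_le_of_sq_le {T : Matrix (Fin D) (Fin D) ℂ} (hT : Tᴴ = T) {s : ℝ} (hs : 0 ≤ s)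
    {ψ : Fin D → ℂ} (hψ : IsState ψ) (h : expect (T * T) ψ ≤ expect T ψ + s) :
    expect T ψ ≤ 1 + s := by
  -- Cauchy-Schwarz
  have h1 : expect T ψ ^ 2 ≤ expect (T * T) ψ := by
    have h2 := abs_dotProduct_mulVec_le (1 : Matrix (Fin D) (Fin D) ℂ) ψ (T *ᵥ ψ)
    rw [Matrix.one_mulVec, isState_iff_norm.1 hψ, mul_one] at h2
    have h3 : |expect T ψ| ≤ ‖(WithLp.toLp 2 (T *ᵥ ψ) : EuclideanSpace ℂ (Fin D))‖ :=
      (Complex.abs_re_le_norm _).trans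
        (h2.trans (mul_le_of_le_one_left (norm_nonneg _) norm_one_le))
    have h4 := expect_conjTranspose_mul_self T ψ
    rw [hT] at h4
    rw [h4, ← sq_abs]
    gcongr
  nlinarith

section Cliques

variable {n N d : ℕ} {P : Fin n → Matrix (Fin D) (Fin D) ℂ} {δ : ℝ}

lemma sum_mul_sum_self (f : Fin d → Matrix (Fin D) (Fin D) ℂ) (hf : ∀ a, IsStarProjection (f a)) :
    (∑ a, f a) * (∑ a, f a) = ∑ a, f a + ∑ a, ∑ b, if a ≠ b then f a * f b else 0 := by
  rw [Finset.sum_mul_sum, ← Finset.sum_add_distrib]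
  refine Finset.sum_congr rfl fun a _ => ?_
  rw [← Finset.add_sum_erase _ _ (Finset.mem_univ a), (hf a).isIdempotentElem.eq,
    ← Finset.add_sum_erase (a := a) _ (fun b => if a ≠ b then f a * f b else 0) (Finset.mem_univ a)]
  simp only [ne_eq, not_true_eq_false, if_false, zero_add]
  congr 1
  refine Finset.sum_congr rfl fun b hb => ?_
  rw [if_pos (Finset.ne_of_mem_erase hb).symm]

lemma abs_expect_offDiag_le {f : Fin d → Matrix (Fin D) (Fin D) ℂ} (hδ : 0 ≤ δ)
    (h : ∀ a b, a ≠ b → ‖f a * f b‖ ≤ δ) {ψ : Fin D → ℂ} (hψ : IsState ψ) :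
    |expect (∑ a, ∑ b, if a ≠ b then f a * f b else 0) ψ| ≤ d ^ 2 * δ := by
  refine (abs_expect_le_norm _ hψ).trans ?_
  calc _ ≤ ∑ a : Fin d, ∑ b : Fin d, δ := by
        refine norm_sum_le_of_le _ fun a _ => norm_sum_le_of_le _ fun b _ => ?_
        split_ifs with hab
        · exact h a b hab
        · rw [norm_zero]; exact hδ
    _ = _ := by simp; ring

lemma expect_clique_le {f : Fin d → Matrix (Fin D) (Fin D) ℂ} (hf : ∀ a, IsStarProjection (f a))
    (hδ : 0 ≤ δ) (h : ∀ a b, a ≠ b → ‖f a * f b‖ ≤ δ) {ψ : Fin D → ℂ} (hψ : IsState ψ) :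
    expect (∑ a, f a) ψ ≤ 1 + d ^ 2 * δ := by
  refine expect_le_of_sq_le ?_ (by positivity) hψ ?_
  · rw [Matrix.conjTranspose_sum]
    exact Finset.sum_congr rfl fun a _ => conjTranspose_of_isStarProjection (hf a)
  · rw [sum_mul_sum_self f hf, expect_add]
    have := (abs_le.1 (abs_expect_offDiag_le hδ h hψ)).2
    linarith

/-- If nearly orthogonal bases almost reach the largest value that the sum of their projections may
have, then each of them sums to `1`, up to `O(δ)`. -/
lemma norm_clique_sub_one_le (hP : ∀ i, IsStarProjection (P i)) (basis : Fin N → Fin d → Fin n)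
    (hδ : 0 ≤ δ) (h : ∀ m a b, a ≠ b → ‖P (basis m a) * P (basis m b)‖ ≤ δ) {r : ℝ} (hr : 0 ≤ r)
    (hsum : ∀ ψ, IsState ψ → N - r * δ ≤ ∑ m, expect (∑ a, P (basis m a)) ψ) (m : Fin N) :
    ‖∑ a, P (basis m a) - 1‖ ≤ (r + N * d ^ 2) * δ := by
  have hN : (1 : ℝ) ≤ N := by exact_mod_cast m.pos
  have hherm : (∑ a, P (basis m a))ᴴ = ∑ a, P (basis m a) := by
    rw [Matrix.conjTranspose_sum]
    exact Finset.sum_congr rfl fun a _ => conjTranspose_of_isStarProjection (hP _)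
  refine norm_le_of_abs_expect (Matrix.IsHermitian.sub hherm Matrix.isHermitian_one)
    (by positivity) fun ψ hψ => ?_
  have h1 : ∀ m, expect (∑ a, P (basis m a)) ψ ≤ 1 + d ^ 2 * δ := fun m =>
    expect_clique_le (fun a => hP _) hδ (h m) hψ
  have h2 := hsum ψ hψ
  rw [← Finset.add_sum_erase _ _ (Finset.mem_univ m)] at h2
  -- the other bases cannot exceed `1` by much, so that this one cannot fall short of `1` by much
  have h3 : ∑ k ∈ Finset.univ.erase m, expect (∑ a, P (basis k a)) ψ ≤
      ∑ k ∈ Finset.univ.erase m, (1 + d ^ 2 * δ : ℝ) := Finset.sum_le_sum fun k _ => h1 k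
  rw [Finset.sum_const, Finset.card_erase_of_mem (Finset.mem_univ m), Finset.card_univ,
    Fintype.card_fin, nsmul_eq_mul, Nat.cast_sub m.pos, Nat.cast_one] at h3
  have h4 : 0 ≤ (d : ℝ) ^ 2 * δ := by positivity
  rw [expect_sub, expect_one hψ, abs_le]
  constructor
  · nlinarith
  · have := h1 m
    nlinarith [mul_nonneg hr hδ]

end Cliques

section FirstOrder

/-- With `Y = 1 - t`, a sum of squares in terms of `Y ^ 2 - p` and of terms that contain `p t` or
`t p`. -/
lemma apex_identity {A : Type*} [Ring A] {p t : A} (hp : p * p = p) :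
    (1 - p) * (1 - t) * ((1 - t) * (1 - p)) + p * t * (t * p) =
      (1 - t) * (1 - t) - p + (p * t * p + p * t * p) + (p * t * (1 - p) + (1 - p) * t * p) +
        (p * t * ((1 - t) * (1 - p)) + (1 - p) * (1 - t) * t * p) := by
  simp only [mul_sub, sub_mul, mul_one, one_mul, mul_assoc, hp]
  abel

/-- For a projection `p` and `Y = 1 - t`, the operator `X = Y (1 - p)` is small if `p` is almost as
large as `Y ^ 2`, up to terms in which `p t` appears. -/
lemma expect_defect_le {p t : Matrix (Fin D) (Fin D) ℂ} (hp : IsStarProjection p) (ht : tᴴ = t)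
    (ψ : Fin D → ℂ) :
    expect (((1 - t) * (1 - p))ᴴ * ((1 - t) * (1 - p))) ψ ≤
      expect ((1 - t) * (1 - t) - p) ψ + 2 * expect (p * t * p) ψ +
        2 * expect (p * t * (1 - p)) ψ + 2 * expect (p * t * ((1 - t) * (1 - p))) ψ := by
  have hp1 := conjTranspose_of_isStarProjection hp
  have h0 := congrArg (fun A => expect A ψ) (apex_identity (t := t) hp.isIdempotentElem.eq)
  have e1 : expect ((1 - p) * t * p) ψ = expect (p * t * (1 - p)) ψ := by
    rw [← expect_conjTranspose]
    simp only [Matrix.conjTranspose_mul, Matrix.conjTranspose_sub, Matrix.conjTranspose_one, hp1, ht,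
      Matrix.mul_assoc]
  have e2 : expect ((1 - p) * (1 - t) * t * p) ψ = expect (p * t * ((1 - t) * (1 - p))) ψ := by
    rw [← expect_conjTranspose]
    simp only [Matrix.conjTranspose_mul, Matrix.conjTranspose_sub, Matrix.conjTranspose_one, hp1, ht,
      Matrix.mul_assoc]
  have e3 : 0 ≤ expect (p * t * (t * p)) ψ := by
    have := expect_conjTranspose_mul_self_nonneg (t * p) ψ
    rwa [Matrix.conjTranspose_mul, hp1, ht] at this
  have e4 : ((1 - t) * (1 - p))ᴴ = (1 - p) * (1 - t) := by
    simp only [Matrix.conjTranspose_mul, Matrix.conjTranspose_sub, Matrix.conjTranspose_one, hp1, ht]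
  simp only [expect_add _ _ ψ, e1, e2] at h0
  rw [e4]
  linarith

/-- The previous estimate for `t = κ ∑ L m`, where the `L m` are projections nearly orthogonal to
`p`. The remaining first-order terms are those of the form `p (p L m) (1 - p)`. -/
lemma expect_defect_le_of_orthogonal {l : ℕ} {p : Matrix (Fin D) (Fin D) ℂ}
    {L : Fin l → Matrix (Fin D) (Fin D) ℂ} (hp : IsStarProjection p)
    (hL : ∀ m, IsStarProjection (L m)) {κ δ : ℝ} (hκ : 0 ≤ κ)
    (h : ∀ m, ‖p * L m‖ ≤ δ) {X : Matrix (Fin D) (Fin D) ℂ}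
    (hX : X = (1 - κ • ∑ m, L m) * (1 - p)) {ψ : Fin D → ℂ} (hψ : IsState ψ) :
    expect (Xᴴ * X) ψ ≤ expect ((1 - κ • ∑ m, L m) * (1 - κ • ∑ m, L m) - p) ψ +
      ∑ m, expect (p * ((2 * κ) • (p * L m)) * (1 - p)) ψ + 2 * κ * l * δ * (δ + ‖X‖) := by
  have hp1 := conjTranspose_of_isStarProjection hp
  have ht : (κ • ∑ m, L m)ᴴ = κ • ∑ m, L m := by
    rw [Matrix.conjTranspose_smul, star_trivial, Matrix.conjTranspose_sum]
    congr 1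
    exact Finset.sum_congr rfl fun a _ => conjTranspose_of_isStarProjection (hL _)
  have h0 := expect_defect_le hp ht ψ
  rw [← hX] at h0
  have hpt : p * (κ • ∑ m, L m) = κ • ∑ m, p * L m := by
    rw [Matrix.mul_smul, Finset.mul_sum]
  have hn : ‖κ • ∑ m, p * L m‖ ≤ κ * (l * δ) := by
    rw [norm_smul, Real.norm_of_nonneg hκ]
    refine mul_le_mul_of_nonneg_left ?_ hκ
    calc _ ≤ ∑ m : Fin l, δ := norm_sum_le_of_le _ fun m _ => h m
      _ = _ := by simp
  have e1 : expect (p * (κ • ∑ m, L m) * p) ψ ≤ κ * (l * (δ * δ)) := by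
    rw [hpt, Matrix.smul_mul, expect_smul, Finset.sum_mul, expect_sum]
    refine mul_le_mul_of_nonneg_left ?_ hκ
    calc _ ≤ ∑ m : Fin l, δ * δ := by
          refine Finset.sum_le_sum fun m _ => ?_
          have h1 : p * L m * p = p * L m * (L m * p) := by
            rw [← Matrix.mul_assoc (p * L m), Matrix.mul_assoc p (L m) (L m),
              (hL m).isIdempotentElem.eq]
          rw [h1]
          refine (le_abs_self _).trans ((abs_expect_le_norm _ hψ).trans ?_)
          refine norm_mul_le_of_le' (h m) ?_
          rw [norm_mul_comm_of_isStarProjection (hL m) hp]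
          exact h m
      _ = _ := by simp
  have e2 : 2 * expect (p * (κ • ∑ m, L m) * (1 - p)) ψ =
      ∑ m, expect (p * ((2 * κ) • (p * L m)) * (1 - p)) ψ := by
    rw [hpt, Matrix.smul_mul, expect_smul, Finset.sum_mul, expect_sum, ← mul_assoc, Finset.mul_sum]
    refine Finset.sum_congr rfl fun m _ => ?_
    rw [Matrix.mul_smul, Matrix.smul_mul, expect_smul, ← Matrix.mul_assoc,
      hp.isIdempotentElem.eq]
  have e3 : expect (p * (κ • ∑ m, L m) * X) ψ ≤ κ * (l * δ) * ‖X‖ := by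
    rw [hpt]
    exact (le_abs_self _).trans ((abs_expect_le_norm _ hψ).trans (norm_mul_le_of_le' hn le_rfl))
  rw [e2] at h0
  linarith

end FirstOrder

end CFR


/-! ### Rigid systems of rays and their approximations -/

namespace CFR

open scoped Matrix.Norms.L2Operator

/-- A family of `n` projections on `ℂ^d`, together with relations that determine it up to
multiplicity: orthogonality relations, orthogonal bases, and the expression
`M (apex j) = 1 - κ ∑ m, M (nbr j m)` of some of the projections by others. That the relations
suffice is the field `rigid`: in every `*`-algebra, projections that satisfy them come from the family
`M` through a system of graded matrix units. -/
structure RigidSystem (n d : ℕ) where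
  /-- The number of bases. -/
  nBasis : ℕ
  /-- The number of projections that are expressed by others. -/
  nApex : ℕ
  /-- The number of projections in each of these expressions. -/
  nNbr : ℕ
  /-- The members of the bases. -/
  basis : Fin nBasis → Fin d → Fin n
  /-- The projections that are expressed by others. -/
  apex : Fin nApex → Fin n
  /-- The projections in these expressions. -/
  nbr : Fin nApex → Fin nNbr → Fin n
  /-- The coefficient in these expressions. -/
  κ : ℝ
  /-- The orthogonality relations. -/
  Orth : Fin n → Fin n → Prop
  /-- The ideal family. -/
  M : Fin n → Matrix (Fin d) (Fin d) ℂ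
  κ_nonneg : 0 ≤ κ
  orth_basis : ∀ m a b, a ≠ b → Orth (basis m a) (basis m b)
  orth_nbr : ∀ j m, Orth (apex j) (nbr j m)
  norm_M_le : ∀ k a b, ‖M k a b‖ ≤ 1
  M_mul_self : ∀ k, M k * M k = M k
  M_mul_basis : ∀ m a b, a ≠ b → M (basis m a) * M (basis m b) = 0
  rigid : ∀ {A : Type} [Ring A] [StarRing A] [Algebra ℂ A] [StarModule ℂ A] (P : Fin n → A),
    (∀ i, star (P i) = P i) → (∀ i, P i * P i = P i) → (∀ i j, Orth i j → P i * P j = 0) →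
    (∀ m, ∑ a, P (basis m a) = 1) →
    (∀ j, P (apex j) = 1 - (κ : ℂ) • ∑ m, P (nbr j m)) →
    ∃ u : GradedMatrixUnits d A, ∀ k, P k = u.map (M k)

namespace RigidSystem

variable {n d : ℕ} (S : RigidSystem n d)

/-- Projections on `ℂ^D` that satisfy the relations of a rigid system up to an error `η`. -/
structure Approx {D : ℕ} (η : ℝ) (P : Fin n → Matrix (Fin D) (Fin D) ℂ) : Prop where
  isProj : ∀ i, IsStarProjection (P i)
  orth : ∀ i j, S.Orth i j → ‖P i * P j‖ ≤ η
  basis : ∀ m, ‖∑ a, P (S.basis m a) - 1‖ ≤ η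
  apex : ∀ j, ‖P (S.apex j) - (1 - (S.κ : ℂ) • ∑ m, P (S.nbr j m))‖ ≤ η

/-- The projections `P` are within `θ`, in operator norm, of an amplification of the ideal family. -/
def IsNear {D : ℕ} (θ : ℝ) (P : Fin n → Matrix (Fin D) (Fin D) ℂ) : Prop :=
  ∃ m₁ m₂ : ℕ, m₁ + m₂ = D / d ∧
    ∃ V : Matrix (Fin D) ((Fin d × Fin m₁) ⊕ (Fin d × Fin m₂)) ℂ, Vᴴ * V = 1 ∧ V * Vᴴ = 1 ∧
      ∀ k, ‖V * amplify m₁ m₂ (S.M k) * Vᴴ - P k‖ ≤ θ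

/-- Projections that satisfy the relations up to a small error `η` are within `O(η)` of an
amplification of the ideal family, uniformly in the dimension. -/
theorem exists_isNear_of_approx [NeZero d] : ∃ C η₀ : ℝ, 0 < η₀ ∧ ∀ (D : ℕ) (η : ℝ)
    (P : Fin n → Matrix (Fin D) (Fin D) ℂ), 0 ≤ η → S.Approx η P → η ≤ η₀ → S.IsNear (C * η) P := by
  -- the index set of all approximate solutions, with their sizes and their errors
  let J : Type := {x : Σ D : ℕ, ℝ × (Fin n → Matrix (Fin D) (Fin D) ℂ) //
    0 ≤ x.2.1 ∧ S.Approx x.2.1 x.2.2}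
  let D : J → ℕ := fun x => x.1.1
  let f : J → ℝ := fun x => x.1.2.1
  let P : Fin n → ∀ x : J, Matrix (Fin (D x)) (Fin (D x)) ℂ := fun k x => x.1.2.2 k
  have hf : ∀ x, 0 ≤ f x := fun x => x.2.1
  have hf' : ∀ x, f x ≤ 1 * |f x| := fun x => by rw [one_mul]; exact le_abs_self _
  have hP : ∀ k, ∃ K : ℝ, ∀ x, ‖P k x‖ ≤ K := fun k =>
    ⟨1, fun x => norm_le_one_of_isStarProjection (x.2.2.isProj k)⟩
  obtain ⟨u, hu⟩ := S.rigid (A := AsymptoticAlgebra (fun x => Matrix (Fin (D x)) (Fin (D x)) ℂ) f)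
    (fun k => asymp f (P k) (hP k))
    (fun k => by
      rw [asymp_star]
      exact asymp_congr (funext fun x => (x.2.2.isProj k).isSelfAdjoint.star_eq))
    (fun k => by
      rw [asymp_mul]
      exact asymp_congr (funext fun x => (x.2.2.isProj k).isIdempotentElem.eq))
    (fun i j h => by
      rw [asymp_mul, asymp_zero, asymp_eq_asymp]
      refine ⟨1, fun x => ?_⟩
      rw [Pi.mul_apply, Pi.zero_apply, sub_zero]
      exact (x.2.2.orth i j h).trans (hf' x))
    (fun m => by
      rw [asymp_sum, asymp_one, asymp_eq_asymp]
      refine ⟨1, fun x => ?_⟩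
      rw [Finset.sum_apply, Pi.one_apply]
      exact (x.2.2.basis m).trans (hf' x))
    (fun j => by
      rw [asymp_sum, asymp_one, asymp_smul, asymp_sub, asymp_eq_asymp]
      refine ⟨1, fun x => ?_⟩
      rw [Pi.sub_apply, Pi.smul_apply, Finset.sum_apply, Pi.one_apply]
      exact (x.2.2.apex j).trans (hf' x))
  obtain ⟨C, η₀, hη₀, h⟩ := exists_amplification_near hf P hP S.M S.norm_M_le u hu
  exact ⟨C, η₀, hη₀, fun D η P h0 hA hη => h ⟨⟨D, η, P⟩, h0, hA⟩ hη⟩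

end RigidSystem

end CFR


/-! ### From small expectation values to small errors -/

namespace CFR

open scoped Matrix.Norms.L2Operator

lemma amplify_sub {d m₁ m₂ : ℕ} (A B : Matrix (Fin d) (Fin d) ℂ) :
    amplify m₁ m₂ (A - B) = amplify m₁ m₂ A - amplify m₁ m₂ B := by
  ext (i | i) (j | j) <;> simp [amplify, sub_mul]

lemma amplify_one {d m₁ m₂ : ℕ} : amplify m₁ m₂ (1 : Matrix (Fin d) (Fin d) ℂ) = 1 := by
  have h : (1 : Matrix (Fin d) (Fin d) ℂ).map star = 1 := by
    ext i j; by_cases hij : i = j <;> simp [Matrix.one_apply, hij]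
  rw [amplify, h, Matrix.one_kronecker_one, Matrix.one_kronecker_one, Matrix.fromBlocks_one]

namespace RigidSystem

variable {n d : ℕ} (S : RigidSystem n d) {D : ℕ} (P : Fin n → Matrix (Fin D) (Fin D) ℂ)

/-- The operators that measure the failure of the relations of a rigid system, other than the
orthogonality relations. -/
noncomputable def defect : Fin S.nApex ⊕ Fin S.nBasis → Matrix (Fin D) (Fin D) ℂ :=
  Sum.elim (fun j => (1 - S.κ • ∑ m, P (S.nbr j m)) * (1 - P (S.apex j)))
    fun c => (1 / 2 : ℝ) • (1 - ∑ a, P (S.basis c a))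

/-- The indices of the first-order terms. -/
abbrev FirstOrder : Type :=
  (Fin S.nApex × Fin S.nNbr) ⊕ {x : Fin S.nBasis × Fin d × Fin d // x.2.1 ≠ x.2.2}

/-- The left factors of the first-order terms. -/
def leftFactor : S.FirstOrder → Matrix (Fin D) (Fin D) ℂ :=
  Sum.elim (fun x => P (S.apex x.1)) fun x => P (S.basis x.1.1 x.1.2.1)

/-- The middle factors of the first-order terms, which are small by near orthogonality. -/
noncomputable def smallFactor : S.FirstOrder → Matrix (Fin D) (Fin D) ℂ :=
  Sum.elim (fun x => (2 * S.κ) • (P (S.apex x.1) * P (S.nbr x.1 x.2)))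
    fun x => P (S.basis x.1.1 x.1.2.1) * P (S.basis x.1.1 x.1.2.2)

/-- The right factors of the first-order terms. -/
def rightFactor : S.FirstOrder → Matrix (Fin D) (Fin D) ℂ :=
  Sum.elim (fun x => 1 - P (S.apex x.1)) fun x => P (S.basis x.1.1 x.1.2.2)

/-- The hypothesis on `P` from which the relations are deduced: a sum of squares that measures their
failure is bounded by the first-order terms that come from the overlaps within the bases. -/
structure HasSmallDefect (K δ : ℝ) : Prop where
  isProj : ∀ i, IsStarProjection (P i)
  orth : ∀ i j, S.Orth i j → ‖P i * P j‖ ≤ δ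
  expect_le : ∀ ψ, IsState ψ →
    ∑ j, expect ((1 - S.κ • ∑ m, P (S.nbr j m)) * (1 - S.κ • ∑ m, P (S.nbr j m)) - P (S.apex j)) ψ +
      1 / 4 * ∑ c, expect ((1 - ∑ a, P (S.basis c a)) * (1 - ∑ a, P (S.basis c a))) ψ ≤
    ∑ c, expect (∑ a, ∑ b, if a ≠ b then P (S.basis c a) * P (S.basis c b) else 0) ψ + K * δ ^ 2

variable {S P} {K δ : ℝ}

lemma norm_smallFactor_le (h : S.HasSmallDefect P K δ) (hδ : 0 ≤ δ) (x : S.FirstOrder) :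
    ‖S.smallFactor P x‖ ≤ (2 * S.κ + 1) * δ := by
  have hκ := S.κ_nonneg
  rcases x with x | x
  · have h1 := h.orth _ _ (S.orth_nbr x.1 x.2)
    have h2 : S.smallFactor P (Sum.inl x) = (2 * S.κ) • (P (S.apex x.1) * P (S.nbr x.1 x.2)) := rfl
    rw [h2, norm_smul, Real.norm_of_nonneg (by positivity)]
    nlinarith
  · have h1 := h.orth _ _ (S.orth_basis x.1.1 _ _ x.2)
    have h2 : S.smallFactor P (Sum.inr x) =
      P (S.basis x.1.1 x.1.2.1) * P (S.basis x.1.1 x.1.2.2) := rfl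
    rw [h2]
    nlinarith [mul_nonneg hκ hδ]

lemma norm_leftFactor_le (h : ∀ i, IsStarProjection (P i)) (x : S.FirstOrder) :
    ‖S.leftFactor P x‖ ≤ 1 := by
  rcases x with x | x <;> exact norm_le_one_of_isStarProjection (h _)

lemma norm_rightFactor_le (h : ∀ i, IsStarProjection (P i)) (x : S.FirstOrder) :
    ‖S.rightFactor P x‖ ≤ 1 := by
  rcases x with x | x
  · exact norm_le_one_of_isStarProjection (h _).one_sub
  · exact norm_le_one_of_isStarProjection (h _)

lemma add_norm_defect_le {η : ℝ} (hη : η = δ + ∑ r, ‖S.defect P r‖)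
    (r : Fin S.nApex ⊕ Fin S.nBasis) : δ + ‖S.defect P r‖ ≤ η := by
  rw [hη]
  exact add_le_add_right (Finset.single_le_sum (f := fun r => ‖S.defect P r‖)
    (fun r _ => norm_nonneg _) (Finset.mem_univ r)) δ

lemma le_add_sum_norm_defect {η : ℝ} (hη : η = δ + ∑ r, ‖S.defect P r‖) : δ ≤ η := by
  rw [hη]
  exact le_add_of_nonneg_right (Finset.sum_nonneg fun r _ => norm_nonneg _)

/-- The squares of the defects are bounded by first-order terms. -/
lemma sum_expect_defect_le (h : S.HasSmallDefect P K δ) (hδ : 0 ≤ δ) {η : ℝ}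
    (hη : η = δ + ∑ r, ‖S.defect P r‖) {ψ : Fin D → ℂ} (hψ : IsState ψ) :
    ∑ r, expect ((S.defect P r)ᴴ * S.defect P r) ψ ≤
      ∑ x, expect (S.leftFactor P x * S.smallFactor P x * S.rightFactor P x) ψ +
        (|K| + S.nApex * (2 * S.κ * S.nNbr)) * (δ * η) := by
  have hκ := S.κ_nonneg
  have hle : ∀ r, δ + ‖S.defect P r‖ ≤ η := add_norm_defect_le hη
  have hδη : δ ≤ η := le_add_sum_norm_defect hη
  have h1 : ∑ j, expect ((S.defect P (Sum.inl j))ᴴ * S.defect P (Sum.inl j)) ψ ≤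
      ∑ j, expect ((1 - S.κ • ∑ m, P (S.nbr j m)) * (1 - S.κ • ∑ m, P (S.nbr j m)) -
        P (S.apex j)) ψ +
      ∑ j, ∑ m, expect (P (S.apex j) * ((2 * S.κ) • (P (S.apex j) * P (S.nbr j m))) *
        (1 - P (S.apex j))) ψ + S.nApex * (2 * S.κ * S.nNbr) * (δ * η) := by
    have h2 : ∑ j : Fin S.nApex, 2 * S.κ * S.nNbr * (δ * η) =
        S.nApex * (2 * S.κ * S.nNbr) * (δ * η) := by
      rw [Finset.sum_const, Finset.card_univ, Fintype.card_fin, nsmul_eq_mul]; ring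
    rw [← h2, ← Finset.sum_add_distrib, ← Finset.sum_add_distrib]
    refine Finset.sum_le_sum fun j _ => ?_
    refine (expect_defect_le_of_orthogonal (h.isProj (S.apex j)) (fun m => h.isProj (S.nbr j m)) hκ
      (fun m => h.orth _ _ (S.orth_nbr j m)) rfl hψ).trans ?_
    have h3 : 2 * S.κ * S.nNbr * δ * (δ + ‖S.defect P (Sum.inl j)‖) ≤
        2 * S.κ * S.nNbr * δ * η := mul_le_mul_of_nonneg_left (hle _) (by positivity)
    have h4 : S.defect P (Sum.inl j) =
      (1 - S.κ • ∑ m, P (S.nbr j m)) * (1 - P (S.apex j)) := rfl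
    rw [h4] at h3
    linarith
  have h2 : ∑ c, expect ((S.defect P (Sum.inr c))ᴴ * S.defect P (Sum.inr c)) ψ =
      1 / 4 * ∑ c, expect ((1 - ∑ a, P (S.basis c a)) * (1 - ∑ a, P (S.basis c a))) ψ := by
    rw [Finset.mul_sum]
    refine Finset.sum_congr rfl fun c _ => ?_
    have h3 : (1 - ∑ a, P (S.basis c a))ᴴ = 1 - ∑ a, P (S.basis c a) := by
      rw [Matrix.conjTranspose_sub, Matrix.conjTranspose_one, Matrix.conjTranspose_sum]
      congr 1
      exact Finset.sum_congr rfl fun a _ => conjTranspose_of_isStarProjection (h.isProj _)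
    have h4 : S.defect P (Sum.inr c) = (1 / 2 : ℝ) • (1 - ∑ a, P (S.basis c a)) := rfl
    rw [h4, Matrix.conjTranspose_smul, star_trivial, h3, Matrix.smul_mul, Matrix.mul_smul,
      expect_smul, expect_smul]
    ring
  -- within a basis, `P_a P_b = P_a (P_a P_b) P_b`
  have h3 : ∑ x : {x : Fin S.nBasis × Fin d × Fin d // x.2.1 ≠ x.2.2},
      expect (S.leftFactor P (Sum.inr x) * S.smallFactor P (Sum.inr x) *
        S.rightFactor P (Sum.inr x)) ψ =
      ∑ c, expect (∑ a, ∑ b, if a ≠ b then P (S.basis c a) * P (S.basis c b) else 0) ψ := by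
    have h4 : ∀ x : {x : Fin S.nBasis × Fin d × Fin d // x.2.1 ≠ x.2.2},
        S.leftFactor P (Sum.inr x) * S.smallFactor P (Sum.inr x) * S.rightFactor P (Sum.inr x) =
          P (S.basis x.1.1 x.1.2.1) * P (S.basis x.1.1 x.1.2.2) := by
      intro x
      change P (S.basis x.1.1 x.1.2.1) * (P (S.basis x.1.1 x.1.2.1) * P (S.basis x.1.1 x.1.2.2)) *
        P (S.basis x.1.1 x.1.2.2) = _
      rw [← Matrix.mul_assoc, (h.isProj _).isIdempotentElem.eq, Matrix.mul_assoc,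
        (h.isProj _).isIdempotentElem.eq]
    simp only [h4]
    rw [← Finset.sum_subtype (Finset.univ.filter fun x : Fin S.nBasis × Fin d × Fin d => x.2.1 ≠ x.2.2)
      (by simp) fun x => expect (P (S.basis x.1 x.2.1) * P (S.basis x.1 x.2.2)) ψ,
      Finset.sum_filter, Fintype.sum_prod_type]
    refine Finset.sum_congr rfl fun c _ => ?_
    rw [Fintype.sum_prod_type, expect_sum]
    refine Finset.sum_congr rfl fun a _ => ?_
    rw [expect_sum]
    refine Finset.sum_congr rfl fun b _ => ?_
    split_ifs with hab
    · rfl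
    · exact (expect_zero ψ).symm
  have h5 := h.expect_le ψ hψ
  have h6 : K * δ ^ 2 ≤ |K| * (δ * η) := by
    have h7 : δ ^ 2 ≤ δ * η := by nlinarith
    exact (mul_le_mul_of_nonneg_right (le_abs_self K) (by positivity)).trans
      (mul_le_mul_of_nonneg_left h7 (abs_nonneg K))
  rw [Fintype.sum_sum_type, Fintype.sum_sum_type, h2, h3, Fintype.sum_prod_type]
  change _ ≤ ∑ j, ∑ m, expect (P (S.apex j) * ((2 * S.κ) • (P (S.apex j) * P (S.nbr j m))) *
        (1 - P (S.apex j))) ψ + _ + _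
  linarith

/-- Small defects mean that the relations hold up to a small error. -/
lemma approx_of_defect (h : S.HasSmallDefect P K δ) (hδ : 0 ≤ δ) {η : ℝ}
    (hη : η = δ + ∑ r, ‖S.defect P r‖) : S.Approx ((S.κ * S.nNbr + 2) * η) P := by
  have hκ := S.κ_nonneg
  have hle : ∀ r, δ + ‖S.defect P r‖ ≤ η := add_norm_defect_le hη
  have hδη : δ ≤ η := le_add_sum_norm_defect hη
  have hκη : 0 ≤ S.κ * S.nNbr * η := by have := hδ.trans hδη; positivity
  refine ⟨h.isProj, fun i j hij => (h.orth i j hij).trans (by nlinarith), fun c => ?_, fun j => ?_⟩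
  · have h1 : ∑ a, P (S.basis c a) - 1 = -(2 : ℝ) • S.defect P (Sum.inr c) := by
      change _ = -(2 : ℝ) • (1 / 2 : ℝ) • (1 - ∑ a, P (S.basis c a))
      rw [smul_smul]; norm_num
    rw [h1, norm_smul]
    have := hle (Sum.inr c)
    norm_num
    nlinarith
  · have h1 : P (S.apex j) - (1 - (S.κ : ℂ) • ∑ m, P (S.nbr j m)) =
        S.κ • ∑ m, P (S.nbr j m) * P (S.apex j) - S.defect P (Sum.inl j) := by
      change _ = _ - (1 - S.κ • ∑ m, P (S.nbr j m)) * (1 - P (S.apex j))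
      rw [Complex.coe_smul, ← Finset.sum_mul, ← Matrix.smul_mul]
      noncomm_ring
    have h2 : ‖∑ m, P (S.nbr j m) * P (S.apex j)‖ ≤ S.nNbr * δ := by
      calc _ ≤ ∑ m : Fin S.nNbr, δ := norm_sum_le_of_le _ fun m _ => by
            rw [norm_mul_comm_of_isStarProjection (h.isProj _) (h.isProj _)]
            exact h.orth _ _ (S.orth_nbr j m)
        _ = _ := by simp
    rw [h1]
    refine (norm_sub_le _ _).trans ?_
    rw [norm_smul, Real.norm_of_nonneg hκ]
    have h3 := mul_le_mul_of_nonneg_left h2 hκ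
    have h4 := hle (Sum.inl j)
    have h5 : S.κ * (S.nNbr * δ) ≤ S.κ * S.nNbr * η := by
      rw [← mul_assoc]; exact mul_le_mul_of_nonneg_left hδη (by positivity)
    linarith

end RigidSystem

end CFR


namespace CFR

open scoped Matrix.Norms.L2Operator

namespace RigidSystem

variable {n d : ℕ} {S : RigidSystem n d} {D : ℕ} {P : Fin n → Matrix (Fin D) (Fin D) ℂ} {K δ : ℝ}

lemma IsNear.mono {θ θ' : ℝ} (h : S.IsNear θ P) (hθ : θ ≤ θ') : S.IsNear θ' P := by
  obtain ⟨m₁, m₂, hm, V, hV, hV', hVP⟩ := h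
  exact ⟨m₁, m₂, hm, V, hV, hV', fun k => (hVP k).trans hθ⟩

/-- A bound on the total error in terms of a bound on the norm of each defect. -/
lemma sq_le_of_norm_defect_sq_le {η b : ℝ} (hη : η = δ + ∑ r, ‖S.defect P r‖)
    (hb : ∀ r, ‖S.defect P r‖ ^ 2 ≤ b) :
    η ^ 2 ≤ 2 * δ ^ 2 + 2 * ((S.nApex + S.nBasis : ℕ) ^ 2 * b) := by
  have h1 : (∑ r, ‖S.defect P r‖) ^ 2 ≤ (S.nApex + S.nBasis : ℕ) ^ 2 * b := by
    refine sq_sum_le_card_mul_sum_sq.trans ?_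
    have h2 : ∑ r, ‖S.defect P r‖ ^ 2 ≤ ∑ r : Fin S.nApex ⊕ Fin S.nBasis, b :=
      Finset.sum_le_sum fun r _ => hb r
    rw [Finset.sum_const, Finset.card_univ, Fintype.card_sum, Fintype.card_fin, Fintype.card_fin,
      nsmul_eq_mul] at h2
    rw [Finset.card_univ, Fintype.card_sum, Fintype.card_fin, Fintype.card_fin, sq, mul_assoc]
    exact mul_le_mul_of_nonneg_left h2 (Nat.cast_nonneg _)
  rw [hη]
  nlinarith [sq_nonneg (δ - ∑ r, ‖S.defect P r‖)]

/-- Bounding the first-order terms by their norms gives defects of order `√δ`. -/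
lemma norm_defect_sq_le (h : S.HasSmallDefect P K δ) (hδ : 0 ≤ δ) {η : ℝ}
    (hη : η = δ + ∑ r, ‖S.defect P r‖) (r : Fin S.nApex ⊕ Fin S.nBasis) :
    ‖S.defect P r‖ ^ 2 ≤ Fintype.card S.FirstOrder * ((2 * S.κ + 1) * δ) +
      (|K| + S.nApex * (2 * S.κ * S.nNbr)) * (δ * η) := by
  have hκ := S.κ_nonneg
  have hη0 : 0 ≤ η := hδ.trans (le_add_sum_norm_defect hη)
  refine norm_sq_le_of_expect _ (by positivity) fun ψ hψ => ?_
  refine ((Finset.single_le_sum (f := fun r => expect ((S.defect P r)ᴴ * S.defect P r) ψ)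
    (fun r _ => expect_conjTranspose_mul_self_nonneg _ _) (Finset.mem_univ r)).trans
    (sum_expect_defect_le h hδ hη hψ)).trans ?_
  gcongr
  calc _ ≤ ∑ x : S.FirstOrder, (2 * S.κ + 1) * δ := by
        refine Finset.sum_le_sum fun x _ => (le_abs_self _).trans ((abs_expect_le_norm _ hψ).trans ?_)
        refine (norm_mul_le_of_le' (norm_mul_le_of_le' (norm_leftFactor_le h.isProj x)
          (norm_smallFactor_le h hδ x)) (norm_rightFactor_le h.isProj x)).trans (le_of_eq ?_)
        ring
    _ = _ := by rw [Finset.sum_const, Finset.card_univ, nsmul_eq_mul]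

/-- Near an amplification of the ideal family, averaging over its slots turns the first-order terms
into second-order ones. -/
lemma norm_defect_sq_le_of_isNear (h : S.HasSmallDefect P K δ) (hδ : 0 ≤ δ) {η θ : ℝ}
    (hη : η = δ + ∑ r, ‖S.defect P r‖) (hθ : 0 ≤ θ) (hnear : S.IsNear θ P)
    (r : Fin S.nApex ⊕ Fin S.nBasis) :
    ‖S.defect P r‖ ^ 2 ≤ 4 * d ^ 2 * (d * ((|K| + S.nApex * (2 * S.κ * S.nNbr)) * (δ * η) +
      Fintype.card S.FirstOrder * ((1 + 2 * d ^ 2) * (θ * ((2 * S.κ + 1) * δ))))) := by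
  have hκ := S.κ_nonneg
  have hη0 : 0 ≤ η := hδ.trans (le_add_sum_norm_defect hη)
  obtain ⟨m₁, m₂, -, V, hV, hV', hVP⟩ := hnear
  refine norm_sq_le_of_first_order hV hV' (A := S.leftFactor P) (Z := S.smallFactor P)
    (B := S.rightFactor P) (a := Sum.elim (fun x => S.M (S.apex x.1))
      fun x => S.M (S.basis x.1.1 x.1.2.1))
    (b := Sum.elim (fun x => 1 - S.M (S.apex x.1)) fun x => S.M (S.basis x.1.1 x.1.2.2))
    ?_ ?_ hθ (by positivity) (by positivity) ?_ ?_ (norm_rightFactor_le h.isProj)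
    (norm_smallFactor_le h hδ) (fun ψ hψ => sum_expect_defect_le h hδ hη hψ) r
  · rintro (x | x)
    · change (1 - S.M _) * S.M _ = 0
      rw [sub_mul, one_mul, S.M_mul_self, sub_self]
    · exact S.M_mul_basis _ _ _ x.2.symm
  · rintro (x | x) <;> exact S.norm_M_le _
  · rintro (x | x) <;> exact hVP _
  · rintro (x | x)
    · have h1 : V * amplify m₁ m₂ (1 - S.M (S.apex x.1)) * Vᴴ - (1 - P (S.apex x.1)) =
          -(V * amplify m₁ m₂ (S.M (S.apex x.1)) * Vᴴ - P (S.apex x.1)) := by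
        rw [amplify_sub, amplify_one, Matrix.mul_sub, Matrix.sub_mul, Matrix.mul_one, hV']
        abel
      change ‖V * amplify m₁ m₂ (1 - S.M (S.apex x.1)) * Vᴴ - (1 - P (S.apex x.1))‖ ≤ θ
      rw [h1, norm_neg]
      exact hVP _
    · exact hVP _

variable (S) in
/-- Families of projections with small defect are within `O(δ)` of an amplification of the ideal
family. A first estimate gives an error of order `√δ`; this suffices to compare the family with an
amplification of the ideal one and so to remove the first-order terms from the bound on the
defects. -/
theorem exists_isNear_of_hasSmallDefect [NeZero d] (K : ℝ) : ∃ C η₀ : ℝ, 0 < η₀ ∧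
    ∀ (D : ℕ) (δ : ℝ) (P : Fin n → Matrix (Fin D) (Fin D) ℂ), 0 ≤ δ → S.HasSmallDefect P K δ →
      δ ≤ η₀ → S.IsNear (C * δ) P := by
  have hκ := S.κ_nonneg
  obtain ⟨C, η₀, hη₀, hC⟩ := S.exists_isNear_of_approx
  obtain ⟨L, hL⟩ : ∃ x : ℝ, x = S.κ * S.nNbr + 2 := ⟨_, rfl⟩
  have hL0 : 0 < L := by rw [hL]; positivity
  obtain ⟨B, hB⟩ : ∃ x : ℝ, x = |K| + S.nApex * (2 * S.κ * S.nNbr) := ⟨_, rfl⟩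
  have hB0 : 0 ≤ B := by rw [hB]; positivity
  obtain ⟨A, hA⟩ : ∃ x : ℝ, x = Fintype.card S.FirstOrder * (2 * S.κ + 1) := ⟨_, rfl⟩
  have hA0 : 0 ≤ A := by rw [hA]; positivity
  obtain ⟨c, hc⟩ : ∃ x : ℝ, x = ((S.nApex + S.nBasis : ℕ) : ℝ) ^ 2 := ⟨_, rfl⟩
  have hc0 : 0 ≤ c := by rw [hc]; positivity
  obtain ⟨C', hC'⟩ : ∃ x : ℝ, x = |C| * L := ⟨_, rfl⟩
  have hC'0 : 0 ≤ C' := by rw [hC']; positivity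
  obtain ⟨G, hG⟩ : ∃ x : ℝ, x = 4 * d ^ 2 * (d * (B + (1 + 2 * d ^ 2) * C' * A)) := ⟨_, rfl⟩
  have hG0 : 0 ≤ G := by rw [hG]; positivity
  obtain ⟨F, hF⟩ : ∃ x : ℝ, x = 4 + 4 * c * A + (2 * c * B) ^ 2 := ⟨_, rfl⟩
  have hF0 : 0 < F := by rw [hF]; positivity
  refine ⟨C' * (2 + 2 * c * G), min 1 ((η₀ / L) ^ 2 / F), by positivity,
    fun D δ P hδ h hδη => ?_⟩
  obtain ⟨η, hη⟩ : ∃ η, η = δ + ∑ r, ‖S.defect P r‖ := ⟨_, rfl⟩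
  have hle : δ ≤ η := le_add_sum_norm_defect hη
  have hη0 : 0 ≤ η := hδ.trans hle
  have hδ1 : δ ≤ 1 := hδη.trans (min_le_left _ _)
  -- the first estimate: `η = O(√δ)`, which puts `P` near an amplification
  have h1 := sq_le_of_norm_defect_sq_le hη (norm_defect_sq_le h hδ hη)
  have h2 : η ^ 2 ≤ F * δ := by
    have e1 : δ ^ 2 ≤ δ := by nlinarith
    have e2 : Fintype.card S.FirstOrder * ((2 * S.κ + 1) * δ) = A * δ := by rw [hA]; ring
    rw [e2, ← hc, ← hB] at h1
    have e3 : 2 * (2 * c * B * δ * η) ≤ η ^ 2 + (2 * c * B) ^ 2 * δ ^ 2 := by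
      nlinarith [sq_nonneg (η - 2 * c * B * δ)]
    have e4 := mul_le_mul_of_nonneg_left e1 (sq_nonneg (2 * c * B))
    rw [hF]
    nlinarith
  have h3 : L * η ≤ η₀ := by
    have e1 : η ^ 2 ≤ (η₀ / L) ^ 2 := by
      have := hδη.trans (min_le_right _ _)
      rw [le_div_iff₀ hF0] at this
      linarith
    have e2 := abs_le_of_sq_le_sq e1 (by positivity)
    have e3 := (le_div_iff₀ hL0).1 ((le_abs_self η).trans e2)
    linarith
  have hnear := hC D (L * η) P (by positivity) (hL ▸ approx_of_defect h hδ hη) h3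
  have hnear' : S.IsNear (C' * η) P := by
    refine hnear.mono ?_
    rw [hC', mul_assoc]
    exact mul_le_mul_of_nonneg_right (le_abs_self C) (by positivity)
  -- the second estimate: `η = O(δ)`
  have h4 := sq_le_of_norm_defect_sq_le hη
    (norm_defect_sq_le_of_isNear h hδ hη (by positivity) hnear')
  have h5 : η ^ 2 ≤ (2 + 2 * c * G) * (δ * η) := by
    have e1 : 4 * (d : ℝ) ^ 2 * (d * (B * (δ * η) + Fintype.card S.FirstOrder *
        ((1 + 2 * d ^ 2) * (C' * η * ((2 * S.κ + 1) * δ))))) = G * (δ * η) := by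
      rw [hG, hA]; ring
    rw [← hc, ← hB, e1] at h4
    have e2 := mul_le_mul_of_nonneg_left hle hδ
    linarith
  refine hnear'.mono ?_
  rw [mul_assoc]
  refine mul_le_mul_of_nonneg_left ?_ hC'0
  rcases hη0.eq_or_lt with h0 | h0
  · rw [← h0]; positivity
  · refine le_of_mul_le_mul_right ?_ h0
    nlinarith

end RigidSystem

end CFR


/-! ### The rays of the four sets -/

namespace CFR

open scoped Matrix.Norms.L2Operator

lemma peres24_eq (i : Fin 24) (a : Fin 4) : peres24 i a = (peresInt i a : ℂ) := by
  fin_cases i <;> fin_cases a <;> simp [peres24, peresInt]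

lemma yo13_eq (i : Fin 13) (a : Fin 3) : yo13 i a = (yoInt i a : ℂ) := by
  fin_cases i <;> fin_cases a <;> simp [yo13, yoInt]

section RankOne

variable {d : ℕ} {v w : Fin d → ℂ}

lemma rankOneProj_mul_self (hv : star v ⬝ᵥ v ≠ 0) : rankOneProj v * rankOneProj v = rankOneProj v := by
  rw [rankOneProj, Matrix.smul_mul, Matrix.mul_smul, Matrix.vecMulVec_mul_vecMulVec, smul_smul,
    Matrix.vecMulVec_smul, smul_smul, mul_assoc, inv_mul_cancel₀ hv, mul_one]

lemma isStarProjection_rankOneProj (hv : star v ⬝ᵥ v ≠ 0) : IsStarProjection (rankOneProj v) := by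
  refine ⟨rankOneProj_mul_self hv, ?_⟩
  have h : star (star v ⬝ᵥ v) = star v ⬝ᵥ v := (Matrix.star_dotProduct v v).symm
  rw [IsSelfAdjoint, rankOneProj, star_smul, star_inv₀, h, Matrix.star_eq_conjTranspose,
    Matrix.conjTranspose_vecMulVec, star_star]

lemma rankOneProj_mul_eq_zero (h : star v ⬝ᵥ w = 0) : rankOneProj v * rankOneProj w = 0 := by
  rw [rankOneProj, rankOneProj, Matrix.smul_mul, Matrix.mul_smul, Matrix.vecMulVec_mul_vecMulVec, h,
    zero_smul, Matrix.vecMulVec_zero, smul_zero, smul_zero]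

lemma norm_entry_le {A : Matrix (Fin d) (Fin d) ℂ} (a b : Fin d) : ‖A a b‖ ≤ ‖A‖ := by
  have h := abs_dotProduct_mulVec_le A (Pi.single a 1) (Pi.single b 1)
  have h1 : ∀ c : Fin d, ‖(WithLp.toLp 2 (Pi.single c 1) : EuclideanSpace ℂ (Fin d))‖ = 1 := fun c => by
    rw [← isState_iff_norm, IsState]; simp
  rw [h1, h1, mul_one, mul_one] at h
  have h2 : star (Pi.single a (1 : ℂ) : Fin d → ℂ) = Pi.single a 1 := by ext; simp [Pi.single_apply]
  rwa [h2, Matrix.mulVec_single_one, single_one_dotProduct] at h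

lemma norm_rankOneProj_entry_le (hv : star v ⬝ᵥ v ≠ 0) (a b : Fin d) : ‖rankOneProj v a b‖ ≤ 1 :=
  (norm_entry_le a b).trans (norm_le_one_of_isStarProjection (isStarProjection_rankOneProj hv))

lemma star_intCast_dotProduct (x y : Fin d → ℤ) :
    star (fun a => (x a : ℂ)) ⬝ᵥ (fun a => (y a : ℂ)) = ((∑ a, x a * y a : ℤ) : ℂ) := by
  simp [dotProduct]

lemma rankOneProj_intCast (x : Fin d → ℤ) (a b : Fin d) : rankOneProj (fun a => (x a : ℂ)) a b =
    ((x a * x b : ℤ) / (∑ a, x a * x a : ℤ) : ℂ) := by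
  rw [rankOneProj_apply, star_intCast_dotProduct]
  simp [div_eq_inv_mul]

end RankOne

lemma peres24_dotProduct (i j : Fin 24) : star (peres24 i) ⬝ᵥ peres24 j =
    ((∑ a, peresInt i a * peresInt j a : ℤ) : ℂ) := by
  rw [← star_intCast_dotProduct]
  simp only [← peres24_eq]

lemma yo13_dotProduct (i j : Fin 13) : star (yo13 i) ⬝ᵥ yo13 j =
    ((∑ a, yoInt i a * yoInt j a : ℤ) : ℂ) := by
  rw [← star_intCast_dotProduct]
  simp only [← yo13_eq]

lemma peres24_ne (i : Fin 24) : star (peres24 i) ⬝ᵥ peres24 i ≠ 0 := by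
  rw [peres24_dotProduct, Int.cast_ne_zero]
  revert i; decide

lemma yo13_ne (i : Fin 13) : star (yo13 i) ⬝ᵥ yo13 i ≠ 0 := by
  rw [yo13_dotProduct, Int.cast_ne_zero]
  revert i; decide

lemma bbc21_ne (i : Fin 21) : star (bbc21 i) ⬝ᵥ bbc21 i ≠ 0 := by
  rw [bbc21_norm]
  split_ifs <;> norm_num

lemma rankOneProj_peres24_apply (k : Fin 24) (a b : Fin 4) : rankOneProj (peres24 k) a b =
    ((peresInt k a * peresInt k b : ℤ) / (∑ a, peresInt k a * peresInt k a : ℤ) : ℂ) := by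
  rw [← rankOneProj_intCast]
  simp only [← peres24_eq]

lemma rankOneProj_yo13_apply (k : Fin 13) (a b : Fin 3) : rankOneProj (yo13 k) a b =
    ((yoInt k a * yoInt k b : ℤ) / (∑ a, yoInt k a * yoInt k a : ℤ) : ℂ) := by
  rw [← rankOneProj_intCast]
  simp only [← yo13_eq]

lemma PeresOrth.dotProduct_eq_zero {i j : Fin 24} (h : PeresOrth i j) :
    star (peres24 i) ⬝ᵥ peres24 j = 0 := by
  rw [peres24_dotProduct, h.2, Int.cast_zero]

lemma YoOrth.dotProduct_eq_zero {i j : Fin 13} (h : YoOrth i j) :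
    star (yo13 i) ⬝ᵥ yo13 j = 0 := by
  rw [yo13_dotProduct, h.2, Int.cast_zero]

/-- The rays of Peres are determined by their orthogonality relations and bases. -/
noncomputable def peresSystem : RigidSystem 24 4 where
  nBasis := 24
  nApex := 0
  nNbr := 0
  basis := peresBasis
  apex := Fin.elim0
  nbr := fun j => j.elim0
  κ := 0
  Orth := PeresOrth
  M := fun k => rankOneProj (peres24 k)
  κ_nonneg := le_rfl
  orth_basis := by decide
  orth_nbr := fun j => j.elim0
  norm_M_le := fun k => norm_rankOneProj_entry_le (peres24_ne k)
  M_mul_self := fun k => rankOneProj_mul_self (peres24_ne k)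
  M_mul_basis := fun m a b hab => by
    have h : ∀ m a b, a ≠ b → PeresOrth (peresBasis m a) (peresBasis m b) := by decide
    exact rankOneProj_mul_eq_zero (h m a b hab).dotProduct_eq_zero
  rigid := fun P hsa hid o hbasis _ => by
    obtain ⟨u, hc, hu⟩ := exists_peres_units P hsa hid o hbasis
    refine ⟨u, fun k => ?_⟩
    rw [hu, u.map_of_c_eq_one hc]
    simp only [rankOneProj_peres24_apply]

/-- The rays of CEG-18, in the coordinates in which they are rays of Peres, are determined by their
orthogonality relations and bases. -/
noncomputable def cegSystem : RigidSystem 18 4 where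
  nBasis := 9
  nApex := 0
  nNbr := 0
  basis := cegBasis
  apex := Fin.elim0
  nbr := fun j => j.elim0
  κ := 0
  Orth := fun i j => PeresOrth (cegPeres i) (cegPeres j)
  M := fun k => rankOneProj (peres24 (cegPeres k))
  κ_nonneg := le_rfl
  orth_basis := by decide
  orth_nbr := fun j => j.elim0
  norm_M_le := fun k => norm_rankOneProj_entry_le (peres24_ne _)
  M_mul_self := fun k => rankOneProj_mul_self (peres24_ne _)
  M_mul_basis := fun m a b hab => by
    have h : ∀ m a b, a ≠ b → PeresOrth (cegPeres (cegBasis m a)) (cegPeres (cegBasis m b)) := by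
      decide
    exact rankOneProj_mul_eq_zero (h m a b hab).dotProduct_eq_zero
  rigid := fun P hsa hid o hbasis _ => by
    obtain ⟨u, hc, hu⟩ := exists_ceg_units P hsa hid o hbasis
    refine ⟨u, fun k => ?_⟩
    rw [hu, u.map_of_c_eq_one hc]
    simp only [rankOneProj_peres24_apply]

/-- The rays of YO-13 are determined by their orthogonality relations, their bases, and the
expression of the four rays outside the bases by their neighbours. -/
noncomputable def yoSystem : RigidSystem 13 3 where
  nBasis := 4
  nApex := 4
  nNbr := 3
  basis := yoBasis
  apex := yoApex
  nbr := yoNbr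
  κ := 2 / 3
  Orth := YoOrth
  M := fun k => rankOneProj (yo13 k)
  κ_nonneg := by norm_num
  orth_basis := by decide
  orth_nbr := by decide
  norm_M_le := fun k => norm_rankOneProj_entry_le (yo13_ne k)
  M_mul_self := fun k => rankOneProj_mul_self (yo13_ne k)
  M_mul_basis := fun m a b hab => by
    have h : ∀ m a b, a ≠ b → YoOrth (yoBasis m a) (yoBasis m b) := by decide
    exact rankOneProj_mul_eq_zero (h m a b hab).dotProduct_eq_zero
  rigid := fun P hsa hid o hbasis hapex => by
    obtain ⟨u, hc, hu⟩ := exists_yo_units P hsa hid o hbasis fun j => by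
      rw [hapex]; norm_num
    refine ⟨u, fun k => ?_⟩
    rw [hu, u.map_of_c_eq_one hc]
    simp only [rankOneProj_yo13_apply]

/-- The rays of BBC-21 are determined by their orthogonality relations, their bases, and the
expression of the nine rays outside the bases by their neighbours. -/
noncomputable def bbcSystem : RigidSystem 21 3 where
  nBasis := 4
  nApex := 9
  nNbr := 4
  basis := bbcBasis
  apex := bbcPoint
  nbr := bbcNbr
  κ := 1 / 2
  Orth := BbcOrth
  M := fun k => rankOneProj (bbc21 k)
  κ_nonneg := by norm_num
  orth_basis := fun m a b hab => Or.inl ⟨m, a, b, hab, rfl, rfl⟩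
  orth_nbr := fun j m => Or.inr ⟨j, m, Or.inl ⟨rfl, rfl⟩⟩
  norm_M_le := fun k => norm_rankOneProj_entry_le (bbc21_ne k)
  M_mul_self := fun k => rankOneProj_mul_self (bbc21_ne k)
  M_mul_basis := fun m a b hab =>
    rankOneProj_mul_eq_zero (bbc21_orth (Or.inl ⟨m, a, b, hab, rfl, rfl⟩))
  rigid := fun P hsa hid o hbasis hpoint => exists_bbc_units P hsa hid o hbasis fun p => by
    rw [hpoint]; norm_num

end CFR


/-! ### Realizations satisfy the relations up to small errors -/

namespace CFR

open scoped Matrix.Norms.L2Operator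

/-- A sum over the members of the blocks of a design, in terms of the number of blocks that contain
each point. -/
lemma sum_sum_eq_sum_card_nsmul {E : Type*} [AddCommMonoid E] {n N d : ℕ} (g : Fin N → Fin d → Fin n)
    (c : Fin n → ℕ) (h : ∀ i, ∑ m, ∑ a, (if g m a = i then 1 else 0) = c i) (x : Fin n → E) :
    ∑ m, ∑ a, x (g m a) = ∑ i, c i • x i := by
  have h1 : ∀ i, c i • x i = ∑ m, ∑ a, if g m a = i then x i else 0 := fun i => by
    rw [← h i]
    simp only [Finset.sum_smul, ite_smul, one_smul, zero_smul]
  simp only [h1]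
  rw [Finset.sum_comm (s := Finset.univ (α := Fin n))]
  refine Finset.sum_congr rfl fun m _ => ?_
  rw [Finset.sum_comm (s := Finset.univ (α := Fin n))]
  refine Finset.sum_congr rfl fun a _ => ?_
  simp

section Realizations

variable {n D : ℕ} {G : SimpleGraph (Fin n)} {w : Fin n → ℝ} {θ ε : ℝ}
  {P : Fin n → Matrix (Fin D) (Fin D) ℂ}

lemma IsRealization.norm_mul_le (h : IsRealization G w θ ε P) (hε : 0 ≤ ε) {i j : Fin n}
    (hij : G.Adj i j) : ‖P i * P j‖ ≤ √ε :=
  norm_mul_le_of_expect (h.isProj j) (h.isProj i) hε (h.le_eps j i hij.symm)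

/-- For a system that consists of bases only, the relations hold approximately as soon as the sum of
the projections of all bases nearly reaches its largest possible value. -/
lemma RigidSystem.approx_of_sum_le {d : ℕ} (S : RigidSystem n d) (hS : S.nApex = 0)
    (hP : ∀ i, IsStarProjection (P i)) {δ r : ℝ} (hδ : 0 ≤ δ) (hr : 0 ≤ r)
    (ho : ∀ i j, S.Orth i j → ‖P i * P j‖ ≤ δ)
    (hsum : ∀ ψ, IsState ψ → S.nBasis - r * δ ≤ ∑ m, expect (∑ a, P (S.basis m a)) ψ) :
    S.Approx ((1 + (r + S.nBasis * d ^ 2)) * δ) P := by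
  have h0 : 0 ≤ (r + S.nBasis * d ^ 2) * δ := by positivity
  refine ⟨hP, fun i j hij => (ho i j hij).trans (by linarith), fun m => ?_, fun j => ?_⟩
  · have := norm_clique_sub_one_le hP S.basis hδ (fun m a b hab => ho _ _ (S.orth_basis m a b hab))
      hr hsum m
    linarith
  · exact (Fin.cast hS j).elim0

lemma sq_sqrt_le_of_le_one (hε : 0 ≤ ε) (hε1 : ε ≤ 1) : ε ≤ √ε := by
  have h1 := Real.sq_sqrt hε
  have h2 : √ε ≤ 1 := Real.sqrt_le_one.2 hε1
  nlinarith [Real.sqrt_nonneg ε]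

lemma expect_one_sub_smul_sq_sub {T p : Matrix (Fin D) (Fin D) ℂ} (κ : ℝ) {ψ : Fin D → ℂ}
    (hψ : IsState ψ) : expect ((1 - κ • T) * (1 - κ • T) - p) ψ =
      1 - 2 * κ * expect T ψ + κ ^ 2 * expect (T * T) ψ - expect p ψ := by
  have h : (1 - κ • T) * (1 - κ • T) = 1 - (2 * κ) • T + κ ^ 2 • (T * T) := by
    rw [sub_mul, one_mul, mul_sub, mul_one, Matrix.smul_mul, Matrix.mul_smul, smul_smul, ← sq, two_mul,
      add_smul]
    abel
  rw [expect_sub, h, expect_add, expect_sub, expect_one hψ, expect_smul, expect_smul]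

end Realizations

section Peres

variable {D : ℕ} {ε : ℝ}

/-- Each ray of Peres lies in four of the 24 bases, so that the bases have total weight at least
`4 (6 - ε) = 24 - 4 ε`. -/
lemma peres_approx {P : Fin 24 → Matrix (Fin D) (Fin D) ℂ} (hε : 0 ≤ ε) (hε1 : ε ≤ 1)
    (h : IsRealization (orthGraph peres24) (fun _ => 1) (6 - ε) ε P) :
    peresSystem.Approx ((1 + (4 + (24 : ℕ) * (4 : ℕ) ^ 2)) * √ε) P := by
  refine peresSystem.approx_of_sum_le rfl h.isProj (Real.sqrt_nonneg _) (by norm_num)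
    (fun i j hij => h.norm_mul_le hε ⟨hij.1, PeresOrth.dotProduct_eq_zero hij⟩) fun ψ hψ => ?_
  change ((24 : ℕ) : ℝ) - _ ≤ ∑ m, expect (∑ a, P (peresBasis m a)) ψ
  simp only [expect_sum]
  rw [sum_sum_eq_sum_card_nsmul peresBasis (fun _ => 4) (by decide +kernel) fun i => expect (P i) ψ]
  have h1 := h.theta_le ψ hψ
  have h2 := sq_sqrt_le_of_le_one hε hε1
  simp only [one_mul] at h1
  rw [← Finset.smul_sum, nsmul_eq_mul]
  push_cast
  linarith

end Peres

section YO

variable {D : ℕ} {ε : ℝ}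

/-- The sums of the three neighbours of the rays of `yoApex` are so placed that their squares add up to a
constant, whether or not rays of different bases commute. -/
lemma yo_sum_sq {A : Type*} [Ring A] {z₁ z₂ z₃ y₁ y₂ y₃ x₁ x₂ x₃ : A} (hz : z₁ + z₂ + z₃ = 1)
    (h₁ : z₁ + y₁ + x₁ = 1) (h₂ : z₂ + y₂ + x₂ = 1) (h₃ : z₃ + y₃ + x₃ = 1)
    (hz₁ : z₁ * z₁ = z₁) (hz₂ : z₂ * z₂ = z₂) (hz₃ : z₃ * z₃ = z₃)
    (hy₁ : y₁ * y₁ = y₁) (hy₂ : y₂ * y₂ = y₂) (hy₃ : y₃ * y₃ = y₃)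
    (hx₁ : x₁ * x₁ = x₁) (hx₂ : x₂ * x₂ = x₂) (hx₃ : x₃ * x₃ = x₃) :
    (x₁ + x₂ + x₃) * (x₁ + x₂ + x₃) + (y₁ + y₂ + x₃) * (y₁ + y₂ + x₃) +
      (x₁ + y₂ + y₃) * (x₁ + y₂ + y₃) + (y₁ + x₂ + y₃) * (y₁ + x₂ + y₃) = 6 := by
  have e₁ : y₁ + x₁ = 1 - z₁ := by rw [← h₁]; abel
  have e₂ : y₂ + x₂ = 1 - z₂ := by rw [← h₂]; abel
  have e₃ : y₃ + x₃ = 1 - z₃ := by rw [← h₃]; abel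
  have s : (y₁ + x₁) + (y₂ + x₂) + (y₃ + x₃) = 2 := by
    rw [e₁, e₂, e₃]
    calc (1 - z₁ + (1 - z₂) + (1 - z₃) : A) = 1 + 1 + 1 - (z₁ + z₂ + z₃) := by abel
      _ = 2 := by rw [hz]; norm_num
  have q : ∀ z : A, z * z = z → (1 - z) * (1 - z) = 1 - z := fun z h => by
    rw [sub_mul, one_mul, mul_sub, mul_one, h]; abel
  -- each pair of rays with distinct indices has exactly one common neighbour outside the bases
  calc _ = (y₁ * y₁ + y₂ * y₂ + y₃ * y₃ + x₁ * x₁ + x₂ * x₂ + x₃ * x₃) +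
        (y₁ * y₁ + y₂ * y₂ + y₃ * y₃ + x₁ * x₁ + x₂ * x₂ + x₃ * x₃) +
        (((y₁ + x₁) + (y₂ + x₂) + (y₃ + x₃)) * ((y₁ + x₁) + (y₂ + x₂) + (y₃ + x₃)) -
          ((y₁ + x₁) * (y₁ + x₁) + (y₂ + x₂) * (y₂ + x₂) + (y₃ + x₃) * (y₃ + x₃))) := by
        noncomm_ring
    _ = ((y₁ + x₁) + (y₂ + x₂) + (y₃ + x₃)) + ((y₁ + x₁) + (y₂ + x₂) + (y₃ + x₃)) +
        (2 * 2 - ((y₁ + x₁) + (y₂ + x₂) + (y₃ + x₃))) := by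
        rw [s, hy₁, hy₂, hy₃, hx₁, hx₂, hx₃]
        congr 1
        · rw [← s]; abel
        · rw [e₁, e₂, e₃, q _ hz₁, q _ hz₂, q _ hz₃, ← e₁, ← e₂, ← e₃, s]
    _ = 6 := by rw [s]; norm_num

/-- For YO-13 the defects of the rays of `yoApex` have sum `4 / 3 - ∑ j, P (apex j)`, which the value of
the witness bounds by `ε / 2`. -/
lemma yo_hasSmallDefect {P : Fin 13 → Matrix (Fin D) (Fin D) ℂ} (hε : 0 ≤ ε)
    (h : IsRealization (orthGraph yo13) yo13Weight (35 / 3 - ε) ε P)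
    (hn : NormalizedTriples (orthGraph yo13) P) :
    yoSystem.HasSmallDefect P (1 / 2) √ε := by
  have hadj : ∀ i j, YoOrth i j → (orthGraph yo13).Adj i j := fun i j hij =>
    ⟨hij.1, YoOrth.dotProduct_eq_zero hij⟩
  have hid : ∀ i, P i * P i = P i := fun i => (h.isProj i).isIdempotentElem.eq
  have hb : ∀ m, ∑ a, P (yoBasis m a) = 1 := by
    intro m
    refine eq_one_of_expect ?_ fun ψ hψ => ?_
    · rw [Matrix.IsHermitian, Matrix.conjTranspose_sum]
      exact Finset.sum_congr rfl fun a _ => conjTranspose_of_isStarProjection (h.isProj _)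
    · have ho := yoSystem.orth_basis m
      rw [Fin.sum_univ_three, expect_add, expect_add]
      exact hn _ _ _ (hadj _ _ (ho 0 1 (by decide))) (hadj _ _ (ho 0 2 (by decide)))
        (hadj _ _ (ho 1 2 (by decide))) ψ hψ
  refine ⟨h.isProj, fun i j hij => h.norm_mul_le hε (hadj i j hij), fun ψ hψ => ?_⟩
  change ∑ j : Fin 4, expect ((1 - (2 / 3 : ℝ) • ∑ m : Fin 3, P (yoNbr j m)) *
      (1 - (2 / 3 : ℝ) • ∑ m : Fin 3, P (yoNbr j m)) - P (yoApex j)) ψ +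
      1 / 4 * ∑ c : Fin 4, expect ((1 - ∑ a, P (yoBasis c a)) * (1 - ∑ a, P (yoBasis c a))) ψ ≤
    ∑ c : Fin 4, expect (∑ a, ∑ b, if a ≠ b then P (yoBasis c a) * P (yoBasis c b) else 0) ψ +
      1 / 2 * √ε ^ 2
  -- the bases sum to `1` exactly, and therefore have no overlaps
  have h1 : ∀ c, (∑ a, ∑ b, if a ≠ b then P (yoBasis c a) * P (yoBasis c b) else 0) = 0 := by
    intro c
    have h2 := sum_mul_sum_self (fun a => P (yoBasis c a)) fun a => h.isProj _
    simp only [hb, mul_one] at h2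
    exact (left_eq_add.1 h2)
  simp only [hb, h1, sub_self, mul_zero, expect_zero, Finset.sum_const_zero, add_zero, zero_add,
    Real.sq_sqrt hε, expect_one_sub_smul_sq_sub _ hψ]
  have hB : ∀ m, ∑ a, expect (P (yoBasis m a)) ψ = 1 := fun m => by
    rw [← expect_sum, hb, expect_one hψ]
  have b0 : expect (P 0) ψ + expect (P 1) ψ + expect (P 2) ψ = 1 :=
    (Fin.sum_univ_three _).symm.trans (hB 0)
  have b1 : expect (P 0) ψ + expect (P 3) ψ + expect (P 4) ψ = 1 :=
    (Fin.sum_univ_three _).symm.trans (hB 1)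
  have b2 : expect (P 1) ψ + expect (P 5) ψ + expect (P 6) ψ = 1 :=
    (Fin.sum_univ_three _).symm.trans (hB 2)
  have b3 : expect (P 2) ψ + expect (P 7) ψ + expect (P 8) ψ = 1 :=
    (Fin.sum_univ_three _).symm.trans (hB 3)
  have hT : ∑ j, expect (∑ m, P (yoNbr j m)) ψ = 4 := by
    simp only [expect_sum]
    have : ∑ j, ∑ m, expect (P (yoNbr j m)) ψ =
        (expect (P 4) ψ + expect (P 6) ψ + expect (P 8) ψ) +
        (expect (P 3) ψ + expect (P 5) ψ + expect (P 8) ψ) +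
        (expect (P 4) ψ + expect (P 5) ψ + expect (P 7) ψ) +
        (expect (P 3) ψ + expect (P 6) ψ + expect (P 7) ψ) := by
      rw [Fin.sum_univ_four]
      simp only [Fin.sum_univ_three]
      rfl
    rw [this]
    linarith
  have hTT : ∑ j, expect ((∑ m, P (yoNbr j m)) * ∑ m, P (yoNbr j m)) ψ = 6 := by
    rw [← expect_sum]
    have h2 := yo_sum_sq (z₁ := P 0) (z₂ := P 1) (z₃ := P 2) (y₁ := P 3) (y₂ := P 5) (y₃ := P 7)
      (x₁ := P 4) (x₂ := P 6) (x₃ := P 8) ((Fin.sum_univ_three _).symm.trans (hb 0))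
      ((Fin.sum_univ_three _).symm.trans (hb 1)) ((Fin.sum_univ_three _).symm.trans (hb 2))
      ((Fin.sum_univ_three _).symm.trans (hb 3)) (hid _) (hid _) (hid _) (hid _) (hid _) (hid _)
      (hid _) (hid _) (hid _)
    have h3 : ∑ j, (∑ m, P (yoNbr j m)) * ∑ m, P (yoNbr j m) = (6 : ℝ) • 1 := by
      rw [Fin.sum_univ_four]
      simp only [Fin.sum_univ_three]
      refine h2.trans ?_
      rw [← Algebra.algebraMap_eq_smul_one, map_ofNat]
    rw [h3, expect_smul, expect_one hψ, mul_one]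
  have hw := h.theta_le ψ hψ
  have hw' : ∑ i, yo13Weight i * expect (P i) ψ =
      3 * ((expect (P 0) ψ + expect (P 3) ψ + expect (P 4) ψ) +
        (expect (P 1) ψ + expect (P 5) ψ + expect (P 6) ψ) +
        (expect (P 2) ψ + expect (P 7) ψ + expect (P 8) ψ)) +
      2 * ∑ j, expect (P (yoApex j)) ψ := by
    rw [Fin.sum_univ_four]
    simp [Fin.sum_univ_succ, yo13Weight, yoApex]
    ring
  rw [hw', b1, b2, b3] at hw
  rw [Finset.sum_sub_distrib, Finset.sum_add_distrib, Finset.sum_sub_distrib, ← Finset.mul_sum,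
    ← Finset.mul_sum, hT, hTT]
  norm_num
  linarith

end YO

end CFR


namespace CFR

open scoped Matrix.Norms.L2Operator

section BBC

variable {D : ℕ} {ε : ℝ}

/-- The position, in each basis, of the neighbours of the first nine rays of BBC-21. -/
def bbcSlot : Fin 9 → Fin 4 → Fin 3 :=
  ![![0, 0, 0, 0], ![0, 2, 2, 2], ![0, 1, 1, 1], ![1, 0, 1, 2], ![1, 1, 2, 0],
    ![1, 2, 0, 1], ![2, 0, 2, 1], ![2, 2, 1, 0], ![2, 1, 0, 2]]

lemma bbcNbr_eq : ∀ p m, bbcNbr p m = bbcBasis m (bbcSlot p m) := by decide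

/-- Two lines of different parallel classes meet in exactly one point of the affine plane. -/
lemma bbcSlot_bijective {m m' : Fin 4} (h : m ≠ m') :
    Function.Bijective fun p => (bbcSlot p m, bbcSlot p m') := by
  rw [Fintype.bijective_iff_injective_and_card]
  have h1 : ∀ m m', m ≠ m' → ∀ p p', bbcSlot p m = bbcSlot p' m → bbcSlot p m' = bbcSlot p' m' →
      p = p' := by decide
  exact ⟨fun p p' hp => h1 m m' h p p' (congrArg Prod.fst hp) (congrArg Prod.snd hp), rfl⟩

lemma sum_bbcNbr {E : Type*} [AddCommMonoid E] (m : Fin 4) (x : Fin 21 → E) :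
    ∑ p, x (bbcNbr p m) = 3 • ∑ a, x (bbcBasis m a) := by
  obtain ⟨m', hm⟩ := exists_ne m
  have h := (bbcSlot_bijective hm.symm).sum_comp fun y => x (bbcBasis m y.1)
  simp only [bbcNbr_eq]
  rw [h, Fintype.sum_prod_type, Finset.smul_sum]
  simp

lemma sum_bbcNbr_mul {E : Type*} [Ring E] {m m' : Fin 4} (hm : m ≠ m') (x : Fin 21 → E) :
    ∑ p, x (bbcNbr p m) * x (bbcNbr p m') = (∑ a, x (bbcBasis m a)) * ∑ a, x (bbcBasis m' a) := by
  have h := (bbcSlot_bijective hm).sum_comp fun y => x (bbcBasis m y.1) * x (bbcBasis m' y.2)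
  simp only [bbcNbr_eq]
  rw [h, Fintype.sum_prod_type, Finset.sum_mul_sum]

lemma sum_bbcPoint_add_sum_bbcBasis {E : Type*} [AddCommMonoid E] (x : Fin 21 → E) :
    ∑ i, x i = ∑ p, x (bbcPoint p) + ∑ m, ∑ a, x (bbcBasis m a) := by
  rw [sum_sum_eq_sum_card_nsmul bbcBasis (fun i => if i < 9 then 0 else 1) (by decide)]
  have h := sum_sum_eq_sum_card_nsmul (fun p (_ : Fin 1) => bbcPoint p)
    (fun i => if i < 9 then 1 else 0) (by decide) x
  simp only [Finset.sum_const, Finset.card_univ, Fintype.card_fin, one_smul] at h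
  rw [h, ← Finset.sum_add_distrib]
  refine Finset.sum_congr rfl fun i _ => ?_
  split_ifs <;> simp

lemma bbc21Weight_point : ∀ p, bbc21Weight (bbcPoint p) = 4 := by
  intro p; fin_cases p <;> rfl

lemma bbc21Weight_basis : ∀ m a, bbc21Weight (bbcBasis m a) = 7 := by
  intro m a; fin_cases m <;> fin_cases a <;> rfl

/-- With `B m` the sum of the `m`-th basis, the squares that belong to the nine points have a sum that
depends only on the `B m` and their products, since two lines of different classes meet in one
point. -/
lemma bbc_hasSmallDefect {P : Fin 21 → Matrix (Fin D) (Fin D) ℂ} (hε : 0 ≤ ε)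
    (h : IsRealization (orthGraph bbc21) bbc21Weight (40 - ε) ε P) :
    bbcSystem.HasSmallDefect P (1 / 4) √ε := by
  have hne : ∀ i j, BbcOrth i j → i ≠ j := by decide +kernel
  have hadj : ∀ i j, BbcOrth i j → (orthGraph bbc21).Adj i j := fun i j hij =>
    ⟨hne i j hij, bbc21_orth hij⟩
  have hid : ∀ i, P i * P i = P i := fun i => (h.isProj i).isIdempotentElem.eq
  refine ⟨h.isProj, fun i j hij => h.norm_mul_le hε (hadj i j hij), fun ψ hψ => ?_⟩
  change ∑ j : Fin 9, expect ((1 - (1 / 2 : ℝ) • ∑ m : Fin 4, P (bbcNbr j m)) *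
      (1 - (1 / 2 : ℝ) • ∑ m : Fin 4, P (bbcNbr j m)) - P (bbcPoint j)) ψ +
      1 / 4 * ∑ c : Fin 4, expect ((1 - ∑ a, P (bbcBasis c a)) * (1 - ∑ a, P (bbcBasis c a))) ψ ≤
    ∑ c : Fin 4, expect (∑ a, ∑ b, if a ≠ b then P (bbcBasis c a) * P (bbcBasis c b) else 0) ψ +
      1 / 4 * √ε ^ 2
  obtain ⟨B, hB⟩ : ∃ B : Fin 4 → Matrix (Fin D) (Fin D) ℂ, ∀ m, ∑ a, P (bbcBasis m a) = B m :=
    ⟨_, fun _ => rfl⟩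
  have hBs : ∀ m, (B m)ᴴ = B m := fun m => by
    rw [← hB, Matrix.conjTranspose_sum]
    exact Finset.sum_congr rfl fun a _ => conjTranspose_of_isStarProjection (h.isProj _)
  have hF : ∀ m, expect (∑ a, ∑ b, if a ≠ b then P (bbcBasis m a) * P (bbcBasis m b) else 0) ψ =
      expect (B m * B m) ψ - expect (B m) ψ := fun m => by
    rw [← hB, sum_mul_sum_self (fun a => P (bbcBasis m a)) fun a => h.isProj _, expect_add]
    ring
  have hN : ∀ m, expect ((1 - B m) * (1 - B m)) ψ =
      1 - 2 * expect (B m) ψ + expect (B m * B m) ψ := fun m => by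
    have := expect_one_sub_smul_sq_sub (T := B m) (p := 0) 1 hψ
    rw [one_smul, sub_zero, expect_zero] at this
    rw [this]; ring
  have hT : ∑ j, expect (∑ m, P (bbcNbr j m)) ψ = 3 * ∑ m, expect (B m) ψ := by
    simp only [← expect_sum]
    rw [Finset.sum_comm]
    simp only [sum_bbcNbr, hB, expect_sum]
    rw [Finset.mul_sum]
    refine Finset.sum_congr rfl fun m _ => ?_
    rw [← Nat.cast_smul_eq_nsmul ℝ, expect_smul]
    norm_num
  have hTT : ∑ j, expect ((∑ m, P (bbcNbr j m)) * ∑ m, P (bbcNbr j m)) ψ =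
      ∑ m, ∑ m', if m = m' then 3 * expect (B m) ψ else expect (B m * B m') ψ := by
    simp only [← expect_sum, Finset.sum_mul_sum]
    rw [Finset.sum_comm, expect_sum]
    refine Finset.sum_congr rfl fun m _ => ?_
    rw [Finset.sum_comm, expect_sum]
    refine Finset.sum_congr rfl fun m' _ => ?_
    split_ifs with hm
    · subst hm
      simp only [hid, sum_bbcNbr, hB]
      rw [← Nat.cast_smul_eq_nsmul ℝ, expect_smul]
      norm_num
    · rw [sum_bbcNbr_mul hm, hB, hB]
  -- the mixed products of the bases are bounded by the squares, which cancel the overlaps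
  have hCS : ∀ m m', expect (B m * B m') ψ + expect (B m' * B m) ψ ≤
      expect (B m * B m) ψ + expect (B m' * B m') ψ := fun m m' => by
    have h1 := expect_conjTranspose_mul_self_nonneg (B m - B m') ψ
    rw [Matrix.conjTranspose_sub, hBs, hBs, sub_mul, mul_sub, mul_sub, expect_sub, expect_sub,
      expect_sub] at h1
    linarith
  have hw := h.theta_le ψ hψ
  rw [sum_bbcPoint_add_sum_bbcBasis] at hw
  simp only [bbc21Weight_point, bbc21Weight_basis, ← Finset.mul_sum, ← expect_sum, hB] at hw
  rw [expect_sum, expect_sum] at hw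
  simp only [hB, hF, hN, expect_one_sub_smul_sq_sub _ hψ, Real.sq_sqrt hε]
  rw [Finset.sum_sub_distrib, Finset.sum_add_distrib, Finset.sum_sub_distrib, ← Finset.mul_sum,
    ← Finset.mul_sum, hT, hTT]
  simp only [Fin.sum_univ_four, Fin.reduceEq, if_true, if_false] at hw ⊢
  norm_num
  have c01 := hCS 0 1
  have c02 := hCS 0 2
  have c03 := hCS 0 3
  have c12 := hCS 1 2
  have c13 := hCS 1 3
  have c23 := hCS 2 3
  linarith

end BBC

section CEG

variable {D : ℕ} {ε : ℝ}

lemma t_mul_t : t * t = 2 := by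
  rw [t, ← Complex.ofReal_mul, Real.mul_self_sqrt (by norm_num)]
  norm_num

lemma star_t : star t = t := by
  rw [t, Complex.star_def, Complex.conj_ofReal]

lemma t_ne_zero : t ≠ 0 := fun h => by
  have := t_mul_t
  rw [h] at this
  norm_num at this

/-- The rotation that takes eighteen of the rays of Peres to those of CEG-18. -/
noncomputable def cegRotation : Matrix (Fin 4) (Fin 4) ℂ :=
  !![1, 0, 0, 0; 0, -1, 0, 0; 0, 0, t / 2, t / 2; 0, 0, t / 2, -(t / 2)]

lemma cegRotation_isometry : cegRotationᴴ * cegRotation = 1 := by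
  have h := t_mul_t
  have h' : (starRingEnd ℂ) t = t := star_t
  ext i j
  fin_cases i <;> fin_cases j <;>
    simp [cegRotation, Matrix.mul_apply, Fin.sum_univ_four, h'] <;> grind

/-- The scale factors of the rotated rays. -/
noncomputable def cegScale : Fin 18 → ℂ :=
  ![1, -1, t / 2, t / 2, 1, 1, -1, 1, t, -t, t, -1, 1, 1, t, -t, -t, t]

lemma cegScale_ne_zero (i : Fin 18) : cegScale i ≠ 0 := by
  have h := t_ne_zero
  fin_cases i <;> simp [cegScale, h]

lemma ceg18_eq (i : Fin 18) :
    ceg18 i = cegScale i • (cegRotation *ᵥ peres24 (cegPeres i)) := by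
  have h := t_mul_t
  have h1 : peres24 (cegPeres i) = fun a => (peresInt (cegPeres i) a : ℂ) := funext (peres24_eq _)
  rw [h1]
  ext a
  fin_cases i <;> fin_cases a <;>
    simp [ceg18, cegScale, cegRotation, cegPeres, peresInt, dotProduct,
      Fin.sum_univ_four] <;> grind

lemma ceg18_dotProduct (i j : Fin 18) : star (ceg18 i) ⬝ᵥ ceg18 j =
    star (cegScale i) * cegScale j * (star (peres24 (cegPeres i)) ⬝ᵥ peres24 (cegPeres j)) := by
  rw [ceg18_eq, ceg18_eq, star_smul, Matrix.star_mulVec, smul_dotProduct, dotProduct_smul,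
    ← Matrix.dotProduct_mulVec, Matrix.mulVec_mulVec, cegRotation_isometry, Matrix.one_mulVec,
    smul_eq_mul, smul_eq_mul, mul_assoc]

lemma ceg18_ne (i : Fin 18) : star (ceg18 i) ⬝ᵥ ceg18 i ≠ 0 := by
  rw [ceg18_dotProduct]
  exact mul_ne_zero (mul_ne_zero (star_ne_zero.2 (cegScale_ne_zero i)) (cegScale_ne_zero i))
    (peres24_ne _)

lemma ceg18_orth {i j : Fin 18} (h : PeresOrth (cegPeres i) (cegPeres j)) :
    star (ceg18 i) ⬝ᵥ ceg18 j = 0 := by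
  rw [ceg18_dotProduct, h.dotProduct_eq_zero, mul_zero]

lemma rankOneProj_ceg18 (i : Fin 18) : rankOneProj (ceg18 i) =
    cegRotation * rankOneProj (peres24 (cegPeres i)) * cegRotationᴴ := by
  have h := cegScale_ne_zero i
  have h' : star (cegScale i) ≠ 0 := star_ne_zero.2 h
  rw [rankOneProj, ceg18_dotProduct, ceg18_eq, rankOneProj, star_smul, Matrix.star_mulVec,
    Matrix.smul_vecMulVec, Matrix.vecMulVec_smul, smul_smul, smul_smul, Matrix.mul_smul,
    Matrix.smul_mul, Matrix.mul_vecMulVec, Matrix.vecMulVec_mul]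
  congr 1
  field_simp

/-- Each ray of CEG-18 lies in two of the nine bases, so that the bases have total weight at least
`2 (9 / 2 - ε) = 9 - 2 ε`. -/
lemma ceg_approx {P : Fin 18 → Matrix (Fin D) (Fin D) ℂ} (hε : 0 ≤ ε) (hε1 : ε ≤ 1)
    (h : IsRealization (orthGraph ceg18) (fun _ => 1) (9 / 2 - ε) ε P) :
    cegSystem.Approx ((1 + (2 + (9 : ℕ) * (4 : ℕ) ^ 2)) * √ε) P := by
  have hne : ∀ i j, PeresOrth (cegPeres i) (cegPeres j) → i ≠ j := fun i j hij hi =>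
    hij.1 (congrArg cegPeres hi)
  refine cegSystem.approx_of_sum_le rfl h.isProj (Real.sqrt_nonneg _) (by norm_num)
    (fun i j hij => h.norm_mul_le hε ⟨hne i j hij, ceg18_orth hij⟩) fun ψ hψ => ?_
  change ((9 : ℕ) : ℝ) - _ ≤ ∑ m, expect (∑ a, P (cegBasis m a)) ψ
  simp only [expect_sum]
  rw [sum_sum_eq_sum_card_nsmul cegBasis (fun _ => 2) (by decide) fun i => expect (P i) ψ]
  have h1 := h.theta_le ψ hψ
  have h2 := sq_sqrt_le_of_le_one hε hε1
  simp only [one_mul] at h1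
  rw [← Finset.smul_sum, nsmul_eq_mul]
  push_cast
  linarith

end CEG

end CFR


/-! ### The ideal realizations -/

namespace CFR

open scoped Matrix.Norms.L2Operator

/-- The projections on the vectors of an orthogonal basis sum to `1`. -/
lemma sum_rankOneProj_eq_one {d : ℕ} (v : Fin d → Fin d → ℂ) (hv : ∀ a, star (v a) ⬝ᵥ v a ≠ 0)
    (ho : ∀ a b, a ≠ b → star (v a) ⬝ᵥ v b = 0) : ∑ a, rankOneProj (v a) = 1 := by
  let A : Matrix (Fin d) (Fin d) ℂ := Matrix.of fun a i => (star (v a) ⬝ᵥ v a)⁻¹ * star (v a i)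
  let B : Matrix (Fin d) (Fin d) ℂ := Matrix.of fun i a => v a i
  have h1 : A * B = 1 := by
    ext a b
    have h2 : (A * B) a b = (star (v a) ⬝ᵥ v a)⁻¹ * (star (v a) ⬝ᵥ v b) := by
      simp only [A, B, Matrix.mul_apply, Matrix.of_apply, dotProduct, Finset.mul_sum, mul_assoc,
        Pi.star_apply]
    rw [h2, Matrix.one_apply]
    split_ifs with hab
    · rw [← hab, inv_mul_cancel₀ (hv a)]
    · rw [ho a b hab, mul_zero]
  rw [← mul_eq_one_comm.1 h1]
  ext i j
  simp only [A, B, Matrix.sum_apply, Matrix.mul_apply, Matrix.of_apply, rankOneProj_apply]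
  exact Finset.sum_congr rfl fun a _ => by ring

lemma isRealization_rankOneProj {n d : ℕ} {v : Fin n → Fin d → ℂ} {w : Fin n → ℝ} {Q : ℝ}
    (hv : ∀ i, star (v i) ⬝ᵥ v i ≠ 0) (hα : weightedIndepNum (orthGraph v) w < Q)
    (hQ : ∑ i, w i • rankOneProj (v i) = Q • 1) :
    IsRealization (orthGraph v) w Q 0 fun i => rankOneProj (v i) := by
  refine ⟨fun i => isStarProjection_rankOneProj (hv i), hα, fun ψ hψ => ?_, fun i j hij ψ _ => ?_⟩
  · have h := congrArg (fun A => expect A ψ) hQ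
    simp only [expect_sum, expect_smul, expect_one hψ, mul_one] at h
    exact h.ge
  · rw [rankOneProj_mul_eq_zero hij.2, Matrix.zero_mul, expect_zero]

/-- A bound on the weighted independence number for integral weights, by means of the indicator
functions of the independent sets. -/
lemma weightedIndepNum_lt {n : ℕ} {G : SimpleGraph (Fin n)} {w : Fin n → ℝ} (k : Fin n → ℕ)
    (hk : ∀ i, w i = k i) (B : ℕ) {Q : ℝ} (hB : (B : ℝ) < Q)
    (h : ∀ x : Fin n → ℕ, (∀ i, x i ≤ 1) → (∀ i j, G.Adj i j → x i + x j ≤ 1) →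
      ∑ i, k i * x i ≤ B) : weightedIndepNum G w < Q := by
  classical
  refine lt_of_le_of_lt (csSup_le ⟨0, ∅, by simp, by simp⟩ ?_) hB
  rintro _ ⟨s, hs, rfl⟩
  have h1 := h (fun i => if i ∈ s then 1 else 0) (fun i => by split_ifs <;> simp) fun i j hij => by
    by_cases hi : i ∈ s
    · by_cases hj : j ∈ s
      · exact absurd hij (hs hi hj hij.ne)
      · simp [hi, hj]
    · simp only [hi, if_false, zero_add]
      split_ifs <;> simp
  calc ∑ i ∈ s, w i = ((∑ i, k i * if i ∈ s then 1 else 0 : ℕ) : ℝ) := by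
        simp [Finset.sum_ite_mem, hk]
    _ ≤ B := by exact_mod_cast h1

/-- The indicator function of an independent set has sum at most `1` on a clique. -/
lemma sum_le_one_of_clique {n d : ℕ} {x : Fin n → ℕ} (hx : ∀ i, x i ≤ 1) (f : Fin d → Fin n)
    (h : ∀ a b, a ≠ b → x (f a) + x (f b) ≤ 1) : ∑ a, x (f a) ≤ 1 := by
  by_cases h0 : ∃ a, x (f a) = 1
  · obtain ⟨a, ha⟩ := h0
    rw [Finset.sum_eq_single a (fun b _ hb => by have := h b a hb; omega) (by simp)]
    exact hx _
  · push Not at h0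
    have h1 : ∀ a, x (f a) = 0 := fun a => by
      have := hx (f a)
      have := h0 a
      omega
    simp [h1]

/-- Each of the eighteen rays lies in two of the nine bases, so that an independent set has at most
`9 / 2` rays, hence at most four. -/
lemma ceg18_indep : weightedIndepNum (orthGraph ceg18) (fun _ => 1) < 9 / 2 := by
  refine weightedIndepNum_lt (fun _ => 1) (by simp) 4 (by norm_num) fun x hx ho => ?_
  have hne : ∀ m a b, a ≠ b → PeresOrth (cegPeres (cegBasis m a)) (cegPeres (cegBasis m b)) := by
    decide
  have h1 : ∑ m, ∑ a, x (cegBasis m a) ≤ ∑ m : Fin 9, 1 := Finset.sum_le_sum fun m _ =>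
    sum_le_one_of_clique hx _ fun a b hab => ho _ _
      ⟨fun h => (hne m a b hab).1 (congrArg cegPeres h), ceg18_orth (hne m a b hab)⟩
  rw [sum_sum_eq_sum_card_nsmul cegBasis (fun _ => 2) (by decide), ← Finset.smul_sum] at h1
  simp only [one_mul]
  simp only [smul_eq_mul, Finset.sum_const, Finset.card_univ, Fintype.card_fin] at h1
  omega

/-- An independent set of six rays would meet each of the 24 bases exactly once, and thus also the
nine bases of CEG-18; but each of the eighteen rays lies in two of these. -/
lemma peres24_indep : weightedIndepNum (orthGraph peres24) (fun _ => 1) < 6 := by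
  refine weightedIndepNum_lt (fun _ => 1) (by simp) 5 (by norm_num) fun x hx ho => ?_
  have hne : ∀ m a b, a ≠ b → PeresOrth (peresBasis m a) (peresBasis m b) := by decide
  have h0 : ∀ m, ∑ a, x (peresBasis m a) ≤ 1 := fun m =>
    sum_le_one_of_clique hx _ fun a b hab => ho _ _
      ⟨(hne m a b hab).1, (hne m a b hab).dotProduct_eq_zero⟩
  simp only [one_mul]
  by_contra! h6
  have h1 := sum_sum_eq_sum_card_nsmul peresBasis (fun _ => 4) (by decide +kernel) x
  rw [← Finset.smul_sum, smul_eq_mul] at h1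
  have h2 : ∀ m, ∑ a, x (peresBasis m a) = 1 := by
    have h3 : ∑ m, ∑ a, x (peresBasis m a) = ∑ m : Fin 24, 1 := by
      refine le_antisymm (Finset.sum_le_sum fun m _ => h0 m) ?_
      rw [h1, Finset.sum_const, Finset.card_univ, Fintype.card_fin, smul_eq_mul]
      omega
    exact fun m => (Finset.sum_eq_sum_iff_of_le fun m _ => h0 m).1 h3 m (Finset.mem_univ m)
  -- the nine bases of CEG-18
  have e9 : x 14 + x 15 + x 0 + x 1 = 1 := (Fin.sum_univ_four _).symm.trans (h2 9)
  have e16 : x 18 + x 19 + x 0 + x 2 = 1 := (Fin.sum_univ_four _).symm.trans (h2 16)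
  have e17 : x 20 + x 21 + x 1 + x 2 = 1 := (Fin.sum_univ_four _).symm.trans (h2 17)
  have e7 : x 13 + x 14 + x 8 + x 9 = 1 := (Fin.sum_univ_four _).symm.trans (h2 7)
  have e14 : x 17 + x 18 + x 8 + x 10 = 1 := (Fin.sum_univ_four _).symm.trans (h2 14)
  have e21 : x 21 + x 22 + x 9 + x 10 = 1 := (Fin.sum_univ_four _).symm.trans (h2 21)
  have e8 : x 13 + x 15 + x 4 + x 5 = 1 := (Fin.sum_univ_four _).symm.trans (h2 8)
  have e15 : x 17 + x 19 + x 4 + x 6 = 1 := (Fin.sum_univ_four _).symm.trans (h2 15)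
  have e19 : x 20 + x 22 + x 5 + x 6 = 1 := (Fin.sum_univ_four _).symm.trans (h2 19)
  omega

lemma yo13_indep : weightedIndepNum (orthGraph yo13) yo13Weight < 35 / 3 := by
  refine weightedIndepNum_lt ![3, 3, 3, 3, 3, 3, 3, 3, 3, 2, 2, 2, 2]
    (fun i => by fin_cases i <;> simp [yo13Weight]) 11 (by norm_num) fun x hx ho => ?_
  have ho' : ∀ i j, YoOrth i j → x i + x j ≤ 1 := fun i j hij =>
    ho i j ⟨hij.1, hij.dotProduct_eq_zero⟩
  have hb : ∀ m, ∑ a, x (yoBasis m a) ≤ 1 := fun m =>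
    sum_le_one_of_clique hx _ fun a b hab => ho' _ _ (yoSystem.orth_basis m a b hab)
  have hn : ∀ j m, x (yoApex j) + x (yoNbr j m) ≤ 1 := fun j m => ho' _ _ (yoSystem.orth_nbr j m)
  have b0 : x 0 + x 1 + x 2 ≤ 1 := (Fin.sum_univ_three _).symm.trans_le (hb 0)
  have b1 : x 0 + x 3 + x 4 ≤ 1 := (Fin.sum_univ_three _).symm.trans_le (hb 1)
  have b2 : x 1 + x 5 + x 6 ≤ 1 := (Fin.sum_univ_three _).symm.trans_le (hb 2)
  have b3 : x 2 + x 7 + x 8 ≤ 1 := (Fin.sum_univ_three _).symm.trans_le (hb 3)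
  have n00 : x 9 + x 4 ≤ 1 := hn 0 0
  have n01 : x 9 + x 6 ≤ 1 := hn 0 1
  have n02 : x 9 + x 8 ≤ 1 := hn 0 2
  have n10 : x 10 + x 3 ≤ 1 := hn 1 0
  have n11 : x 10 + x 5 ≤ 1 := hn 1 1
  have n12 : x 10 + x 8 ≤ 1 := hn 1 2
  have n20 : x 11 + x 4 ≤ 1 := hn 2 0
  have n21 : x 11 + x 5 ≤ 1 := hn 2 1
  have n22 : x 11 + x 7 ≤ 1 := hn 2 2
  have n30 : x 12 + x 3 ≤ 1 := hn 3 0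
  have n31 : x 12 + x 6 ≤ 1 := hn 3 1
  have n32 : x 12 + x 7 ≤ 1 := hn 3 2
  have h9 : x 9 = 0 ∨ x 9 = 1 := Nat.le_one_iff_eq_zero_or_eq_one.1 (hx 9)
  have h10 : x 10 = 0 ∨ x 10 = 1 := Nat.le_one_iff_eq_zero_or_eq_one.1 (hx 10)
  have h11 : x 11 = 0 ∨ x 11 = 1 := Nat.le_one_iff_eq_zero_or_eq_one.1 (hx 11)
  have h12 : x 12 = 0 ∨ x 12 = 1 := Nat.le_one_iff_eq_zero_or_eq_one.1 (hx 12)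
  have hsum : ∑ i, ![3, 3, 3, 3, 3, 3, 3, 3, 3, 2, 2, 2, 2] i * x i =
      3 * (x 0 + x 1 + x 2 + x 3 + x 4 + x 5 + x 6 + x 7 + x 8) +
        2 * (x 9 + x 10 + x 11 + x 12) := by
    simp [Fin.sum_univ_succ]
    ring
  rw [hsum]
  rcases h9 with h9 | h9 <;> rcases h10 with h10 | h10 <;> rcases h11 with h11 | h11 <;>
    rcases h12 with h12 | h12 <;> omega

/-- An independent set of BBC-21 contains at most one ray of each basis, and the remaining rays are
the points of the affine plane that lie on none of the corresponding lines. -/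
lemma bbc21_indep : weightedIndepNum (orthGraph bbc21) bbc21Weight < 40 := by
  refine weightedIndepNum_lt ![4, 4, 4, 4, 4, 4, 4, 4, 4, 7, 7, 7, 7, 7, 7, 7, 7, 7, 7, 7, 7]
    (fun i => by fin_cases i <;> simp [bbc21Weight]) 36 (by norm_num) fun x hx ho => ?_
  have hne : ∀ i j, BbcOrth i j → i ≠ j := by decide +kernel
  have ho' : ∀ i j, BbcOrth i j → x i + x j ≤ 1 := fun i j hij =>
    ho i j ⟨hne i j hij, bbc21_orth hij⟩
  -- the ray of the independent set in each basis; the value `3` means that there is none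
  have hc : ∀ m, ∃ k : Fin 4, ∀ a, x (bbcBasis m a) = if a.castSucc = k then 1 else 0 := by
    intro m
    have h01 := ho' _ _ (bbcSystem.orth_basis m 0 1 (by decide))
    have h02 := ho' _ _ (bbcSystem.orth_basis m 0 2 (by decide))
    have h12 := ho' _ _ (bbcSystem.orth_basis m 1 2 (by decide))
    change x (bbcBasis m 0) + x (bbcBasis m 1) ≤ 1 at h01
    change x (bbcBasis m 0) + x (bbcBasis m 2) ≤ 1 at h02
    change x (bbcBasis m 1) + x (bbcBasis m 2) ≤ 1 at h12
    rcases Nat.le_one_iff_eq_zero_or_eq_one.1 (hx (bbcBasis m 0)) with h0 | h0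
    · rcases Nat.le_one_iff_eq_zero_or_eq_one.1 (hx (bbcBasis m 1)) with h1 | h1
      · rcases Nat.le_one_iff_eq_zero_or_eq_one.1 (hx (bbcBasis m 2)) with h2 | h2
        · exact ⟨3, by rw [Fin.forall_fin_succ, Fin.forall_fin_two]; exact ⟨h0, h1, h2⟩⟩
        · exact ⟨2, by rw [Fin.forall_fin_succ, Fin.forall_fin_two]; exact ⟨h0, h1, h2⟩⟩
      · exact ⟨1, by rw [Fin.forall_fin_succ, Fin.forall_fin_two]
                     exact ⟨h0, h1, show x (bbcBasis m 2) = 0 by omega⟩⟩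
    · exact ⟨0, by rw [Fin.forall_fin_succ, Fin.forall_fin_two]
                   exact ⟨h0, show x (bbcBasis m 1) = 0 by omega,
                     show x (bbcBasis m 2) = 0 by omega⟩⟩
  choose c hc using hc
  have hp : ∀ p, x (bbcPoint p) ≤ if ∃ m, (bbcSlot p m).castSucc = c m then 0 else 1 := by
    intro p
    split_ifs with h
    · obtain ⟨m, hm⟩ := h
      have h1 := ho' _ _ (bbcSystem.orth_nbr p m)
      change x (bbcPoint p) + x (bbcNbr p m) ≤ 1 at h1
      rw [bbcNbr_eq, hc, if_pos hm] at h1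
      omega
    · exact hx _
  have hw := sum_bbcPoint_add_sum_bbcBasis fun i =>
    ![4, 4, 4, 4, 4, 4, 4, 4, 4, 7, 7, 7, 7, 7, 7, 7, 7, 7, 7, 7, 7] i * x i
  have hw4 : ∀ p, ![4, 4, 4, 4, 4, 4, 4, 4, 4, 7, 7, 7, 7, 7, 7, 7, 7, 7, 7, 7, 7] (bbcPoint p) =
      4 := by decide
  have hw7 : ∀ m a, ![4, 4, 4, 4, 4, 4, 4, 4, 4, 7, 7, 7, 7, 7, 7, 7, 7, 7, 7, 7, 7]
      (bbcBasis m a) = 7 := by decide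
  -- the weight of at most one line of each class and of the points on none of these lines
  have hfin : ∀ c : Fin 4 → Fin 4, ∑ p, (4 * if ∃ m, (bbcSlot p m).castSucc = c m then 0 else 1) +
      ∑ m, ∑ a : Fin 3, (7 * if a.castSucc = c m then 1 else 0) ≤ 36 := by decide +kernel
  simp only [hw4, hw7, hc] at hw
  rw [hw]
  refine le_trans ?_ (hfin c)
  gcongr with p
  exact hp p

end CFR


namespace CFR

open scoped Matrix.Norms.L2Operator

lemma ceg18_isRealization :
    IsRealization (orthGraph ceg18) (fun _ => 1) (9 / 2) 0 fun i => rankOneProj (ceg18 i) := by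
  refine isRealization_rankOneProj ceg18_ne ceg18_indep ?_
  have hb : ∀ m, ∑ a, rankOneProj (ceg18 (cegBasis m a)) = 1 := fun m =>
    sum_rankOneProj_eq_one (fun a => ceg18 (cegBasis m a)) (fun a => ceg18_ne _)
      fun a b hab => ceg18_orth (cegSystem.orth_basis m a b hab)
  have h := sum_sum_eq_sum_card_nsmul cegBasis (fun _ => 2) (by decide)
    fun i => rankOneProj (ceg18 i)
  simp only [hb, ← Finset.smul_sum, Finset.sum_const, Finset.card_univ, Fintype.card_fin] at h
  rw [← Nat.cast_smul_eq_nsmul ℝ, ← Nat.cast_smul_eq_nsmul ℝ 2] at h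
  simp only [one_smul]
  calc ∑ i, rankOneProj (ceg18 i) = (1 / 2 : ℝ) • ((2 : ℕ) : ℝ) • ∑ i, rankOneProj (ceg18 i) := by
        rw [smul_smul]; norm_num
    _ = _ := by rw [← h, smul_smul]; norm_num

lemma peres24_isRealization :
    IsRealization (orthGraph peres24) (fun _ => 1) 6 0 fun i => rankOneProj (peres24 i) := by
  refine isRealization_rankOneProj peres24_ne peres24_indep ?_
  have hb : ∀ m, ∑ a, rankOneProj (peres24 (peresBasis m a)) = 1 := fun m =>
    sum_rankOneProj_eq_one (fun a => peres24 (peresBasis m a)) (fun a => peres24_ne _)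
      fun a b hab => (peresSystem.orth_basis m a b hab).dotProduct_eq_zero
  have h := sum_sum_eq_sum_card_nsmul peresBasis (fun _ => 4) (by decide +kernel)
    fun i => rankOneProj (peres24 i)
  simp only [hb, ← Finset.smul_sum, Finset.sum_const, Finset.card_univ, Fintype.card_fin] at h
  rw [← Nat.cast_smul_eq_nsmul ℝ, ← Nat.cast_smul_eq_nsmul ℝ 4] at h
  simp only [one_smul]
  calc ∑ i, rankOneProj (peres24 i) =
        (1 / 4 : ℝ) • ((4 : ℕ) : ℝ) • ∑ i, rankOneProj (peres24 i) := by
        rw [smul_smul]; norm_num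
    _ = _ := by rw [← h, smul_smul]; norm_num

lemma rankOneProj_yo13_triple {i j k : Fin 13} (hij : (orthGraph yo13).Adj i j)
    (hik : (orthGraph yo13).Adj i k) (hjk : (orthGraph yo13).Adj j k) :
    rankOneProj (yo13 i) + rankOneProj (yo13 j) + rankOneProj (yo13 k) = 1 := by
  have h := sum_rankOneProj_eq_one ![yo13 i, yo13 j, yo13 k]
    (by intro a; fin_cases a <;> exact yo13_ne _)
    (by
      intro a b hab
      fin_cases a <;> fin_cases b <;>
        first
          | exact absurd rfl hab
          | exact hij.2
          | exact hik.2
          | exact hjk.2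
          | exact hij.symm.2
          | exact hik.symm.2
          | exact hjk.symm.2)
  rwa [Fin.sum_univ_three] at h

lemma yo13_normalizedTriples :
    NormalizedTriples (orthGraph yo13) fun i => rankOneProj (yo13 i) := by
  intro i j k hij hik hjk ψ hψ
  rw [← expect_add, ← expect_add, rankOneProj_yo13_triple hij hik hjk, expect_one hψ]

lemma sum_rankOneProj_yoApex : ∑ j, rankOneProj (yo13 (yoApex j)) = (4 / 3 : ℝ) • 1 := by
  ext a b
  rw [Matrix.sum_apply]
  simp only [rankOneProj_yo13_apply]
  fin_cases a <;> fin_cases b <;>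
    simp [Fin.sum_univ_four, Fin.sum_univ_three, yoApex, yoInt] <;> norm_num

lemma yo13_isRealization :
    IsRealization (orthGraph yo13) yo13Weight (35 / 3) 0 fun i => rankOneProj (yo13 i) := by
  refine isRealization_rankOneProj yo13_ne yo13_indep ?_
  have hadj : ∀ i j, YoOrth i j → (orthGraph yo13).Adj i j := fun i j hij =>
    ⟨hij.1, hij.dotProduct_eq_zero⟩
  have b1 := rankOneProj_yo13_triple (hadj 0 3 (by decide)) (hadj 0 4 (by decide))
    (hadj 3 4 (by decide))
  have b2 := rankOneProj_yo13_triple (hadj 1 5 (by decide)) (hadj 1 6 (by decide))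
    (hadj 5 6 (by decide))
  have b3 := rankOneProj_yo13_triple (hadj 2 7 (by decide)) (hadj 2 8 (by decide))
    (hadj 7 8 (by decide))
  have h : ∑ i, yo13Weight i • rankOneProj (yo13 i) = (3 : ℝ) •
      ((rankOneProj (yo13 0) + rankOneProj (yo13 3) + rankOneProj (yo13 4)) +
        (rankOneProj (yo13 1) + rankOneProj (yo13 5) + rankOneProj (yo13 6)) +
        (rankOneProj (yo13 2) + rankOneProj (yo13 7) + rankOneProj (yo13 8))) +
      (2 : ℝ) • ∑ j, rankOneProj (yo13 (yoApex j)) := by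
    rw [Fin.sum_univ_four]
    simp [Fin.sum_univ_succ, yo13Weight, yoApex]
    module
  rw [h, b1, b2, b3, sum_rankOneProj_yoApex]
  module

lemma bbc21_isRealization :
    IsRealization (orthGraph bbc21) bbc21Weight 40 0 fun i => rankOneProj (bbc21 i) := by
  refine isRealization_rankOneProj bbc21_ne bbc21_indep ?_
  have hb : ∀ m, ∑ a, rankOneProj (bbc21 (bbcBasis m a)) = 1 := fun m =>
    sum_rankOneProj_eq_one (fun a => bbc21 (bbcBasis m a)) (fun a => bbc21_ne _)
      fun a b hab => bbc21_orth (bbcSystem.orth_basis m a b hab)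
  -- each line has three points
  have hn : ∑ p, ∑ m, rankOneProj (bbc21 (bbcNbr p m)) = (12 : ℝ) • 1 := by
    rw [Finset.sum_comm]
    simp only [sum_bbcNbr _ fun i => rankOneProj (bbc21 i), hb]
    rw [Finset.sum_const, Finset.card_univ, Fintype.card_fin]
    module
  rw [sum_bbcPoint_add_sum_bbcBasis]
  simp only [bbc21Weight_point, bbc21Weight_basis, ← Finset.smul_sum, hb, rankOneProj_bbc21_point,
    Finset.sum_sub_distrib, hn]
  rw [Finset.sum_const, Finset.sum_const, Finset.card_univ, Finset.card_univ, Fintype.card_fin,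
    Fintype.card_fin]
  module

end CFR


/-! ### Robust certification -/

namespace CFR

open scoped Matrix.Norms.L2Operator

/-- There is an isometry from a space of dimension at most `D` to `ℂ^D`. -/
lemma exists_isometry_of_card_le {D : ℕ} {n : Type*} [Fintype n] [DecidableEq n]
    (h : Fintype.card n ≤ D) : ∃ V : Matrix (Fin D) n ℂ, Vᴴ * V = 1 := by
  obtain ⟨f⟩ : Nonempty (n ↪ Fin D) := Function.Embedding.nonempty_of_card_le (by simpa using h)
  refine ⟨(1 : Matrix (Fin D) (Fin D) ℂ).submatrix id f, ?_⟩
  rw [Matrix.conjTranspose_submatrix, Matrix.conjTranspose_one,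
    ← Matrix.submatrix_mul _ _ _ _ _ Function.bijective_id, mul_one]
  exact Matrix.submatrix_one f f.injective

/-- For robust certification it suffices to consider small `ε`: two projections never differ by more
than a constant. -/
theorem robustCFR_of_small {n d : ℕ} {v : Fin n → Fin d → ℂ} {w : Fin n → ℝ} {Q ε₀ : ℝ}
    {extra : ∀ {D : ℕ}, (Fin n → Matrix (Fin D) (Fin D) ℂ) → Prop}
    (hv : ∀ i, star (v i) ⬝ᵥ v i ≠ 0)
    (hideal : IsRealization (orthGraph v) w Q 0 fun i => rankOneProj (v i))
    (hextra : extra fun i => rankOneProj (v i))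
    {C η₀ : ℝ} (hη₀ : 0 < η₀) (h : ∀ ε : ℝ, 0 ≤ ε → ε < ε₀ → √ε ≤ η₀ →
      ∀ (D : ℕ) (P : Fin n → Matrix (Fin D) (Fin D) ℂ),
        IsRealization (orthGraph v) w (Q - ε) ε P → extra P →
        ∃ m₁ m₂ : ℕ, m₁ + m₂ = D / d ∧
          ∃ V : Matrix (Fin D) ((Fin d × Fin m₁) ⊕ (Fin d × Fin m₂)) ℂ, Vᴴ * V = 1 ∧
            ∀ i, ‖V * amplify m₁ m₂ (rankOneProj (v i)) * Vᴴ - P i‖ ≤ C * √ε) :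
    RobustCFR v w Q extra ε₀ (1 / 2) := by
  refine ⟨⟨hideal, hextra⟩, max C ((2 * d ^ 2 + 1) / η₀), fun ε hε hε₀ D P hP hx => ?_⟩
  rw [← Real.sqrt_eq_rpow]
  rcases le_or_gt (√ε) η₀ with hs | hs
  · obtain ⟨m₁, m₂, hm, V, hV, hVP⟩ := h ε hε hε₀ hs D P hP hx
    refine ⟨m₁, m₂, hm, V, hV, fun i => ?_⟩
    rw [opNorm_eq_norm]
    exact (hVP i).trans (mul_le_mul_of_nonneg_right (le_max_left _ _) (Real.sqrt_nonneg _))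
  · obtain ⟨V, hV⟩ := exists_isometry_of_card_le (D := D)
      (n := (Fin d × Fin (D / d)) ⊕ (Fin d × Fin 0)) (by
        simpa using Nat.mul_div_le D d)
    refine ⟨D / d, 0, by simp, V, hV, fun i => ?_⟩
    rw [opNorm_eq_norm]
    have hV1 : ‖V‖ ≤ 1 := norm_le_one_of_isometry hV
    have hVs1 : ‖Vᴴ‖ ≤ 1 := by rwa [Matrix.l2_opNorm_conjTranspose]
    calc ‖V * amplify (D / d) 0 (rankOneProj (v i)) * Vᴴ - P i‖
        ≤ 1 * (2 * d ^ 2) * 1 + 1 := (norm_sub_le _ _).trans (add_le_add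
          (norm_mul_le_of_le' (norm_mul_le_of_le' hV1
            (norm_amplify_le _ _ (norm_rankOneProj_entry_le (hv i)))) hVs1)
          (norm_le_one_of_isStarProjection (hP.isProj i)))
      _ = (2 * d ^ 2 + 1) / η₀ * η₀ := by field_simp
      _ ≤ max C ((2 * d ^ 2 + 1) / η₀) * √ε := mul_le_mul (le_max_right _ _) hs.le hη₀.le
          (le_max_of_le_right (by positivity))

lemma amplify_mul {d m₁ m₂ : ℕ} (A B : Matrix (Fin d) (Fin d) ℂ) :
    amplify m₁ m₂ (A * B) = amplify m₁ m₂ A * amplify m₁ m₂ B := by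
  have h : (A * B).map star = A.map star * B.map star := Matrix.map_mul (f := starRingEnd ℂ)
  rw [amplify, amplify, amplify, Matrix.fromBlocks_multiply, h]
  simp only [← Matrix.mul_kronecker_mul, mul_one, Matrix.mul_zero, Matrix.zero_mul, add_zero,
    zero_add]

/-- A system whose relations hold approximately in each realization gives robust certification, also
of the ideal family in rotated coordinates. -/
theorem RigidSystem.robustCFR {n d : ℕ} [NeZero d] (S : RigidSystem n d) {v : Fin n → Fin d → ℂ}
    {w : Fin n → ℝ} {Q ε₀ : ℝ}
    {extra : ∀ {D : ℕ}, (Fin n → Matrix (Fin D) (Fin D) ℂ) → Prop}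
    (hv : ∀ i, star (v i) ⬝ᵥ v i ≠ 0) {U : Matrix (Fin d) (Fin d) ℂ} (hU : Uᴴ * U = 1)
    (hM : ∀ i, rankOneProj (v i) = U * S.M i * Uᴴ)
    (hideal : IsRealization (orthGraph v) w Q 0 fun i => rankOneProj (v i))
    (hextra : extra fun i => rankOneProj (v i))
    (h : ∃ C η₀ : ℝ, 0 < η₀ ∧ ∀ ε : ℝ, 0 ≤ ε → ε < ε₀ → √ε ≤ η₀ →
      ∀ (D : ℕ) (P : Fin n → Matrix (Fin D) (Fin D) ℂ),
        IsRealization (orthGraph v) w (Q - ε) ε P → extra P → S.IsNear (C * √ε) P) :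
    RobustCFR v w Q extra ε₀ (1 / 2) := by
  obtain ⟨C, η₀, hη₀, h⟩ := h
  refine robustCFR_of_small hv hideal hextra hη₀ (C := C) fun ε hε hε₀ hs D P hP hx => ?_
  obtain ⟨m₁, m₂, hm, V, hV, -, hVP⟩ := h ε hε hε₀ hs D P hP hx
  have hU1 : (amplify m₁ m₂ U)ᴴ * amplify m₁ m₂ U = 1 := by
    rw [amplify_conjTranspose, ← amplify_mul, hU, amplify_one]
  have hU2 : amplify m₁ m₂ U * (amplify m₁ m₂ U)ᴴ = 1 := mul_eq_one_comm.1 hU1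
  refine ⟨m₁, m₂, hm, V * (amplify m₁ m₂ U)ᴴ, ?_, fun i => ?_⟩
  · rw [Matrix.conjTranspose_mul, Matrix.conjTranspose_conjTranspose, Matrix.mul_assoc,
      ← Matrix.mul_assoc Vᴴ, hV, Matrix.one_mul, hU2]
  · have h1 : V * (amplify m₁ m₂ U)ᴴ * amplify m₁ m₂ (rankOneProj (v i)) *
        (V * (amplify m₁ m₂ U)ᴴ)ᴴ = V * amplify m₁ m₂ (S.M i) * Vᴴ := by
      rw [hM, amplify_mul, amplify_mul, ← amplify_conjTranspose, Matrix.conjTranspose_mul,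
        Matrix.conjTranspose_conjTranspose]
      calc _ = V * ((amplify m₁ m₂ U)ᴴ * amplify m₁ m₂ U) * amplify m₁ m₂ (S.M i) *
            ((amplify m₁ m₂ U)ᴴ * amplify m₁ m₂ U) * Vᴴ := by simp only [Matrix.mul_assoc]
        _ = _ := by rw [hU1, Matrix.mul_one, Matrix.mul_one]
    rw [h1]
    exact hVP i

/-- Robust certification from approximate relations with an error of order `√ε`. -/
lemma RigidSystem.exists_isNear_of_approx_sqrt {n d : ℕ} [NeZero d] (S : RigidSystem n d) {K : ℝ}
    (hK : 0 < K) : ∃ C η₀ : ℝ, 0 < η₀ ∧ ∀ ε : ℝ, √ε ≤ η₀ →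
      ∀ (D : ℕ) (P : Fin n → Matrix (Fin D) (Fin D) ℂ), S.Approx (K * √ε) P →
        S.IsNear (C * √ε) P := by
  obtain ⟨C, η₀, hη₀, h⟩ := S.exists_isNear_of_approx
  refine ⟨C * K, η₀ / K, by positivity, fun ε hε D P hP => ?_⟩
  rw [mul_assoc]
  rw [le_div_iff₀ hK] at hε
  exact h D _ P (by positivity) hP (by linarith)

theorem robustCFR_peres24 :
    RobustCFR peres24 (fun _ => 1) 6 (fun _ => True) 0.177 (1 / 2) := by
  obtain ⟨C, η₀, hη₀, h⟩ := peresSystem.exists_isNear_of_approx_sqrt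
    (K := 1 + (4 + (24 : ℕ) * (4 : ℕ) ^ 2)) (by norm_num)
  refine peresSystem.robustCFR peres24_ne (U := 1) (by simp) (fun i => by simp [peresSystem])
    peres24_isRealization trivial ⟨C, η₀, hη₀, fun ε hε hε₀ hs D P hP _ => h ε hs D P ?_⟩
  exact peres_approx hε (hε₀.le.trans (by norm_num)) hP

theorem robustCFR_ceg18 :
    RobustCFR ceg18 (fun _ => 1) (9 / 2) (fun _ => True) 0.134 (1 / 2) := by
  obtain ⟨C, η₀, hη₀, h⟩ := cegSystem.exists_isNear_of_approx_sqrt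
    (K := 1 + (2 + (9 : ℕ) * (4 : ℕ) ^ 2)) (by norm_num)
  refine cegSystem.robustCFR ceg18_ne cegRotation_isometry rankOneProj_ceg18
    ceg18_isRealization trivial ⟨C, η₀, hη₀, fun ε hε hε₀ hs D P hP _ => h ε hs D P ?_⟩
  exact ceg_approx hε (hε₀.le.trans (by norm_num)) hP

theorem robustCFR_yo13 : RobustCFR yo13 yo13Weight (35 / 3)
    (NormalizedTriples (orthGraph yo13)) 0.208 (1 / 2) := by
  obtain ⟨C, η₀, hη₀, h⟩ := yoSystem.exists_isNear_of_hasSmallDefect (1 / 2)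
  exact yoSystem.robustCFR yo13_ne (U := 1) (by simp) (fun i => by simp [yoSystem])
    yo13_isRealization yo13_normalizedTriples ⟨C, η₀, hη₀, fun ε hε _ hs D P hP hn =>
      h D _ P (Real.sqrt_nonneg _) (yo_hasSmallDefect hε hP hn) hs⟩

theorem robustCFR_bbc21 :
    RobustCFR bbc21 bbc21Weight 40 (fun _ => True) 0.132 (1 / 2) := by
  obtain ⟨C, η₀, hη₀, h⟩ := bbcSystem.exists_isNear_of_hasSmallDefect (1 / 4)
  exact bbcSystem.robustCFR bbc21_ne (U := 1) (by simp) (fun i => by simp [bbcSystem])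
    bbc21_isRealization trivial ⟨C, η₀, hη₀, fun ε hε _ hs D P hP _ =>
      h D _ P (Real.sqrt_nonneg _) (bbc_hasSmallDefect hε hP) hs⟩

end CFR

theorem mainTheorem3 :
    CFR.RobustCFR CFR.bbc21 CFR.bbc21Weight 40 (fun _ => True) 0.132 (1 / 2) ∧
    CFR.RobustCFR CFR.ceg18 (fun _ => 1) (9 / 2) (fun _ => True) 0.134 (1 / 2) ∧
    CFR.RobustCFR CFR.peres24 (fun _ => 1) 6 (fun _ => True) 0.177 (1 / 2) ∧
    CFR.RobustCFR CFR.yo13 CFR.yo13Weight (35 / 3)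
      (CFR.NormalizedTriples (CFR.orthGraph CFR.yo13)) 0.208 (1 / 2) :=
  ⟨CFR.robustCFR_bbc21, CFR.robustCFR_ceg18, CFR.robustCFR_peres24, CFR.robustCFR_yo13⟩
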